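/- Let $\mathbb G$ be a Carnot group of step $s\ge 3$, i.e. a connected, simply connected real Lie group whose Lie algebra $\mathfrak g$ is equipped with a stratification $\mathfrak g=\mathfrak g_1\oplus\dots\oplus\mathfrak g_s$, $\mathfrak g_{i+1}=[\mathfrak g_1,\mathfrak g_i]$ for $1\le i\le s-1$, $[\mathfrak g,\mathfrak g_s]=\{0\}$, $\mathfrak g_s\neq\{0\}$. For $u\in L^1([0,1],\mathfrak g_1)$ let $\gamma_u:[0,1]\to\mathbb G$ be the absolutely continuous curve with $\gamma_u(0)=e$ and $\gamma_u'(t)=(dL_{\gamma_u(t)})_e\,u(t)$ for a.e. $t$, let $F(u)=\gamma_u(1)$ be the endpoint map, and let $$\mathrm{Abn}_{\mathbb G}=\{F(u) : u\in L^1([0,1],\mathfrak g_1),\ d_uF \text{ is not surjective}\}$$ be the abnormal set. Assume that $\mathbb G$ is filiform, with a basis $X_1,\dots,X_{s+1}$ of $\mathfrak g$ such that $\mathfrak g_1=\mathrm{span}\{X_1,X_2\}$ and $\mathfrak g_j=\mathrm{span}\{X_{j+1}\}$ for $2\le j\le s$. (i) Suppose $\mathbb G$ is of type I, i.e. the only non-trivial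 bracket relations are $[X_1,X_j]=X_{j+1}$ for $2\le j\le s$. Then $\mathrm{Abn}_{\mathbb G}$ is the horizontal line $\{\exp(tX_2) : t\in\mathbb R\}$. (ii) Suppose $\mathbb G$ is of type II, i.e. $s\ge5$ is odd and the only non-trivial bracket relations are $[X_1,X_j]=X_{j+1}$ for $2\le j\le s-1$ and $[X_i,X_{s+2-i}]=(-1)^iX_{s+1}$ for $2\le i\le s$. Then $$\mathrm{Abn}_{\mathbb G}=\{\exp(aX_2)\exp(bX_1)\exp(cX_2) : a,b,c\in\mathbb R\},$$ and this set is algebraic (constructible) of dimension $3$: in the exponential coordinates $x\mapsto\exp(x_1X_1+\dots+x_{s+1}X_{s+1})$, its Zariski closure $W\subseteq\mathbb R^{s+1}$ is an irreducible real algebraic variety of dimension $3$, and $\mathrm{Abn}_{\mathbb G}$ is the union of a non-empty Zariski-open subset $W\cap\{f\ne0\}$ of $W$ ($f$ a polynomial) and a real algebraic set. -/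

import Mathlib

open scoped Manifold ContDiff
open MeasureTheory Set

noncomputable section

section LieGroupBasics

variable {E : Type*} [NormedAddCommGroup E] [NormedSpace ℝ E]
  {G : Type*} [TopologicalSpace G] [ChartedSpace E G] [Group G]

/-- A smooth real Lie group has the regularity under which Mathlib constructs its Lie algebra. -/
instance lieGroupMinSmoothness [LieGroup 𝓘(ℝ, E) ∞ G] :
    LieGroup 𝓘(ℝ, E) (minSmoothness ℝ 3) G := by
  rw [minSmoothness_of_isRCLikeNormedField]
  infer_instance

/-- The Lie algebra of a finite-dimensional Lie group is finite-dimensional. -/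
instance finiteDimensionalGroupLieAlgebra [FiniteDimensional ℝ E] :
    FiniteDimensional ℝ (GroupLieAlgebra 𝓘(ℝ, E) G) :=
  inferInstanceAs (FiniteDimensional ℝ E)

open Classical in
/-- The exponential map of a Lie group: `exp v = γ(1)`, where `γ : ℝ → G` is the integral curve of
the left-invariant vector field generated by `v`, with `γ(0) = 1`. (Such a curve exists and is
unique in every Hausdorff Lie group.) -/
def lieExp (v : GroupLieAlgebra 𝓘(ℝ, E) G) : G :=
  if h : ∃ γ : ℝ → G, γ 0 = 1 ∧ IsMIntegralCurve (I := 𝓘(ℝ, E)) γ (mulInvariantVectorField v)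
  then h.choose 1 else 1

end LieGroupBasics

/-- A stratification of step `s` of a real Lie algebra `𝔤`:
`𝔤 = 𝔤₁ ⊕ ⋯ ⊕ 𝔤ₛ`, `𝔤ᵢ₊₁ = [𝔤₁, 𝔤ᵢ]` for `1 ≤ i ≤ s - 1`, `[𝔤, 𝔤ₛ] = 0` and `𝔤ₛ ≠ 0`.
Here `𝔤ᵢ` is `layer i`; only the indices `1, …, s` are meaningful.
A Carnot group is a (connected and) simply connected Lie group together with a stratification of
its Lie algebra, which is then automatically nilpotent. -/
structure Stratification (𝔤 : Type*) [LieRing 𝔤] [LieAlgebra ℝ 𝔤] (s : ℕ) where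
  layer : ℕ → Submodule ℝ 𝔤
  isInternal : DirectSum.IsInternal fun i : Fin s => layer (i + 1)
  layer_succ : ∀ i, 1 ≤ i → i + 1 ≤ s →
    layer (i + 1) = Submodule.span ℝ {z | ∃ x ∈ layer 1, ∃ y ∈ layer i, ⁅x, y⁆ = z}
  lie_layer_last : ∀ x : 𝔤, ∀ y ∈ layer s, ⁅x, y⁆ = 0
  layer_last_ne_bot : layer s ≠ ⊥

section Filiform

variable {𝔤 : Type*} [LieRing 𝔤] [LieAlgebra ℝ 𝔤] {s : ℕ}

/-- The basis `X₁, …, Xₛ₊₁` is adapted to a filiform stratification: `𝔤₁ = span {X₁, X₂}` and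
`𝔤ⱼ = span {Xⱼ₊₁}` for `2 ≤ j ≤ s`. In particular `dim 𝔤₁ = 2` and
`dim 𝔤₂ = ⋯ = dim 𝔤ₛ = 1`, i.e. the stratified Lie algebra is filiform.
Indices are shifted by one: `X i` in the code is the vector `Xᵢ₊₁` of the text. -/
structure IsFiliformBasis (S : Stratification 𝔤 s) (X : Module.Basis (Fin (s + 1)) ℝ 𝔤) :
    Prop where
  layer_one : S.layer 1 = Submodule.span ℝ {X 0, X 1}
  layer_eq : ∀ j : Fin (s + 1), 2 ≤ j.val → S.layer j.val = Submodule.span ℝ {X j}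

/-- The stratified Lie algebra is filiform of type I, with adapted basis `X₁, …, Xₛ₊₁`: the only
non-trivial bracket relations are `[X₁, Xⱼ] = Xⱼ₊₁` for `2 ≤ j ≤ s`.
(`X i` in the code is `Xᵢ₊₁`.) -/
structure IsTypeI (S : Stratification 𝔤 s) (X : Module.Basis (Fin (s + 1)) ℝ 𝔤) : Prop
    extends IsFiliformBasis S X where
  lie_first : ∀ j k : Fin (s + 1), 1 ≤ j.val → k.val = j.val + 1 → ⁅X 0, X j⁆ = X k
  lie_first_last : ⁅X 0, X (Fin.last s)⁆ = 0
  lie_eq_zero : ∀ i j : Fin (s + 1), 1 ≤ i.val → 1 ≤ j.val → ⁅X i, X j⁆ = 0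

/-- The stratified Lie algebra is filiform of type II, with adapted basis `X₁, …, Xₛ₊₁`: the step
`s ≥ 5` is odd, and the only non-trivial bracket relations are
`[X₁, Xⱼ] = Xⱼ₊₁` for `2 ≤ j ≤ s - 1` and `[Xᵢ, Xₛ₊₂₋ᵢ] = (-1)ⁱ Xₛ₊₁` for `2 ≤ i ≤ s`.
(`X i` in the code is `Xᵢ₊₁`.) -/
structure IsTypeII (S : Stratification 𝔤 s) (X : Module.Basis (Fin (s + 1)) ℝ 𝔤) : Prop
    extends IsFiliformBasis S X where
  five_le : 5 ≤ s
  odd : Odd s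
  lie_first : ∀ j k : Fin (s + 1), 1 ≤ j.val → k.val = j.val + 1 → k.val + 1 ≤ s →
    ⁅X 0, X j⁆ = X k
  lie_first_eq_zero : ∀ j : Fin (s + 1), s ≤ j.val + 1 → ⁅X 0, X j⁆ = 0
  lie_eq_last : ∀ i j : Fin (s + 1), 1 ≤ i.val → 1 ≤ j.val → i.val + j.val = s →
    ⁅X i, X j⁆ = (-1 : ℝ) ^ (i.val + 1) • X (Fin.last s)
  lie_eq_zero : ∀ i j : Fin (s + 1), 1 ≤ i.val → 1 ≤ j.val → i.val + j.val ≠ s → ⁅X i, X j⁆ = 0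

end Filiform

/-- The Banach space `L¹([0,1], ℝʳ)` of controls; a basis `Y₁, …, Yᵣ` of the first layer `𝔤₁`
identifies it with `L¹([0,1], 𝔤₁)`. -/
abbrev Control (r : ℕ) : Type :=
  Lp (EuclideanSpace ℝ (Fin r)) 1 (volume.restrict (Icc (0 : ℝ) 1))

section Endpoint

variable {E : Type*} [NormedAddCommGroup E] [NormedSpace ℝ E]
  {G : Type*} [TopologicalSpace G] [ChartedSpace E G] [Group G] {r : ℕ}

/-- `γ` (restricted to `[0,1]`) is the horizontal curve from the identity with control `u` in the
frame `Y`: it is an absolutely continuous curve, `γ(0) = 1`, and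
`γ'(t) = (dL_{γ(t)})₁ (∑ᵢ uᵢ(t) Yᵢ)` for a.e. `t ∈ [0,1]`. A continuous curve in a manifold is
absolutely continuous iff its composition with every smooth function is. -/
structure IsHorizontalCurve (Y : Fin r → GroupLieAlgebra 𝓘(ℝ, E) G) (u : Control r)
    (γ : ℝ → G) : Prop where
  map_zero : γ 0 = 1
  continuousOn : ContinuousOn γ (Icc 0 1)
  absolutelyContinuous : ∀ φ : G → ℝ, ContMDiff 𝓘(ℝ, E) 𝓘(ℝ, ℝ) ∞ φ →
    AbsolutelyContinuousOnInterval (φ ∘ γ) 0 1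
  hasDeriv : ∀ᵐ t ∂(volume.restrict (Icc (0 : ℝ) 1)),
    HasMFDerivAt 𝓘(ℝ, ℝ) 𝓘(ℝ, E) γ t
      ((1 : ℝ →L[ℝ] ℝ).smulRight (mulInvariantVectorField (∑ i, (u t) i • Y i) (γ t)))

open Classical in
/-- The endpoint map `F : L¹([0,1], 𝔤₁) → G`, `F(u) = γ_u(1)`, in the frame `Y` of `𝔤₁`. (The
horizontal curve `γ_u` exists and is unique on `[0,1]` for every control `u`.) -/
def endpointMap (Y : Fin r → GroupLieAlgebra 𝓘(ℝ, E) G) (u : Control r) : G :=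
  if h : ∃ γ : ℝ → G, IsHorizontalCurve Y u γ then h.choose 1 else 1

/-- A control is singular if the differential of the endpoint map at it is not surjective. -/
def IsSingularControl (Y : Fin r → GroupLieAlgebra 𝓘(ℝ, E) G) (u : Control r) : Prop :=
  ¬ Function.Surjective (mfderiv 𝓘(ℝ, Control r) 𝓘(ℝ, E) (endpointMap Y) u)

/-- The abnormal set `Abn_G` of a Carnot group: the set of critical values of the endpoint map,
i.e. the endpoints `γ_u(1)` for `u` a singular control. (The identification of `𝔤₁` with `ℝʳ`
uses some basis of `𝔤₁`; the resulting set does not depend on it.) -/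
def abnormalSet [FiniteDimensional ℝ E] [LieGroup 𝓘(ℝ, E) ∞ G] {s : ℕ}
    (S : Stratification (GroupLieAlgebra 𝓘(ℝ, E) G) s) : Set G :=
  let Y := fun i => (Module.finBasis ℝ (S.layer 1) i : GroupLieAlgebra 𝓘(ℝ, E) G)
  endpointMap Y '' {u | IsSingularControl Y u}

/-- The set `A ⊆ G` in the exponential coordinates `x ↦ exp (∑ᵢ xᵢ Xᵢ)` of a basis `X` of the Lie
algebra. -/
def inExpCoordinates {ι : Type*} [Fintype ι] (X : ι → GroupLieAlgebra 𝓘(ℝ, E) G) (A : Set G) :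
    Set (ι → ℝ) :=
  {x | lieExp (∑ i, x i • X i) ∈ A}

end Endpoint

/-- The Zariski closure `W` of `A ⊆ ℝⁿ` (the zero locus of the ideal of `A`) is an irreducible real
algebraic variety of dimension `d`, and `A` fills `W` up to a lower-dimensional set: `A` is the
union of the non-empty Zariski-open subset `W ∩ {f ≠ 0}` of `W` and of an algebraic set (the zero
locus of `J`). In particular `A` is Zariski-constructible. -/
structure IsConstructibleOfDim {ι : Type*} (A : Set (ι → ℝ)) (d : ℕ) : Prop where
  irreducible : (MvPolynomial.vanishingIdeal ℝ A).IsPrime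
  dim_eq : ringKrullDim (MvPolynomial ι ℝ ⧸ MvPolynomial.vanishingIdeal ℝ A) = d
  constructible : ∃ f ∉ MvPolynomial.vanishingIdeal ℝ A, ∃ J : Ideal (MvPolynomial ι ℝ),
    A = {x | x ∈ MvPolynomial.zeroLocus ℝ (MvPolynomial.vanishingIdeal ℝ A) ∧
          MvPolynomial.eval x f ≠ 0} ∪ MvPolynomial.zeroLocus ℝ J

end

/-!
# The abnormal set of filiform Carnot groups

Both types of filiform Lie algebras have the form `ℝ X₁ ⋉ V`, where `V` is spanned by the other
vectors of the basis, `X₁` acts on `V` by a nilpotent derivation `D`, and the bracket on `V` is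
`[v, w] = form(v, w) z` with `z` central and killed by `D` (`HeisenbergData`). The form is zero in
type I; in type II it is the alternating form with `form(e, Dᵐ e) = 1`, where `e = X₂` and
`m = s - 2`.

**Coordinates.** The set `V × ℝ` carries an explicit Lie group structure in which `(v, t)` stands
for `exp v * exp (t X₁)` (`HeisenbergData.mul`). The map `(v, t) ↦ exp v * exp (t X₁)` to `G` is a
homomorphism (`ofPair_mul`), since the adjoint action of a one-parameter subgroup solves a linear
differential equation (`adMap_expMap`), and it is a local diffeomorphism, hence a covering. As `G`
is simply connected it is a diffeomorphism (`bijective_ofPair`, `contMDiff_toPair`). In these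
coordinates the horizontal curve with control `q₁ X₁ + q₂ X₂` is given by `x = ∫ q₁` and
`p = ∫ q₂ exp (x D) e`, with the central correction `½ ∫ q₂ form(p, exp (x D) e)` (`endpointMap_eq`). As `D`
is nilpotent, this is a composition of polynomials and bounded integral operators on `L¹`, which
gives the differential of the endpoint map (`exists_hasFDerivAt_liftEndpoint`).

**Abnormal controls.** If the differential is not onto, a non-zero covector `μ` annihilates its
image, and testing with variations of `q₂` shows that the switching function `σ₀(t)`, the pairing of
`μ` transported to time `t` with `e`, vanishes identically (`exists_covector`). Write `σₖ` for the same
pairing with `Dᵏ e`; the derivative of `σₖ` is `q₁ σₖ₊₁ + μ(z) q₂ form(e, Dᵏ e)`. As long as the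
last term is zero, `σₖ = 0` implies `q₁ σₖ₊₁ = 0`, so that `σₖ₊₁²` is constant; hence `σₖ₊₁ = 0`
unless `q₁ = 0` (`switching_eq_zero`).

* In type I this forces `μ = 0` or `q₁ = 0`. The controls with `q₁ = 0` are indeed abnormal,
  because the last coordinate of the variation vanishes, and their endpoints are the points
  `exp (t X₂)` (`IsTypeOne.image_isAbnormal`).
* In type II the recursion runs up to `σₘ`, which is the affine function `σₘ(0) + μ(z) ∫ q₂` with
  `q₁ σₘ = 0`. So `q₁` is supported where the primitive of `q₂` takes one value `a`
  (`IsTypeTwo.exists_mul_eq_zero`). Such a curve ends at `exp (a X₂) exp (b X₁) exp (c X₂)`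
  (`liftEndpoint_eq_of_mul_eq_zero`), and conversely every such control is abnormal
  (`IsTypeTwo.isAbnormal`).

**Algebraicity.** The change from `exp (v + t X₁)` to `exp v * exp (t X₁)` is polynomial and
invertible with polynomial inverse (`expMap_lin`, `flowAvg_flowAvgInv`), so in exponential
coordinates the abnormal set of type II is the image of a polynomial map of `(a, b, c)`, whose
first three components are `b`, `a + c` and `b (c - a) / 2`. For `b ≠ 0` these determine `a`, `b`,
`c` rationally, and for `b = 0` the image is a line. Hence the image is the union of the open part
`x₁ ≠ 0` of its closure and of a line (`IsAbnormalParam.isConstructibleOfDim`). The ideal of the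
image is the kernel of a homomorphism to `ℝ[a, b, c]`, so it is prime; the dimension is at most
`3` by Noether normalization, and a chain of irreducible closed subsets shows that it is at least
`3`.
-/

noncomputable section

set_option linter.unusedSectionVars false

open Filter Topology

/-! ### Left translation to the identity -/

section LeftTrivialization

variable {E : Type*} [NormedAddCommGroup E] [NormedSpace ℝ E]
  {G : Type*} [TopologicalSpace G] [ChartedSpace E G] [Group G]

variable (E G) in
/-- The preferred chart at the identity. -/
def idChart : PartialEquiv G E := extChartAt 𝓘(ℝ, E) (1 : G)

variable (E) in
/-- The derivative at the identity of left translation by `g`, as a map between copies of the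
model space. -/
def leftDeriv (g : G) : E →L[ℝ] E := mfderiv 𝓘(ℝ, E) 𝓘(ℝ, E) (g * ·) (1 : G)

theorem one_mem_idChart_source : (1 : G) ∈ (idChart E G).source :=
  mem_extChartAt_source _

theorem idChart_source_mem : (idChart E G).source ∈ 𝓝 (1 : G) :=
  extChartAt_source_mem_nhds _

theorem idChart_target_mem :
    (idChart E G).target ∈ 𝓝 ((idChart E G) 1) :=
  extChartAt_target_mem_nhds _

theorem idChart_symm_idChart_one :
    (idChart E G).symm ((idChart E G) 1) = 1 :=
  (idChart E G).left_inv one_mem_idChart_source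

variable [LieGroup 𝓘(ℝ, E) ∞ G]

theorem contMDiff_leftMul (g : G) : ContMDiff 𝓘(ℝ, E) 𝓘(ℝ, E) ∞ (g * · : G → G) :=
  contMDiff_mul_left

theorem mdifferentiableAt_leftMul (g h : G) :
    MDifferentiableAt 𝓘(ℝ, E) 𝓘(ℝ, E) (g * · : G → G) h :=
  (contMDiff_leftMul g).mdifferentiableAt (by simp)

theorem contMDiffAt_idChart {g : G} (hg : g ∈ (idChart E G).source) :
    ContMDiffAt 𝓘(ℝ, E) 𝓘(ℝ, E) ∞ (idChart E G) g := by
  have : IsManifold 𝓘(ℝ, E) ∞ G := inferInstance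
  exact contMDiffAt_extChartAt' (by simpa [idChart] using hg)

theorem contMDiffAt_idChart_symm {a : E} (ha : a ∈ (idChart E G).target) :
    ContMDiffAt 𝓘(ℝ, E) 𝓘(ℝ, E) ∞ (idChart E G).symm a := by
  have : IsManifold 𝓘(ℝ, E) ∞ G := inferInstance
  exact (contMDiffOn_extChartAt_symm (1 : G)).contMDiffAt
    ((isOpen_extChartAt_target (I := 𝓘(ℝ, E)) (1 : G)).mem_nhds ha)

theorem hasMFDerivAt_idChart :
    HasMFDerivAt 𝓘(ℝ, E) 𝓘(ℝ, E) (idChart E G) 1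
      (ContinuousLinearMap.id ℝ E) := by
  have : IsManifold 𝓘(ℝ, E) 1 G := IsManifold.of_le (n := ∞) (by simp)
  have h := ((contMDiffAt_idChart (E := E) (G := G) one_mem_idChart_source).mdifferentiableAt
    (by simp)).hasMFDerivAt
  have h2 : mfderiv 𝓘(ℝ, E) 𝓘(ℝ, E) (extChartAt 𝓘(ℝ, E) (1 : G)) 1
      = ContinuousLinearMap.id ℝ E := mfderiv_extChartAt_self
  rw [show mfderiv 𝓘(ℝ, E) 𝓘(ℝ, E) (idChart E G) 1 = _ from h2] at h
  exact h

theorem hasMFDerivAt_idChart_symm :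
    HasMFDerivAt 𝓘(ℝ, E) 𝓘(ℝ, E) (idChart E G).symm
      ((idChart E G) 1) (ContinuousLinearMap.id ℝ E) := by
  have : IsManifold 𝓘(ℝ, E) 1 G := IsManifold.of_le (n := ∞) (by simp)
  have h := ((contMDiffAt_idChart_symm (E := E) (G := G)
    ((idChart E G).map_source one_mem_idChart_source)).mdifferentiableAt (by simp)).hasMFDerivAt
  have h2 := mfderivWithin_range_extChartAt_symm (I := 𝓘(ℝ, E)) (x := (1 : G))
  simp only [modelWithCornersSelf_coe, range_id, mfderivWithin_univ] at h2
  rw [show mfderiv 𝓘(ℝ, E) 𝓘(ℝ, E) (idChart E G).symm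
    ((idChart E G) 1) = _ from h2] at h
  exact h

variable {B : Type*} [NormedAddCommGroup B] [NormedSpace ℝ B]

theorem hasMFDerivAt_leftMul (g : G) :
    HasMFDerivAt 𝓘(ℝ, E) 𝓘(ℝ, E) (g * · : G → G) 1 (leftDeriv E g) :=
  (mdifferentiableAt_leftMul g 1).hasMFDerivAt

theorem leftDeriv_one : leftDeriv E (1 : G) = ContinuousLinearMap.id ℝ E := by
  have h := hasMFDerivAt_leftMul (E := E) (1 : G)
  rw [show ((1 : G) * ·) = (id : G → G) by ext x; simp] at h
  exact hasMFDerivAt_unique h (hasMFDerivAt_id (1 : G))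

/-- A map into a Lie group is differentiable at `u` iff its left translate to the identity is
differentiable in the chart at the identity, and the derivatives correspond by left translation. -/
theorem hasMFDerivAt_iff_leftTranslate {f : B → G} {u : B} {T : B →L[ℝ] E} :
    HasMFDerivAt 𝓘(ℝ, B) 𝓘(ℝ, E) f u ((leftDeriv E (f u)).comp T) ↔
      ContinuousAt f u ∧
        HasFDerivAt (fun w => (idChart E G) ((f u)⁻¹ * f w)) T u := by
  constructor
  · intro h
    refine ⟨h.continuousAt, ?_⟩
    have h1 := (mdifferentiableAt_leftMul (E := E) (f u)⁻¹ (f u)).hasMFDerivAt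
    have h2 : HasMFDerivAt 𝓘(ℝ, E) 𝓘(ℝ, E) (idChart E G) ((f u)⁻¹ * f u)
        (ContinuousLinearMap.id ℝ E) := by
      rw [inv_mul_cancel]; exact hasMFDerivAt_idChart
    have h3 := (h2.comp (f u) h1).comp u h
    have h4 : (leftDeriv E ((f u)⁻¹ * f u) : E →L[ℝ] E) =
        ContinuousLinearMap.comp (mfderiv 𝓘(ℝ, E) 𝓘(ℝ, E) ((f u)⁻¹ * · : G → G) (f u))
          (leftDeriv E (f u)) := by
      have h5 : HasMFDerivAt 𝓘(ℝ, E) 𝓘(ℝ, E) (f u * · : G → G) 1 (leftDeriv E (f u)) :=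
        hasMFDerivAt_leftMul (f u)
      have h1' : HasMFDerivAt 𝓘(ℝ, E) 𝓘(ℝ, E) ((f u)⁻¹ * · : G → G) (f u * 1)
          (mfderiv 𝓘(ℝ, E) 𝓘(ℝ, E) ((f u)⁻¹ * · : G → G) (f u)) := by
        rw [mul_one]; exact h1
      have h6 := h1'.comp 1 h5
      have h7 : ((f u)⁻¹ * · : G → G) ∘ (f u * ·) = (((f u)⁻¹ * f u) * ·) := by
        ext x; simp
      rw [h7] at h6
      have h8 := hasMFDerivAt_leftMul (E := E) ((f u)⁻¹ * f u)
      have h9 := hasMFDerivAt_unique h8 h6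
      exact h9
    rw [inv_mul_cancel, leftDeriv_one] at h4
    have h9 : HasMFDerivAt 𝓘(ℝ, B) 𝓘(ℝ, E)
        (fun w => (idChart E G) ((f u)⁻¹ * f w)) u T := by
      refine h3.congr_mfderiv ?_
      ext v
      exact (DFunLike.congr_fun h4 (T v)).symm
    exact h9.hasFDerivAt
  · rintro ⟨hc, h⟩
    have h1 : HasMFDerivAt 𝓘(ℝ, E) 𝓘(ℝ, E) (idChart E G).symm
        ((idChart E G) ((f u)⁻¹ * f u)) (ContinuousLinearMap.id ℝ E) := by
      rw [inv_mul_cancel]; exact hasMFDerivAt_idChart_symm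
    have h2 := h1.comp u h.hasMFDerivAt
    have h3 : HasMFDerivAt 𝓘(ℝ, E) 𝓘(ℝ, E) (f u * · : G → G)
        ((idChart E G).symm ((idChart E G) ((f u)⁻¹ * f u)))
        (leftDeriv E (f u)) := by
      rw [inv_mul_cancel, idChart_symm_idChart_one]; exact hasMFDerivAt_leftMul (f u)
    have h4 := h3.comp u h2
    have h5 : f =ᶠ[𝓝 u] ((f u * · : G → G) ∘ (idChart E G).symm ∘
        fun w => (idChart E G) ((f u)⁻¹ * f w)) := by
      have h6 : Tendsto (fun w => (f u)⁻¹ * f w) (𝓝 u) (𝓝 1) := by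
        have : IsTopologicalGroup G := topologicalGroup_of_lieGroup 𝓘(ℝ, E) ∞
        have h7 : ContinuousAt (fun w => (f u)⁻¹ * f w) u := continuousAt_const.mul hc
        rwa [ContinuousAt, inv_mul_cancel] at h7
      filter_upwards [h6 (idChart_source_mem (E := E))] with w hw
      simp only [Function.comp_apply]
      rw [(idChart E G).left_inv hw, mul_inv_cancel_left]
    refine (h4.congr_of_eventuallyEq h5).congr_mfderiv ?_
    ext v
    rfl

end LeftTrivialization

/-! ### Left velocities and the adjoint action -/

section Velocity

variable {E : Type*} [NormedAddCommGroup E] [NormedSpace ℝ E]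
  {G : Type*} [TopologicalSpace G] [ChartedSpace E G] [Group G]

/-- The curve `γ` has left velocity `ξ` at time `t`: its derivative there is the value at `γ t` of
the left-invariant vector field generated by `ξ`. This is expressed in the chart at the identity,
after left translation by `(γ t)⁻¹`. -/
def HasLeftVelocity (γ : ℝ → G) (ξ : E) (t : ℝ) : Prop :=
  ContinuousAt γ t ∧ HasDerivAt (fun s => (idChart E G) ((γ t)⁻¹ * γ s)) ξ t

/-- The adjoint action of a Lie group on the model space of its tangent space at the identity. -/
def adMap (g : G) : E →L[ℝ] E :=
  fderiv ℝ (fun a => (idChart E G) (g * (idChart E G).symm a * g⁻¹))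
    ((idChart E G) 1)

variable [LieGroup 𝓘(ℝ, E) ∞ G]

theorem hasLeftVelocity_iff_hasMFDerivAt {γ : ℝ → G} {ξ : E} {t : ℝ} :
    HasLeftVelocity γ ξ t ↔ HasMFDerivAt 𝓘(ℝ, ℝ) 𝓘(ℝ, E) γ t
      ((1 : ℝ →L[ℝ] ℝ).smulRight (mulInvariantVectorField (I := 𝓘(ℝ, E)) (G := G) ξ (γ t))) := by
  have h1 := hasMFDerivAt_iff_leftTranslate (E := E) (f := γ) (u := t)
    (T := (1 : ℝ →L[ℝ] ℝ).smulRight ξ)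
  have h2 : (leftDeriv E (γ t)).comp ((1 : ℝ →L[ℝ] ℝ).smulRight ξ) =
      (1 : ℝ →L[ℝ] ℝ).smulRight (leftDeriv E (γ t) ξ) := by
    ext; simp
  have h3 : HasLeftVelocity γ ξ t ↔ ContinuousAt γ t ∧
      HasFDerivAt (fun w => (idChart E G) ((γ t)⁻¹ * γ w)) ((1 : ℝ →L[ℝ] ℝ).smulRight ξ) t := by
    rw [HasLeftVelocity, hasDerivAt_iff_hasFDerivAt]; rfl
  refine (h3.trans h1.symm).trans ⟨fun h => h.congr_mfderiv h2, fun h => h.congr_mfderiv h2.symm⟩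

theorem contDiffAt_idChart_comp {B : Type*} [NormedAddCommGroup B] [NormedSpace ℝ B] {f : B → G}
    {b : B} (hf : ContMDiffAt 𝓘(ℝ, B) 𝓘(ℝ, E) ∞ f b) (hb : f b ∈ (idChart E G).source) :
    ContDiffAt ℝ ∞ (fun x => (idChart E G) (f x)) b :=
  contMDiffAt_iff_contDiffAt.1 ((contMDiffAt_idChart hb).comp b hf)

theorem contMDiffAt_idChart_symm_one :
    ContMDiffAt 𝓘(ℝ, E) 𝓘(ℝ, E) ∞ (idChart E G).symm ((idChart E G) 1) :=
  contMDiffAt_idChart_symm ((idChart E G).map_source one_mem_idChart_source)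

variable (E G) in
/-- The group multiplication in the chart at the identity. -/
def chartMul (p : E × E) : E :=
  (idChart E G)
    ((idChart E G).symm p.1 * (idChart E G).symm p.2)

theorem contDiffAt_chartMul : ContDiffAt ℝ ∞ (chartMul E G)
    ((idChart E G) 1, (idChart E G) 1) := by
  refine contDiffAt_idChart_comp (f := fun p : E × E =>
    (idChart E G).symm p.1 * (idChart E G).symm p.2) ?_ ?_
  · have h1 : ContMDiffAt 𝓘(ℝ, E × E) 𝓘(ℝ, E) ∞ (fun p : E × E => (idChart E G).symm p.1)
        ((idChart E G) 1, (idChart E G) 1) :=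
      ContMDiffAt.comp (g := (idChart E G).symm) (f := Prod.fst) _ contMDiffAt_idChart_symm_one
        contDiffAt_fst.contMDiffAt
    have h2 : ContMDiffAt 𝓘(ℝ, E × E) 𝓘(ℝ, E) ∞ (fun p : E × E => (idChart E G).symm p.2)
        ((idChart E G) 1, (idChart E G) 1) :=
      ContMDiffAt.comp (g := (idChart E G).symm) (f := Prod.snd) _ contMDiffAt_idChart_symm_one
        contDiffAt_snd.contMDiffAt
    exact h1.mul h2
  · simp only [idChart_symm_idChart_one, mul_one]
    exact one_mem_idChart_source

theorem chartMul_one_left : ∀ᶠ a in 𝓝 ((idChart E G) 1),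
    chartMul E G ((idChart E G) 1, a) = a := by
  filter_upwards [idChart_target_mem] with a ha
  rw [chartMul, idChart_symm_idChart_one, one_mul, (idChart E G).right_inv ha]

theorem chartMul_one_right : ∀ᶠ a in 𝓝 ((idChart E G) 1),
    chartMul E G (a, (idChart E G) 1) = a := by
  filter_upwards [idChart_target_mem] with a ha
  rw [chartMul, idChart_symm_idChart_one, mul_one, (idChart E G).right_inv ha]

theorem hasFDerivAt_chartMul : HasFDerivAt (chartMul E G)
    (ContinuousLinearMap.fst ℝ E E + ContinuousLinearMap.snd ℝ E E)
    ((idChart E G) 1, (idChart E G) 1) := by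
  set e := (idChart E G) 1
  have h := (contDiffAt_chartMul (E := E) (G := G)).differentiableAt (by simp) |>.hasFDerivAt
  refine h.congr_fderiv ?_
  have h1 := HasFDerivAt.comp (g := chartMul E G) (f := fun a => (a, e)) e h
    (hasFDerivAt_prodMk_left e e)
  have h2 := HasFDerivAt.comp (g := chartMul E G) (f := fun a => (e, a)) e h
    (hasFDerivAt_prodMk_right e e)
  have h1' := ((hasFDerivAt_id e).congr_of_eventuallyEq
    (chartMul_one_right (E := E) (G := G))).unique h1
  have h2' := ((hasFDerivAt_id e).congr_of_eventuallyEq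
    (chartMul_one_left (E := E) (G := G))).unique h2
  ext v
  · simpa using (DFunLike.congr_fun h1' v).symm
  · simpa using (DFunLike.congr_fun h2' v).symm

theorem contDiffAt_conj (g : G) : ContDiffAt ℝ ∞
    (fun a => (idChart E G) (g * (idChart E G).symm a * g⁻¹))
    ((idChart E G) 1) := by
  refine contDiffAt_idChart_comp (f := fun a => g * (idChart E G).symm a * g⁻¹)
    ?_ ?_
  · exact (contMDiffAt_const.mul contMDiffAt_idChart_symm_one).mul contMDiffAt_const
  · simp only [idChart_symm_idChart_one, mul_one, mul_inv_cancel]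
    exact one_mem_idChart_source

theorem hasFDerivAt_conj (g : G) : HasFDerivAt
    (fun a => (idChart E G) (g * (idChart E G).symm a * g⁻¹))
    (adMap g) ((idChart E G) 1) :=
  ((contDiffAt_conj g).differentiableAt (by simp)).hasFDerivAt

theorem adMap_one : (adMap (1 : G) : E →L[ℝ] E) = ContinuousLinearMap.id ℝ E := by
  refine (hasFDerivAt_conj (1 : G)).unique ((hasFDerivAt_id _).congr_of_eventuallyEq ?_)
  filter_upwards [idChart_target_mem] with a ha
  rw [one_mul, inv_one, mul_one, (idChart E G).right_inv ha]; rfl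

theorem tendsto_inv_mul {X : Type*} [TopologicalSpace X] {γ : X → G} {t : X}
    (h : ContinuousAt γ t) (E : Type*) [NormedAddCommGroup E] [NormedSpace ℝ E]
    [ChartedSpace E G] [LieGroup 𝓘(ℝ, E) ∞ G] :
    Tendsto (fun s => (γ t)⁻¹ * γ s) (𝓝 t) (𝓝 1) := by
  have : IsTopologicalGroup G := topologicalGroup_of_lieGroup 𝓘(ℝ, E) ∞
  have h7 : ContinuousAt (fun w => (γ t)⁻¹ * γ w) t := continuousAt_const.mul h
  rwa [ContinuousAt, inv_mul_cancel] at h7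

theorem tendsto_conj {X : Type*} {k : X → G} {l : Filter X} (h : Tendsto k l (𝓝 1)) (g : G)
    (E : Type*) [NormedAddCommGroup E] [NormedSpace ℝ E]
    [ChartedSpace E G] [LieGroup 𝓘(ℝ, E) ∞ G] :
    Tendsto (fun s => g * k s * g⁻¹) l (𝓝 1) := by
  have : IsTopologicalGroup G := topologicalGroup_of_lieGroup 𝓘(ℝ, E) ∞
  have h7 := (h.const_mul g).mul_const g⁻¹
  rwa [mul_one, mul_inv_cancel] at h7

theorem adMap_mul (g h : G) : (adMap (g * h) : E →L[ℝ] E) = (adMap g).comp (adMap h) := by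
  have h1 : HasFDerivAt (fun a => (idChart E G) (g * (idChart E G).symm a * g⁻¹)) (adMap g)
      ((idChart E G) (h * (idChart E G).symm ((idChart E G) 1) * h⁻¹)) := by
    rw [idChart_symm_idChart_one, mul_one, mul_inv_cancel]; exact hasFDerivAt_conj g
  have h2 := HasFDerivAt.comp (g := fun a => (idChart E G) (g * (idChart E G).symm a * g⁻¹))
    (f := fun a => (idChart E G) (h * (idChart E G).symm a * h⁻¹)) ((idChart E G) 1) h1
    (hasFDerivAt_conj h)
  refine HasFDerivAt.unique ?_ h2
  refine (hasFDerivAt_conj (g * h)).congr_of_eventuallyEq ?_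
  have h3 : Tendsto (idChart E G).symm (𝓝 ((idChart E G) 1)) (𝓝 1) := by
    have := (contMDiffAt_idChart_symm_one (E := E) (G := G)).continuousAt
    rwa [ContinuousAt, idChart_symm_idChart_one] at this
  filter_upwards [tendsto_conj h3 h E (idChart_source_mem (E := E))] with a ha
  rw [Function.comp_apply, (idChart E G).left_inv ha]
  simp [mul_assoc]

/-- Product rule for left velocities: the velocity of the left factor is moved past the right
factor by the adjoint action. -/
theorem HasLeftVelocity.mul {γ η : ℝ → G} {ξ ζ : E} {t : ℝ} (hγ : HasLeftVelocity γ ξ t)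
    (hη : HasLeftVelocity η ζ t) :
    HasLeftVelocity (fun s => γ s * η s) (adMap (η t)⁻¹ ξ + ζ) t := by
  have : IsTopologicalGroup G := topologicalGroup_of_lieGroup 𝓘(ℝ, E) ∞
  refine ⟨hγ.1.mul hη.1, ?_⟩
  have h1 : HasFDerivAt
      (fun a => (idChart E G) ((η t)⁻¹ * (idChart E G).symm a * (η t)⁻¹⁻¹)) (adMap (η t)⁻¹)
      ((idChart E G) ((γ t)⁻¹ * γ t)) := by
    rw [inv_mul_cancel]; exact hasFDerivAt_conj _
  have h2 := HasFDerivAt.comp_hasDerivAt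
    (l := fun a => (idChart E G) ((η t)⁻¹ * (idChart E G).symm a * (η t)⁻¹⁻¹))
    (f := fun s => (idChart E G) ((γ t)⁻¹ * γ s)) t h1 hγ.2
  have h3 := h2.prodMk hη.2
  have h4 := HasFDerivAt.comp_hasDerivAt (l := chartMul E G) t (by
    simpa [idChart_symm_idChart_one] using hasFDerivAt_chartMul (E := E) (G := G)) h3
  refine (h4.congr_of_eventuallyEq ?_).congr_deriv (by simp)
  have t1 := tendsto_inv_mul hγ.1 E
  filter_upwards [t1 (idChart_source_mem (E := E)),
    tendsto_conj t1 (η t)⁻¹ E (idChart_source_mem (E := E)),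
    tendsto_inv_mul hη.1 E (idChart_source_mem (E := E))] with s hs1 hs2 hs3
  simp only [Function.comp_apply, chartMul]
  rw [(idChart E G).left_inv hs1, (idChart E G).left_inv hs2, (idChart E G).left_inv hs3]
  simp [mul_assoc]

theorem HasLeftVelocity.const (g : G) (t : ℝ) : HasLeftVelocity (fun _ => g) (0 : E) t :=
  ⟨continuousAt_const, hasDerivAt_const _ _⟩

theorem HasLeftVelocity.comp {γ : ℝ → G} {f : ℝ → ℝ} {ξ : E} {t f' : ℝ}
    (hγ : HasLeftVelocity γ ξ (f t)) (hf : HasDerivAt f f' t) :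
    HasLeftVelocity (fun s => γ (f s)) (f' • ξ) t :=
  ⟨ContinuousAt.comp (f := f) hγ.1 hf.continuousAt, HasDerivAt.scomp t hγ.2 hf⟩

theorem HasLeftVelocity.const_mul {γ : ℝ → G} {ξ : E} {t : ℝ} (hγ : HasLeftVelocity γ ξ t) (g : G) :
    HasLeftVelocity (fun s => g * γ s) ξ t := by
  simpa using (HasLeftVelocity.const g t).mul hγ

end Velocity

/-! ### The derivative of the adjoint action is the Lie bracket -/

section AdjointDerivative

variable {E : Type*} [NormedAddCommGroup E] [NormedSpace ℝ E]
  {G : Type*} [TopologicalSpace G] [ChartedSpace E G] [Group G]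

variable (G) in
/-- The Lie bracket of the Lie algebra of `G`, on the model space of its tangent space (to which
the type `GroupLieAlgebra` unfolds). -/
def modelBracket (X Y : E) : E :=
  Bracket.bracket (L := GroupLieAlgebra 𝓘(ℝ, E) G) (M := GroupLieAlgebra 𝓘(ℝ, E) G) X Y

variable (G) in
/-- The left-invariant vector field generated by `X`, in the chart at the identity. -/
def chartField (X : E) (a : E) : E :=
  fderiv ℝ (chartMul E G) (a, idChart E G 1) (0, X)

variable [LieGroup 𝓘(ℝ, E) ∞ G]

theorem eventually_contDiffAt_chartMul : ∀ᶠ p in 𝓝 (idChart E G 1, idChart E G 1),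
    ContDiffAt ℝ 1 (chartMul E G) p :=
  (contDiffAt_chartMul.of_le (by simp)).eventually (by simp)

theorem contDiffAt_chartField (X : E) : ContDiffAt ℝ ∞ (chartField G X) (idChart E G 1) := by
  have h1 : ContDiffAt ℝ ∞ (fderiv ℝ (chartMul E G)) (idChart E G 1, idChart E G 1) :=
    (contDiffAt_chartMul (E := E) (G := G)).fderiv_right (by simp)
  have h2 : ContDiffAt ℝ ∞ (fun a : E => (a, idChart E G 1)) (idChart E G 1) :=
    contDiffAt_id.prodMk contDiffAt_const
  have h3 : ContDiffAt ℝ ∞ (fun a : E => fderiv ℝ (chartMul E G) (a, idChart E G 1))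
    (idChart E G 1) := ContDiffAt.comp (idChart E G 1) h1 h2
  exact h3.clm_apply contDiffAt_const

theorem fderiv_chartField (X v : E) : fderiv ℝ (chartField G X) (idChart E G 1) v =
    fderiv ℝ (fderiv ℝ (chartMul E G)) (idChart E G 1, idChart E G 1) (v, 0) (0, X) := by
  have h1 : HasFDerivAt (fderiv ℝ (chartMul E G)) _ (idChart E G 1, idChart E G 1) :=
    (((contDiffAt_chartMul (E := E) (G := G)).fderiv_right (m := ∞) (by simp)).differentiableAt
      (by simp)).hasFDerivAt
  have h2 := HasFDerivAt.comp (g := fderiv ℝ (chartMul E G)) (f := fun a => (a, idChart E G 1))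
    (idChart E G 1) h1 (hasFDerivAt_prodMk_left _ _)
  have h3 := h2.clm_apply (hasFDerivAt_const ((0, X) : E × E) _)
  have h4 : HasFDerivAt (chartField G X) _ (idChart E G 1) := h3
  rw [h4.fderiv]
  simp

/-- The pullback of a left-invariant vector field to the chart at the identity, in terms of which
the bracket of the Lie algebra is defined, is `chartField`. -/
theorem mpullback_eq_chartField (X : E) : ∀ᶠ a in 𝓝 (idChart E G 1),
    VectorField.mpullbackWithin 𝓘(ℝ, E) 𝓘(ℝ, E) (extChartAt 𝓘(ℝ, E) (1 : G)).symm
      (mulInvariantVectorField (I := 𝓘(ℝ, E)) (G := G) X) (range 𝓘(ℝ, E)) a = chartField G X a := by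
  have : IsManifold 𝓘(ℝ, E) 1 G := IsManifold.of_le (n := ∞) (by simp)
  have hev : ∀ᶠ a in 𝓝 (idChart E G 1), ContDiffAt ℝ 1 (chartMul E G) (a, idChart E G 1) := by
    have h2 : ContinuousAt (fun a : E => (a, idChart E G 1)) (idChart E G 1) := by fun_prop
    exact h2.eventually eventually_contDiffAt_chartMul
  filter_upwards [idChart_target_mem (E := E) (G := G), hev] with a ha hda
  have ha' : a ∈ (extChartAt 𝓘(ℝ, E) (1 : G)).target := ha
  have i1 := mfderiv_extChartAt_comp_mfderivWithin_extChartAt_symm (I := 𝓘(ℝ, E)) ha'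
  have i2 := mfderivWithin_extChartAt_symm_comp_mfderiv_extChartAt (I := 𝓘(ℝ, E)) ha'
  have key : chartField G X a = mfderiv 𝓘(ℝ, E) 𝓘(ℝ, E) (extChartAt 𝓘(ℝ, E) (1 : G))
      ((idChart E G).symm a)
      (mulInvariantVectorField (I := 𝓘(ℝ, E)) (G := G) X ((idChart E G).symm a)) := by
    have e1 := HasFDerivAt.comp (g := chartMul E G) (f := fun b => (a, b)) (idChart E G 1)
      (hda.differentiableAt (by simp)).hasFDerivAt (hasFDerivAt_prodMk_right _ _)
    have f1 : HasMFDerivAt 𝓘(ℝ, E) 𝓘(ℝ, E) (idChart E G) ((idChart E G).symm a)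
        (mfderiv 𝓘(ℝ, E) 𝓘(ℝ, E) (idChart E G) ((idChart E G).symm a)) :=
      ((contMDiffAt_idChart ((idChart E G).map_target ha)).mdifferentiableAt (by simp)).hasMFDerivAt
    have f1' : HasMFDerivAt 𝓘(ℝ, E) 𝓘(ℝ, E) (idChart E G) ((idChart E G).symm a * 1)
        (mfderiv 𝓘(ℝ, E) 𝓘(ℝ, E) (idChart E G) ((idChart E G).symm a)) := by
      rw [mul_one]; exact f1
    have f2 := f1'.comp 1 (hasMFDerivAt_leftMul (E := E) ((idChart E G).symm a))
    have f2' : HasMFDerivAt 𝓘(ℝ, E) 𝓘(ℝ, E) ((idChart E G) ∘ ((idChart E G).symm a * ·))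
        ((idChart E G).symm (idChart E G 1))
        ((mfderiv 𝓘(ℝ, E) 𝓘(ℝ, E) (idChart E G) ((idChart E G).symm a)).comp
          (leftDeriv E ((idChart E G).symm a))) := by
      rw [idChart_symm_idChart_one]; exact f2
    have f3 := (f2'.comp (idChart E G 1) hasMFDerivAt_idChart_symm).hasFDerivAt
    have f4 := e1.unique f3
    have f5 := DFunLike.congr_fun f4 X
    have f6 : chartField G X a = _ := (show chartField G X a = _ by
      simp only [chartField, ContinuousLinearMap.comp_apply, ContinuousLinearMap.inr_apply]).trans f5
    exact f6
  rw [VectorField.mpullbackWithin_apply, ContinuousLinearMap.inverse_eq i2 i1]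
  exact key.symm

theorem modelBracket_eq (X Y : E) : modelBracket G X Y =
    fderiv ℝ (chartField G Y) (idChart E G 1) X - fderiv ℝ (chartField G X) (idChart E G 1) Y := by
  have : IsManifold 𝓘(ℝ, E) 1 G := IsManifold.of_le (n := ∞) (by simp)
  let F : E → E → E := fun Z a =>
    VectorField.mpullbackWithin 𝓘(ℝ, E) 𝓘(ℝ, E) (extChartAt 𝓘(ℝ, E) (1 : G)).symm
      (mulInvariantVectorField (I := 𝓘(ℝ, E)) (G := G) Z) (range 𝓘(ℝ, E)) a
  have h1 : modelBracket G X Y = (mfderiv 𝓘(ℝ, E) 𝓘(ℝ, E) (extChartAt 𝓘(ℝ, E) (1 : G)) 1).inverse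
    ((VectorField.lieBracketWithin ℝ (F X) (F Y)
      ((extChartAt 𝓘(ℝ, E) (1 : G)).symm ⁻¹' univ ∩ range 𝓘(ℝ, E)) (idChart E G 1)) : E) := rfl
  have h2 : ((extChartAt 𝓘(ℝ, E) (1 : G)).symm ⁻¹' univ ∩ range 𝓘(ℝ, E)) = univ := by simp
  rw [h2, VectorField.lieBracketWithin_univ] at h1
  have h3 : VectorField.lieBracket ℝ (F X) (F Y) (idChart E G 1) =
      VectorField.lieBracket ℝ (chartField G X) (chartField G Y) (idChart E G 1) :=
    Filter.EventuallyEq.lieBracket_vectorField_eq (mpullback_eq_chartField (G := G) X)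
      (mpullback_eq_chartField (G := G) Y)
  have h5 : chartField G Y (idChart E G 1) = Y ∧ chartField G X (idChart E G 1) = X := by
    simp [chartField, hasFDerivAt_chartMul.fderiv]
  have h6 : ∀ w : E, (mfderiv 𝓘(ℝ, E) 𝓘(ℝ, E) (extChartAt 𝓘(ℝ, E) (1 : G)) 1).inverse w = w := by
    intro w
    rw [mfderiv_extChartAt_self]
    exact DFunLike.congr_fun (ContinuousLinearMap.inverse_id (R := ℝ) (M := E)) w
  rw [h3] at h1
  refine h1.trans ((h6 _).trans ?_)
  change VectorField.lieBracket ℝ (chartField G X) (chartField G Y) (idChart E G 1) = _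
  rw [VectorField.lieBracket, h5.1, h5.2]

/-- The derivative of the adjoint action at the identity is the Lie bracket. Differentiating the
identity `(a b a⁻¹) a = a b` in `b` and then in `a` expresses it by the second derivative of the
multiplication, and the symmetry of that derivative gives the two terms of the bracket. -/
theorem HasLeftVelocity.hasDerivAt_adMap {γ : ℝ → G} {X : E} (hγ : HasLeftVelocity γ X 0)
    (h0 : γ 0 = 1) (Y : E) :
    HasDerivAt (fun t => adMap (γ t) Y) (modelBracket G X Y) 0 := by
  set e := idChart E G 1 with he
  -- Conjugation in the chart.
  let C : E × E → E := fun p => idChart E G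
    ((idChart E G).symm p.1 * (idChart E G).symm p.2 * ((idChart E G).symm p.1)⁻¹)
  have k1 : ContMDiffAt 𝓘(ℝ, E × E) 𝓘(ℝ, E) ∞ (fun p : E × E => (idChart E G).symm p.1) (e, e) :=
    ContMDiffAt.comp (g := (idChart E G).symm) (f := Prod.fst) (e, e) contMDiffAt_idChart_symm_one
      contDiffAt_fst.contMDiffAt
  have k2 : ContMDiffAt 𝓘(ℝ, E × E) 𝓘(ℝ, E) ∞ (fun p : E × E => (idChart E G).symm p.2) (e, e) :=
    ContMDiffAt.comp (g := (idChart E G).symm) (f := Prod.snd) (e, e) contMDiffAt_idChart_symm_one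
      contDiffAt_snd.contMDiffAt
  have k3 := (k1.mul k2).mul (k1.inv)
  have hC : ContDiffAt ℝ ∞ C (e, e) := by
    refine contDiffAt_idChart_comp k3 ?_
    simp only [he, idChart_symm_idChart_one, mul_one, inv_one]
    exact one_mem_idChart_source
  let A : E → E := fun a => fderiv ℝ C (a, e) (0, Y)
  have hpair : ContinuousAt (fun a : E => (a, e)) e := by fun_prop
  have hpair' : ContinuousAt (fun a : E => (e, a)) e := by fun_prop
  have hA : DifferentiableAt ℝ A e := by
    have h1 : ContDiffAt ℝ ∞ (fderiv ℝ C) (e, e) := hC.fderiv_right (by simp)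
    have h2 : ContDiffAt ℝ ∞ (fun a : E => fderiv ℝ C (a, e)) e :=
      ContDiffAt.comp e h1 (contDiffAt_id.prodMk contDiffAt_const)
    exact (h2.clm_apply contDiffAt_const).differentiableAt (by simp)
  have hCev : ∀ᶠ a in 𝓝 e, ContDiffAt ℝ 1 C (a, e) :=
    hpair.eventually ((hC.of_le (by simp)).eventually (by simp))
  have hAad : ∀ᶠ a in 𝓝 e, adMap ((idChart E G).symm a) Y = A a := by
    filter_upwards [hCev] with a ha
    have e1 := HasFDerivAt.comp (g := C) (f := fun b => (a, b)) e
      (ha.differentiableAt (by simp)).hasFDerivAt (hasFDerivAt_prodMk_right _ _)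
    have e2 := (hasFDerivAt_conj ((idChart E G).symm a)).unique e1
    simpa using DFunLike.congr_fun e2 Y
  have hM : ContDiffAt ℝ ∞ (chartMul E G) (e, e) := contDiffAt_chartMul
  have hCe : ∀ a, C (a, e) = e := by
    intro a; simp only [C, he, idChart_symm_idChart_one]; simp
  -- The identity `(a b a⁻¹) a = a b`, in the chart.
  have hid : ∀ᶠ p in 𝓝 (e, e), chartMul E G (C p, p.1) = chartMul E G p := by
    have h1 : ∀ᶠ p in 𝓝 (e, e), (idChart E G).symm p.1 * (idChart E G).symm p.2 *
        ((idChart E G).symm p.1)⁻¹ ∈ (idChart E G).source := by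
      have := k3.continuousAt
      rw [ContinuousAt] at this
      refine this ?_
      simp only [Pi.mul_apply, he, idChart_symm_idChart_one, mul_one, inv_one]
      exact idChart_source_mem
    filter_upwards [h1] with p hp
    simp only [chartMul, C]
    rw [(idChart E G).left_inv hp]
    simp
  have hMev : ∀ᶠ a in 𝓝 e, ContDiffAt ℝ 1 (chartMul E G) (a, e) :=
    hpair.eventually ((hM.of_le (by simp)).eventually (by simp))
  have hMev' : ∀ᶠ a in 𝓝 e, ContDiffAt ℝ 1 (chartMul E G) (e, a) :=
    hpair'.eventually ((hM.of_le (by simp)).eventually (by simp))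
  have hdid : ∀ᶠ a in 𝓝 e, fderiv ℝ (chartMul E G) (e, a) (A a, 0) = chartField G Y a := by
    have h1 := hpair.eventually hid.eventually_nhds
    filter_upwards [h1, hMev, hMev', hCev] with a ha1 ha2 ha3 ha4
    have e1 := HasFDerivAt.comp (g := C) (f := fun b => (a, b)) e
      (ha4.differentiableAt (by simp)).hasFDerivAt (hasFDerivAt_prodMk_right _ _)
    have e2 := e1.prodMk (hasFDerivAt_const a e)
    have e3 := HasFDerivAt.comp (g := chartMul E G) (f := fun b => (C (a, b), a)) e
      (by rw [hCe]; exact (ha3.differentiableAt (by simp)).hasFDerivAt) e2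
    have e4 := HasFDerivAt.comp (g := chartMul E G) (f := fun b => (a, b)) e
      (ha2.differentiableAt (by simp)).hasFDerivAt (hasFDerivAt_prodMk_right _ _)
    have e5 : (fun b => chartMul E G (C (a, b), a)) =ᶠ[𝓝 e] fun b => chartMul E G (a, b) := by
      have : ContinuousAt (fun b : E => (a, b)) e := by fun_prop
      exact this.eventually ha1
    have e6 := (e3.congr_of_eventuallyEq e5.symm).unique e4
    have e7 := DFunLike.congr_fun e6 Y
    simpa [A, chartField] using e7
  have hA0 : A e = Y := by
    rw [← hAad.self_of_nhds, he, idChart_symm_idChart_one, adMap_one]; rfl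
  -- The derivative of `hdid` at the origin of the chart.
  have hder : modelBracket G X Y = fderiv ℝ A e X := by
    have h1 : HasFDerivAt (fderiv ℝ (chartMul E G)) _ (e, e) :=
      ((hM.fderiv_right (m := ∞) (by simp)).differentiableAt (by simp)).hasFDerivAt
    have h2 := HasFDerivAt.comp (g := fderiv ℝ (chartMul E G)) (f := fun a => (e, a))
      e h1 (hasFDerivAt_prodMk_right _ _)
    have h3 := h2.clm_apply (hA.hasFDerivAt.prodMk (hasFDerivAt_const (0 : E) e))
    have h4 := (h3.congr_of_eventuallyEq (hdid.mono fun a h => h.symm)).fderiv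
    have h5 := DFunLike.congr_fun h4 X
    have h6 : IsSymmSndFDerivAt ℝ (chartMul E G) (e, e) :=
      hM.isSymmSndFDerivAt (by
        rw [minSmoothness_of_isRCLikeNormedField]; exact WithTop.coe_le_coe.2 le_top)
    have h7 := h6.eq (0, X) (Y, 0)
    rw [modelBracket_eq, fderiv_chartField X Y, ← he, h5, ← h7]
    have hA0' := hA0
    rw [he] at hA0'
    simp [hasFDerivAt_chartMul.fderiv, he, hA0']
  have hg : HasDerivAt (fun s => idChart E G (γ s)) X 0 := by simpa [h0] using hγ.2
  have hc : HasDerivAt (A ∘ fun s => idChart E G (γ s)) (fderiv ℝ A e X) 0 :=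
    HasFDerivAt.comp_hasDerivAt (l := A) 0 (by rw [h0]; exact hA.hasFDerivAt) hg
  rw [hder]
  refine hc.congr_of_eventuallyEq ?_
  have hs : ∀ᶠ s in 𝓝 (0 : ℝ), γ s ∈ (idChart E G).source :=
    hγ.1 (by rw [h0]; exact idChart_source_mem)
  have hcont : ContinuousAt (fun s => idChart E G (γ s)) 0 := hg.continuousAt
  have hs2 : ∀ᶠ s in 𝓝 (0 : ℝ), adMap ((idChart E G).symm (idChart E G (γ s))) Y =
      A (idChart E G (γ s)) := hcont.eventually (by simpa only [h0] using hAad)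
  filter_upwards [hs, hs2] with s h1 h2
  rw [Function.comp_apply, ← h2, (idChart E G).left_inv h1]

end AdjointDerivative

/-! ### The exponential map -/

section Exponential

variable {E : Type*} [NormedAddCommGroup E] [NormedSpace ℝ E]
  {G : Type*} [TopologicalSpace G] [ChartedSpace E G] [Group G]

variable (G) in
/-- The exponential map, on the model space of the Lie algebra. -/
def expMap (v : E) : G := lieExp (E := E) (G := G) v

variable [LieGroup 𝓘(ℝ, E) ∞ G]

theorem contMDiff_one_mulInvariantVectorField (v : E) :
    ContMDiff 𝓘(ℝ, E) 𝓘(ℝ, E).tangent 1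
      (fun g : G => (⟨g, mulInvariantVectorField (I := 𝓘(ℝ, E)) v g⟩ :
        TangentBundle 𝓘(ℝ, E) G)) := by
  have h := contMDiff_mulInvariantVectorField (I := 𝓘(ℝ, E)) (G := G) v
  refine h.of_le ?_
  rw [minSmoothness_of_isRCLikeNormedField]
  norm_num

theorem isMIntegralCurve_iff_hasLeftVelocity {γ : ℝ → G} {v : E} :
    IsMIntegralCurve (I := 𝓘(ℝ, E)) γ (mulInvariantVectorField (I := 𝓘(ℝ, E)) v) ↔
      ∀ t, HasLeftVelocity γ v t :=
  forall_congr' fun _ => hasLeftVelocity_iff_hasMFDerivAt.symm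

variable [FiniteDimensional ℝ E] [T2Space G]

/-- Left-invariant vector fields are complete. -/
theorem exists_hasLeftVelocity (v : E) :
    ∃ γ : ℝ → G, γ 0 = 1 ∧ ∀ t, HasLeftVelocity γ v t := by
  have : CompleteSpace E := FiniteDimensional.complete ℝ E
  have : IsManifold 𝓘(ℝ, E) 1 G := IsManifold.of_le (n := ∞) (by simp)
  obtain ⟨γ, h0, hγ⟩ := exists_isMIntegralCurveAt_of_contMDiffAt_boundaryless (t₀ := (0 : ℝ))
    ((contMDiff_one_mulInvariantVectorField (G := G) v).contMDiffAt (x := (1 : G)))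
  obtain ⟨ε, hε, hball⟩ := Metric.eventually_nhds_iff.1 hγ
  have hv : ∀ t ∈ Ioo (-ε) ε, HasLeftVelocity γ v t := fun t ht =>
    hasLeftVelocity_iff_hasMFDerivAt.2 (hball (by simpa [abs_lt] using ht))
  obtain ⟨η, h1, h2⟩ := exists_isMIntegralCurve_of_isMIntegralCurveOn
    (contMDiff_one_mulInvariantVectorField (G := G) v) hε (fun g => ⟨fun t => g * γ t, by simp [h0],
      fun t ht => (hasLeftVelocity_iff_hasMFDerivAt.1 ((hv t ht).const_mul g)).hasMFDerivWithinAt⟩)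
    (1 : G)
  exact ⟨η, h1, isMIntegralCurve_iff_hasLeftVelocity.1 h2⟩

theorem hasLeftVelocity_unique {γ η : ℝ → G} {v : E} (hγ : ∀ t, HasLeftVelocity γ v t)
    (hη : ∀ t, HasLeftVelocity η v t) (h : γ 0 = η 0) : γ = η := by
  have : CompleteSpace E := FiniteDimensional.complete ℝ E
  have : IsManifold 𝓘(ℝ, E) 1 G := IsManifold.of_le (n := ∞) (by simp)
  exact isMIntegralCurve_Ioo_eq_of_contMDiff_boundaryless (t₀ := (0 : ℝ))
    (contMDiff_one_mulInvariantVectorField (G := G) v)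
    (isMIntegralCurve_iff_hasLeftVelocity.2 hγ) (isMIntegralCurve_iff_hasLeftVelocity.2 hη) h

theorem eq_expMap_one {γ : ℝ → G} {v : E} (h0 : γ 0 = 1) (hγ : ∀ t, HasLeftVelocity γ v t) :
    γ 1 = expMap G v := by
  have hex : ∃ γ : ℝ → G, γ 0 = 1 ∧
      IsMIntegralCurve (I := 𝓘(ℝ, E)) γ (mulInvariantVectorField (I := 𝓘(ℝ, E)) v) :=
    ⟨γ, h0, isMIntegralCurve_iff_hasLeftVelocity.2 hγ⟩
  have h1 : expMap G v = hex.choose 1 := dif_pos hex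
  have h2 := hex.choose_spec
  rw [h1, hasLeftVelocity_unique hγ (isMIntegralCurve_iff_hasLeftVelocity.1 h2.2)
    (h0.trans h2.1.symm)]

/-- The integral curves through the identity are the one-parameter subgroups. -/
theorem eq_expMap_smul {γ : ℝ → G} {v : E} (h0 : γ 0 = 1) (hγ : ∀ t, HasLeftVelocity γ v t)
    (t : ℝ) : γ t = expMap G (t • v) := by
  have h := eq_expMap_one (γ := fun s => γ (s * t)) (v := t • v) (by simpa using h0) (fun s => by
    have h2 := (hγ (s * t)).comp (f := fun s => s * t) (t := s) (f' := t)
      (by simpa using (hasDerivAt_id s).mul_const t)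
    exact h2)
  simpa using h

theorem hasLeftVelocity_expMap (v : E) (t : ℝ) :
    HasLeftVelocity (fun t : ℝ => expMap G (t • v)) v t := by
  obtain ⟨γ, h0, hγ⟩ := exists_hasLeftVelocity (G := G) v
  rw [← funext (eq_expMap_smul h0 hγ)]
  exact hγ t

@[simp] theorem expMap_zero : expMap G (0 : E) = 1 :=
  (eq_expMap_one (γ := fun _ => (1 : G)) rfl (fun t => HasLeftVelocity.const 1 t)).symm

theorem expMap_add_smul (s t : ℝ) (v : E) :
    expMap G ((s + t) • v) = expMap G (s • v) * expMap G (t • v) := by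
  have h := eq_expMap_smul (γ := fun t => (expMap G (s • v))⁻¹ * expMap G ((s + t) • v)) (v := v)
    (by simp) (fun t => by
      have h2 := (hasLeftVelocity_expMap (G := G) v (s + t)).comp (f := fun t => s + t) (f' := 1)
        ((hasDerivAt_id t).const_add s)
      rw [one_smul] at h2
      exact h2.const_mul _) t
  rw [← h, mul_inv_cancel_left]

theorem expMap_neg (v : E) : expMap G (-v) = (expMap G v)⁻¹ := by
  have h := expMap_add_smul (G := G) (-1) 1 v
  simp only [neg_add_cancel, zero_smul, expMap_zero, neg_smul, one_smul] at h
  exact eq_inv_of_mul_eq_one_left h.symm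

/-- The exponential map intertwines the adjoint action and conjugation. -/
theorem conj_expMap (g : G) (v : E) : g * expMap G v * g⁻¹ = expMap G (adMap g v) := by
  have h := eq_expMap_one (γ := fun t : ℝ => g * expMap G (t • v) * g⁻¹) (v := adMap g v) (by simp)
    fun t => by
      simpa using ((hasLeftVelocity_expMap v t).const_mul g).mul (HasLeftVelocity.const g⁻¹ t)
  simpa using h

theorem modelBracket_add (X Y Z : E) :
    modelBracket G X (Y + Z) = modelBracket G X Y + modelBracket G X Z :=
  lie_add (L := GroupLieAlgebra 𝓘(ℝ, E) G) (M := GroupLieAlgebra 𝓘(ℝ, E) G) X Y Z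

theorem modelBracket_smul (X Y : E) (c : ℝ) :
    modelBracket G X (c • Y) = c • modelBracket G X Y :=
  lie_smul (R := ℝ) (L := GroupLieAlgebra 𝓘(ℝ, E) G) (M := GroupLieAlgebra 𝓘(ℝ, E) G) c X Y

/-- `Ad (exp tX) Y` is the solution of `c' = [X, c]`, `c(0) = Y`. -/
theorem adMap_expMap {X Y : E} {c : ℝ → E} (h0 : c 0 = Y)
    (hc : ∀ t, HasDerivAt c (modelBracket G X (c t)) t) (t : ℝ) :
    adMap (expMap G (t • X)) Y = c t := by
  let ad : E →L[ℝ] E := LinearMap.toContinuousLinearMap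
    { toFun := modelBracket G X, map_add' := modelBracket_add X,
      map_smul' := fun c Y => modelBracket_smul X Y c }
  have h1 : ∀ t, HasDerivAt (fun t : ℝ => adMap (expMap G (t • X)) Y)
      (ad (adMap (expMap G (t • X)) Y)) t := by
    intro t
    have h2 := (hasLeftVelocity_expMap (G := G) X 0).hasDerivAt_adMap (by simp)
      (adMap (expMap G (t • X)) Y)
    have h2' : HasDerivAt (fun s : ℝ => adMap (expMap G (s • X)) (adMap (expMap G (t • X)) Y))
      (modelBracket G X (adMap (expMap G (t • X)) Y)) (t - t) := by rwa [sub_self]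
    have h3 := h2'.comp_sub_const t t
    refine h3.congr_of_eventuallyEq (Eventually.of_forall fun s => ?_)
    beta_reduce
    rw [← ContinuousLinearMap.comp_apply, ← adMap_mul, ← expMap_add_smul]
    simp
  have h4 : (fun t : ℝ => adMap (expMap G (t • X)) Y) = c :=
    ODE_solution_unique_univ (v := fun _ x => ad x) (s := fun _ => univ) (t₀ := 0) (K := ‖ad‖₊)
      (fun _ => ad.lipschitz.lipschitzOnWith) (fun t => ⟨h1 t, mem_univ _⟩)
      (fun t => ⟨hc t, mem_univ _⟩) (by simp [h0, adMap_one])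
  exact congrFun h4 t

theorem eventually_hasDerivAt_chart {γ : ℝ → G} {v : E} (h0 : γ 0 = 1)
    (hγ : ∀ t, HasLeftVelocity γ v t) : ∀ᶠ t in 𝓝 (0 : ℝ),
      HasDerivAt (fun s => idChart E G (γ s)) (chartField G v (idChart E G (γ t))) t := by
  have hcont : ContinuousAt (fun t => idChart E G (γ t)) 0 := by
    have := (hγ 0).2.continuousAt
    simpa [h0] using this
  have hpair : ContinuousAt (fun t => (idChart E G (γ t), idChart E G (1 : G))) 0 :=
    hcont.prodMk continuousAt_const
  have h1 : ∀ᶠ t in 𝓝 (0 : ℝ), ContDiffAt ℝ 1 (chartMul E G)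
      (idChart E G (γ t), idChart E G 1) :=
    hpair.eventually (by simpa only [h0] using eventually_contDiffAt_chartMul)
  have h2 : ∀ᶠ t in 𝓝 (0 : ℝ), γ t ∈ (idChart E G).source :=
    (hγ 0).1 (by rw [h0]; exact idChart_source_mem)
  filter_upwards [h1, h2] with t h3 h4
  have h5 := HasFDerivAt.comp_hasDerivAt (l := chartMul E G)
    (f := fun s => (idChart E G (γ t), idChart E G ((γ t)⁻¹ * γ s))) t
    (by simpa using (h3.differentiableAt (by simp)).hasFDerivAt)
    ((hasDerivAt_const t (idChart E G (γ t))).prodMk (hγ t).2)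
  refine h5.congr_of_eventuallyEq ?_
  filter_upwards [tendsto_inv_mul (hγ t).1 E (idChart_source_mem (E := E))] with s hs
  rw [Function.comp_apply, chartMul, (idChart E G).left_inv h4, (idChart E G).left_inv hs]
  simp

/-- By bootstrapping: in the chart the curve solves an ordinary differential equation with smooth
right-hand side. -/
theorem contDiffAt_chart_of_hasLeftVelocity {γ : ℝ → G} {v : E} (h0 : γ 0 = 1)
    (hγ : ∀ t, HasLeftVelocity γ v t) : ContDiffAt ℝ ∞ (fun s => idChart E G (γ s)) 0 := by
  have hd := eventually_hasDerivAt_chart h0 hγ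
  refine contDiffAt_infty.2 fun n => ?_
  induction n with
  | zero =>
    refine contDiffAt_zero.2 ⟨{t | HasDerivAt (fun s => idChart E G (γ s))
      (chartField G v (idChart E G (γ t))) t}, hd, fun t ht => ?_⟩
    exact (HasDerivAt.continuousAt ht).continuousWithinAt
  | succ n ih =>
    refine contDiffAt_succ_iff_hasFDerivAt.2 ⟨fun t => (1 : ℝ →L[ℝ] ℝ).smulRight
      (chartField G v (idChart E G (γ t))), ⟨_, hd, fun t ht => HasDerivAt.hasFDerivAt ht⟩, ?_⟩
    have h1 : ContDiffAt ℝ n (chartField G v) (idChart E G (γ 0)) := by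
      rw [h0]; exact (contDiffAt_chartField v).of_le (by exact_mod_cast le_top)
    have h2 : ContDiffAt ℝ n (fun t => chartField G v (idChart E G (γ t))) 0 :=
      ContDiffAt.comp (g := chartField G v) (f := fun t => idChart E G (γ t)) 0 h1 ih
    exact contDiffAt_const.smulRight h2

/-- One-parameter subgroups are smooth. -/
theorem contMDiff_expMap_smul (v : E) :
    ContMDiff 𝓘(ℝ, ℝ) 𝓘(ℝ, E) ∞ (fun t : ℝ => expMap G (t • v)) := by
  have h0 : ContMDiffAt 𝓘(ℝ, ℝ) 𝓘(ℝ, E) ∞ (fun t : ℝ => expMap G (t • v)) 0 := by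
    have h1 := contDiffAt_chart_of_hasLeftVelocity (γ := fun t : ℝ => expMap G (t • v)) (by simp)
      (hasLeftVelocity_expMap v)
    have h2 : ContMDiffAt 𝓘(ℝ, E) 𝓘(ℝ, E) ∞ (idChart E G).symm
        (idChart E G (expMap G ((0 : ℝ) • v))) := by
      simpa using contMDiffAt_idChart_symm_one (E := E) (G := G)
    have h3 := ContMDiffAt.comp (0 : ℝ) h2 h1.contMDiffAt
    refine h3.congr_of_eventuallyEq ?_
    have h4 : ∀ᶠ t in 𝓝 (0 : ℝ), expMap G (t • v) ∈ (idChart E G).source :=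
      (hasLeftVelocity_expMap v 0).1 (by simpa using idChart_source_mem)
    filter_upwards [h4] with t ht
    exact ((idChart E G).left_inv ht).symm
  intro t
  have h5 : (fun s : ℝ => expMap G (s • v)) =
      (expMap G (t • v) * ·) ∘ (fun s : ℝ => expMap G (s • v)) ∘ fun s => s - t := by
    ext s
    simp [← expMap_add_smul]
  rw [h5]
  refine ContMDiffAt.comp t (contMDiff_leftMul _).contMDiffAt
    (ContMDiffAt.comp (I' := 𝓘(ℝ, ℝ)) t ?_ ?_)
  · simpa using h0
  · exact (contDiff_id.sub contDiff_const).contMDiff.contMDiffAt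

end Exponential

/-! ### The model group -/

section ModelGroup

/-- The data of a Lie algebra `ℝ ⋉ V`, in which `ℝ` acts on `V` by the derivation `D` and
the bracket on `V` is `[v, w] = form(v, w) z` with `z` central. The field `form_D` is the Jacobi
identity: `D` is an infinitesimal symmetry of the form. Nilpotency of `D` is not part of the
structure. -/
structure HeisenbergData (V : Type*) [NormedAddCommGroup V] [NormedSpace ℝ V] where
  D : V →L[ℝ] V
  form : V →L[ℝ] V →L[ℝ] ℝ
  z : V
  form_self : ∀ v, form v v = 0
  D_z : D z = 0
  form_z : ∀ v, form z v = 0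
  form_D : ∀ v w, form (D v) w + form v (D w) = 0

variable {V : Type*} [NormedAddCommGroup V] [NormedSpace ℝ V] [FiniteDimensional ℝ V]

namespace HeisenbergData

variable (H : HeisenbergData V)

/-- The flow `exp (tD)` of the derivation `D`. -/
def flow (t : ℝ) : V →L[ℝ] V := NormedSpace.exp (t • H.D)

theorem form_swap (v w : V) : H.form v w = - H.form w v := by
  have h := H.form_self (v + w)
  simp only [map_add, add_apply, H.form_self] at h
  linarith

@[simp] theorem form_z_right (v : V) : H.form v H.z = 0 := by
  rw [form_swap, H.form_z, neg_zero]

@[simp] theorem flow_zero : H.flow 0 = ContinuousLinearMap.id ℝ V := by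
  simp [flow]; rfl

theorem flow_add (s t : ℝ) : H.flow (s + t) = (H.flow s).comp (H.flow t) := by
  have : CompleteSpace V := FiniteDimensional.complete ℝ V
  let _ : NormedAlgebra ℚ (V →L[ℝ] V) := NormedAlgebra.restrictScalars ℚ ℝ _
  rw [flow, add_smul, NormedSpace.exp_add_of_commute
    (((Commute.refl H.D).smul_right t).smul_left s)]
  rfl

theorem flow_add_apply (s t : ℝ) (v : V) : H.flow (s + t) v = H.flow s (H.flow t v) := by
  rw [flow_add]; rfl

theorem hasDerivAt_flow (v : V) (t : ℝ) :
    HasDerivAt (fun t => H.flow t v) (H.D (H.flow t v)) t := by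
  have : CompleteSpace V := FiniteDimensional.complete ℝ V
  have h := hasDerivAt_exp_smul_const' (𝕂 := ℝ) H.D t
  exact h.clm_apply (hasDerivAt_const t v) |>.congr_deriv (by simp [flow])

theorem D_flow (t : ℝ) (v : V) : H.D (H.flow t v) = H.flow t (H.D v) := by
  have : CompleteSpace V := FiniteDimensional.complete ℝ V
  have h : Commute H.D (H.flow t) := ((Commute.refl H.D).smul_right t).exp_right
  exact DFunLike.congr_fun h.eq v

theorem contDiff_flow : ContDiff ℝ ∞ H.flow := by
  have : CompleteSpace V := FiniteDimensional.complete ℝ V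
  have h : ContDiff ℝ ∞ (NormedSpace.exp : (V →L[ℝ] V) → (V →L[ℝ] V)) :=
    contDiff_iff_contDiffAt.2 fun x => (NormedSpace.exp_analytic (𝕂 := ℝ) x).contDiffAt
  exact h.comp (contDiff_id.smul contDiff_const)

theorem flow_z (t : ℝ) : H.flow t H.z = H.z := by
  have h3 := is_const_of_deriv_eq_zero (f := fun t => H.flow t H.z) ?_ ?_ t 0
  · simpa using h3
  · exact fun s => (H.hasDerivAt_flow H.z s).differentiableAt
  · intro s
    rw [(H.hasDerivAt_flow H.z s).deriv]
    rw [H.D_flow, H.D_z, map_zero]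

@[simp] theorem form_flow (t : ℝ) (v w : V) : H.form (H.flow t v) (H.flow t w) = H.form v w := by
  have h1 : ∀ s, HasDerivAt (fun s => H.form (H.flow s v) (H.flow s w)) 0 s := by
    intro s
    have h2 := (H.form.hasFDerivAt.comp_hasDerivAt s (H.hasDerivAt_flow v s)).clm_apply
      (H.hasDerivAt_flow w s)
    refine h2.congr_deriv ?_
    exact H.form_D _ _
  have h3 := is_const_of_deriv_eq_zero (fun s => (h1 s).differentiableAt) (fun s => (h1 s).deriv) t 0
  simpa using h3

/-- The simply connected Lie group of a `HeisenbergData`, with underlying manifold `V × ℝ`: the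
pair `(v, t)` stands for `exp v * exp (t X₁)`. -/
def Model (_ : HeisenbergData V) : Type _ := V × ℝ

instance : TopologicalSpace H.Model := inferInstanceAs (TopologicalSpace (V × ℝ))

/-- The group law on the model of a `HeisenbergData`: the Heisenberg law on `V`, twisted by the
flow of `D`. -/
def mul (p q : V × ℝ) : V × ℝ :=
  (p.1 + H.flow p.2 q.1 + (1 / 2 * H.form p.1 (H.flow p.2 q.1)) • H.z, p.2 + q.2)

/-- The inverse in the model of a `HeisenbergData`. -/
def inv (p : V × ℝ) : V × ℝ := (-(H.flow (-p.2) p.1), -p.2)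

theorem mul_assoc' (p q r : V × ℝ) : H.mul (H.mul p q) r = H.mul p (H.mul q r) := by
  refine Prod.ext ?_ (add_assoc _ _ _)
  simp only [mul, map_add, map_smul, flow_z, flow_add_apply, add_apply,
    smul_apply, form_z, form_z_right, form_flow, smul_zero]
  module

theorem zero_mul' (p : V × ℝ) : H.mul 0 p = p := by
  simp [mul]

theorem mul_zero' (p : V × ℝ) : H.mul p 0 = p := by
  simp [mul]

theorem inv_mul' (p : V × ℝ) : H.mul (H.inv p) p = 0 := by
  simp [mul, inv, H.form_self]

instance : Group H.Model :=
  { mul := H.mul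
    one := (0 : V × ℝ)
    inv := H.inv
    mul_assoc := H.mul_assoc'
    one_mul := H.zero_mul'
    mul_one := H.mul_zero'
    inv_mul_cancel := H.inv_mul' }

theorem contDiff_mul : ContDiff ℝ ∞ (fun p : (V × ℝ) × (V × ℝ) => H.mul p.1 p.2) := by
  have h1 : ContDiff ℝ ∞ (fun p : (V × ℝ) × (V × ℝ) => H.flow p.1.2 p.2.1) :=
    (H.contDiff_flow.comp (contDiff_snd.comp contDiff_fst)).clm_apply (contDiff_fst.comp contDiff_snd)
  have h2 : ContDiff ℝ ∞ (fun p : (V × ℝ) × (V × ℝ) => p.1.1) := contDiff_fst.comp contDiff_fst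
  have h3 : ContDiff ℝ ∞ (fun p : (V × ℝ) × (V × ℝ) => H.form p.1.1 (H.flow p.1.2 p.2.1)) :=
    (H.form.contDiff.comp h2).clm_apply h1
  exact ((h2.add h1).add ((contDiff_const.mul h3).smul contDiff_const)).prodMk
    ((contDiff_snd.comp contDiff_fst).add (contDiff_snd.comp contDiff_snd))

theorem contDiff_inv : ContDiff ℝ ∞ H.inv :=
  ((H.contDiff_flow.comp contDiff_snd.neg).clm_apply contDiff_fst).neg.prodMk contDiff_snd.neg

instance : IsTopologicalGroup H.Model where
  continuous_mul := H.contDiff_mul.continuous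
  continuous_inv := H.contDiff_inv.continuous

end HeisenbergData
end ModelGroup

/-! ### Identification of a simply connected group with its model -/

section Realization

variable {V : Type*} [NormedAddCommGroup V] [NormedSpace ℝ V] [FiniteDimensional ℝ V]
  {E : Type*} [NormedAddCommGroup E] [NormedSpace ℝ E]
  (G : Type*) [TopologicalSpace G] [ChartedSpace E G] [Group G]

/-- An isomorphism of the Lie algebra of a Lie group `G` with the Lie algebra `ℝ ⋉ V` of a
`HeisenbergData`; `X₁` is the image of the generator of `ℝ`. -/
structure HeisenbergData.Realization (H : HeisenbergData V) where
  incl : V →L[ℝ] E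
  X₁ : E
  bracket_first : ∀ v, modelBracket G X₁ (incl v) = incl (H.D v)
  bracket_incl : ∀ v w, modelBracket G (incl v) (incl w) = H.form v w • incl H.z
  bijective : Function.Bijective (fun p : V × ℝ => incl p.1 + p.2 • X₁)

namespace HeisenbergData.Realization

variable {G} [LieGroup 𝓘(ℝ, E) ∞ G] [FiniteDimensional ℝ E] [T2Space G]
  {H : HeisenbergData V} (R : H.Realization (E := E) G)

theorem adMap_first (t : ℝ) (v : V) :
    adMap (expMap G (t • R.X₁)) (R.incl v) = R.incl (H.flow t v) := by
  refine adMap_expMap (c := fun t => R.incl (H.flow t v)) (by simp) (fun t => ?_) t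
  rw [R.bracket_first]
  exact R.incl.hasFDerivAt.comp_hasDerivAt t (H.hasDerivAt_flow v t)

/-- As `[w, [w, v]] = 0`, the series `Ad (exp w) v = v + [w, v] + ⋯` stops after two terms. -/
theorem adMap_incl (w v : V) :
    adMap (expMap G (R.incl w)) (R.incl v) = R.incl (v + H.form w v • H.z) := by
  have h := adMap_expMap (G := G) (X := R.incl w) (Y := R.incl v)
    (c := fun t => R.incl (v + (t * H.form w v) • H.z)) (by simp) (fun t => ?_) 1
  · simpa using h
  · rw [R.bracket_incl, map_add, map_smul, form_z_right, smul_zero, add_zero, ← map_smul]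
    refine R.incl.hasFDerivAt.comp_hasDerivAt t ?_
    have h2 := (((hasDerivAt_id t).mul_const (H.form w v)).smul_const H.z).const_add v
    simpa using h2

theorem conj_first (t : ℝ) (v : V) : expMap G (t • R.X₁) * expMap G (R.incl v) =
    expMap G (R.incl (H.flow t v)) * expMap G (t • R.X₁) := by
  rw [← R.adMap_first, ← conj_expMap, inv_mul_cancel_right]

theorem hasLeftVelocity_z {f : ℝ → ℝ} {f' t : ℝ} (hf : HasDerivAt f f' t) {γ : ℝ → G}
    {v : V} (hγ : HasLeftVelocity γ (R.incl v) t) :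
    HasLeftVelocity (fun s => γ s * expMap G (f s • R.incl H.z)) (R.incl (v + f' • H.z)) t := by
  have h := hγ.mul ((hasLeftVelocity_expMap (G := G) (R.incl H.z) (f t)).comp hf)
  rw [← expMap_neg, ← smul_neg, ← map_neg, ← map_smul, adMap_incl, map_smul, map_neg,
    smul_apply, neg_apply, H.form_z] at h
  simpa using h

/-- The Baker–Campbell–Hausdorff formula in the two-step nilpotent ideal `V`: the right-hand side,
with `v`, `w` replaced by `t v`, `t w`, has constant left velocity `v + w`. -/
theorem expMap_add (v w : V) : expMap G (R.incl (v + w)) =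
    expMap G (R.incl v) * expMap G (R.incl w) *
      expMap G ((-(1 / 2) * H.form v w) • R.incl H.z) := by
  have h := eq_expMap_one (G := G) (v := R.incl (v + w))
    (γ := fun t : ℝ => expMap G (t • R.incl v) * expMap G (t • R.incl w) *
      expMap G ((-(1 / 2) * H.form v w * t ^ 2) • R.incl H.z)) (by simp) (fun t => ?_)
  · rw [← h]; simp
  · have h1 := (hasLeftVelocity_expMap (G := G) (R.incl v) t).mul
      (hasLeftVelocity_expMap (G := G) (R.incl w) t)
    rw [← expMap_neg, ← smul_neg, ← map_neg, ← map_smul, adMap_incl, map_smul, map_neg,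
      smul_apply, neg_apply, ← map_add] at h1
    have h2 := R.hasLeftVelocity_z ((hasDerivAt_pow 2 t).const_mul (-(1 / 2) * H.form v w)) h1
    have h3 : v + w = v + (t • -H.form w v) • H.z + w +
        (-(1 / 2) * H.form v w * (((2 : ℕ) : ℝ) * t ^ (2 - 1))) • H.z := by
      rw [H.form_swap w v]
      simp only [smul_eq_mul]
      push_cast
      module
    rw [h3]
    exact h2

theorem expMap_add_z (v : V) (c : ℝ) : expMap G (R.incl (v + c • H.z)) =
    expMap G (R.incl v) * expMap G (c • R.incl H.z) := by
  rw [R.expMap_add]; simp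

theorem expMap_mul (v w : V) : expMap G (R.incl v) * expMap G (R.incl w) =
    expMap G (R.incl (v + w + (1 / 2 * H.form v w) • H.z)) := by
  rw [R.expMap_add_z, R.expMap_add, mul_assoc _ _ (expMap G _), ← expMap_add_smul]
  simp

/-- The parametrization `(v, t) ↦ exp v * exp (t X₁)` of `G`. -/
def ofPair (p : V × ℝ) : G := expMap G (R.incl p.1) * expMap G (p.2 • R.X₁)

@[simp] theorem ofPair_zero : R.ofPair 0 = 1 := by
  simp [ofPair]

theorem ofPair_mul (p q : V × ℝ) : R.ofPair (H.mul p q) = R.ofPair p * R.ofPair q := by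
  simp only [ofPair, mul]
  rw [← R.expMap_mul, expMap_add_smul]
  simp only [mul_assoc]
  rw [← mul_assoc (expMap G (R.incl (H.flow p.2 q.1))), ← R.conj_first]
  simp only [mul_assoc]

/-- The parametrization of `G` by the model group, as a homomorphism. -/
def param : H.Model →* G where
  toFun := R.ofPair
  map_one' := R.ofPair_zero
  map_mul' := R.ofPair_mul

theorem ofPair_inv (p : V × ℝ) : R.ofPair (H.inv p) = (R.ofPair p)⁻¹ :=
  map_inv (G := H.Model) (H := G) R.param p

/-- By the Baker–Campbell–Hausdorff formula, `exp` on `V` is a product of one-parameter subgroups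
with coordinates depending polynomially on `v`. -/
theorem contMDiff_expMap_incl :
    ContMDiff 𝓘(ℝ, V) 𝓘(ℝ, E) ∞ (fun v => expMap G (R.incl v)) := by
  let b := Module.finBasis ℝ V
  have hlin : ∀ f : V →ₗ[ℝ] ℝ, ContMDiff 𝓘(ℝ, V) 𝓘(ℝ, ℝ) ∞ f := fun f =>
    (LinearMap.toContinuousLinearMap f).contDiff.contMDiff
  have h : ∀ s : Finset (Fin (Module.finrank ℝ V)), ContMDiff 𝓘(ℝ, V) 𝓘(ℝ, E) ∞
      (fun v => expMap G (R.incl (∑ i ∈ s, b.repr v i • b i))) := by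
    intro s
    induction s using Finset.induction_on with
    | empty => simpa using contMDiff_const
    | insert i s hi ih =>
      have h1 : (fun v => expMap G (R.incl (∑ j ∈ insert i s, b.repr v j • b j))) =
        fun v => expMap G (b.coord i v • R.incl (b i)) *
          expMap G (R.incl (∑ j ∈ s, b.repr v j • b j)) *
          expMap G ((-(1 / 2) * H.form (b.coord i v • b i) (∑ j ∈ s, b.repr v j • b j)) •
            R.incl H.z) := by
        ext v
        rw [Finset.sum_insert hi, R.expMap_add]
        simp
      rw [h1]
      have h2 : ContMDiff 𝓘(ℝ, V) 𝓘(ℝ, ℝ) ∞ (fun v => -(1 / 2) *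
          H.form (b.coord i v • b i) (∑ j ∈ s, b.repr v j • b j)) := by
        refine ContDiff.contMDiff ?_
        refine contDiff_const.mul ((H.form.contDiff.comp ?_).clm_apply ?_)
        · exact (hlin (b.coord i)).contDiff.smul contDiff_const
        · exact ContDiff.sum fun j _ => (hlin (b.coord j)).contDiff.smul contDiff_const
      exact (((contMDiff_expMap_smul (G := G) (R.incl (b i))).comp (hlin (b.coord i))).mul ih).mul
        ((contMDiff_expMap_smul (G := G) (R.incl H.z)).comp h2)
  simpa [b.sum_repr] using h Finset.univ

theorem contMDiff_ofPair :
    ContMDiff 𝓘(ℝ, V × ℝ) 𝓘(ℝ, E) ∞ (R.ofPair) := by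
  have h1 : ContMDiff 𝓘(ℝ, V × ℝ) 𝓘(ℝ, V) ∞ (Prod.fst : V × ℝ → V) := contDiff_fst.contMDiff
  have h2 : ContMDiff 𝓘(ℝ, V × ℝ) 𝓘(ℝ, ℝ) ∞ (Prod.snd : V × ℝ → ℝ) := contDiff_snd.contMDiff
  exact (R.contMDiff_expMap_incl.comp h1).mul ((contMDiff_expMap_smul (G := G) R.X₁).comp h2)

/-- The linear isomorphism `(v, t) ↦ v + t X₁` between the Lie algebras. -/
def lin : (V × ℝ) ≃L[ℝ] E :=
  (LinearEquiv.ofBijective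
    ({ toFun := fun p => R.incl p.1 + p.2 • R.X₁
       map_add' := fun p q => by simp [add_smul]; abel
       map_smul' := fun c p => by simp [mul_smul] } : V × ℝ →ₗ[ℝ] E)
    R.bijective).toContinuousLinearEquiv

theorem lin_apply (p : V × ℝ) : R.lin p = R.incl p.1 + p.2 • R.X₁ := rfl

theorem contDiffAt_idChart_ofPair :
    ContDiffAt ℝ ∞ (fun p : V × ℝ => idChart E G (R.ofPair p)) 0 := by
  refine contDiffAt_idChart_comp (f := R.ofPair)
    R.contMDiff_ofPair.contMDiffAt ?_
  simpa [ofPair] using one_mem_idChart_source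

theorem hasStrictFDerivAt_idChart_ofPair : HasStrictFDerivAt
    (fun p : V × ℝ => idChart E G (R.ofPair p)) (R.lin : V × ℝ →L[ℝ] E) 0 := by
  have h := R.contDiffAt_idChart_ofPair.hasStrictFDerivAt (by simp)
  refine h.congr_fderiv ?_
  refine ContinuousLinearMap.ext fun p => ?_
  have h1 := HasFDerivAt.comp_hasDerivAt (l := fun p : V × ℝ => idChart E G (R.ofPair p))
    (f := fun t : ℝ => t • p) 0 (by simpa using h.hasFDerivAt)
    ((hasDerivAt_id (0 : ℝ)).smul_const p)
  have h2 := (hasLeftVelocity_expMap (G := G) (R.incl p.1) 0).mul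
      (hasLeftVelocity_expMap (G := G) (p.2 • R.X₁) 0)
  have h3 := h2.2
  simp only [zero_smul, expMap_zero, mul_one, inv_one, one_mul, adMap_one,
    ContinuousLinearMap.id_apply] at h3
  have h4 := h1.unique (f := fun t : ℝ => idChart E G (R.ofPair (t • p))) (by
    refine h3.congr_of_eventuallyEq (Eventually.of_forall fun t => ?_)
    simp [ofPair, smul_smul])
  simpa [lin_apply] using h4

theorem map_ofPair_nhds : map (R.ofPair) (𝓝 0) = 𝓝 1 := by
  have : CompleteSpace V := FiniteDimensional.complete ℝ V
  have h := R.hasStrictFDerivAt_idChart_ofPair.map_nhds_eq_of_equiv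
  have h1 : map (idChart E G).symm (𝓝 (idChart E G 1)) = 𝓝 (1 : G) := by
    rw [idChart, ← map_extChartAt_nhds_of_boundaryless, map_map]
    refine (map_congr ?_).trans map_id
    filter_upwards [extChartAt_source_mem_nhds (I := 𝓘(ℝ, E)) (1 : G)] with g hg
    exact (extChartAt 𝓘(ℝ, E) (1 : G)).left_inv hg
  rw [R.ofPair_zero] at h
  rw [← h1, ← h, map_map]
  refine map_congr ?_
  have h2 : ContinuousAt (R.ofPair) 0 := R.contMDiff_ofPair.continuous.continuousAt
  filter_upwards [h2 (by rw [R.ofPair_zero]; exact idChart_source_mem (E := E))] with p hp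
  exact ((idChart E G).left_inv hp).symm

theorem isOpenMap_param : IsOpenMap R.param := by
  have : IsTopologicalGroup G := topologicalGroup_of_lieGroup 𝓘(ℝ, E) ∞
  exact IsTopologicalGroup.isOpenMap_iff_nhds_one.2 R.map_ofPair_nhds.ge

theorem continuous_param : Continuous R.param := R.contMDiff_ofPair.continuous

/-- The image is an open subgroup, hence everything. -/
theorem surjective_param [ConnectedSpace G] : Function.Surjective R.param := by
  have : IsTopologicalGroup G := topologicalGroup_of_lieGroup 𝓘(ℝ, E) ∞
  have h1 : IsOpen (R.param.range : Set G) := by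
    rw [MonoidHom.coe_range]; exact R.isOpenMap_param.isOpen_range
  have h2 : IsClopen (R.param.range : Set G) := ⟨Subgroup.isClosed_of_isOpen _ h1, h1⟩
  have h3 := h2.eq_univ ⟨1, R.param.range.one_mem⟩
  rw [← range_eq_univ, ← MonoidHom.coe_range, h3]

theorem isDiscrete_ker_param : IsDiscrete (R.param.ker : Set H.Model) := by
  have : CompleteSpace V := FiniteDimensional.complete ℝ V
  have h := R.hasStrictFDerivAt_idChart_ofPair.eventually_left_inverse
  have h0 := h.self_of_nhds
  rw [isDiscrete_iff_nhdsNE]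
  have h1' : ∀ᶠ p in 𝓝 (0 : V × ℝ), R.ofPair p = 1 → p = 0 := by
    filter_upwards [h] with p hp hker
    rw [hker] at hp
    rw [R.ofPair_zero] at h0
    exact hp.symm.trans h0
  have h1 : ∀ᶠ p in 𝓝 (1 : H.Model), R.param p = 1 → p = 1 := h1'
  intro x hx
  rw [← Filter.empty_mem_iff_bot, Filter.mem_inf_principal, mem_nhdsWithin_iff_eventually]
  have h2 : Tendsto (fun y : H.Model => x⁻¹ * y) (𝓝 x) (𝓝 1) := by
    have : ContinuousAt (fun y : H.Model => x⁻¹ * y) x := by fun_prop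
    rwa [ContinuousAt, inv_mul_cancel] at this
  filter_upwards [h2.eventually h1] with y hy hne hker
  exact hne (inv_mul_eq_one.1 (hy (MonoidHom.mem_ker.1
    (R.param.ker.mul_mem (R.param.ker.inv_mem hx) hker)))).symm

/-- The parametrization is a covering map, hence injective as `G` is simply connected. -/
theorem injective_param [SimplyConnectedSpace G] : Function.Injective R.param := by
  have hq : IsQuotientMap R.param := R.isOpenMap_param.isQuotientMap R.continuous_param
    R.surjective_param
  have cov :=
    (hq.isQuotientCoveringMap_of_isDiscrete_ker_monoidHom R.isDiscrete_ker_param).isCoveringMap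
  intro x y hxy
  have : PathConnectedSpace H.Model := inferInstanceAs (PathConnectedSpace (V × ℝ))
  let γ : Path x y := PathConnectedSpace.somePath x y
  have h := cov.monodromy_eq_of_map_eq (γ := .refl (R.param x)) (ex := ⟨x, rfl⟩)
    (ey := ⟨y, hxy.symm⟩) (.mk γ) (Subsingleton.elim _ _)
  rw [cov.monodromy_refl] at h
  exact congrArg Subtype.val h

end HeisenbergData.Realization

end Realization

/-! ### Left translation in the model group -/

section Translation

variable {V : Type*} [NormedAddCommGroup V] [NormedSpace ℝ V] [FiniteDimensional ℝ V]

namespace HeisenbergData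

variable (H : HeisenbergData V)

/-- The derivative at `p` of the left translation by `p⁻¹` in the model group. -/
def transDeriv (p : V × ℝ) : V × ℝ →L[ℝ] V × ℝ :=
  ((H.flow (-p.2) - ((1 / 2 : ℝ) • (H.form p.1)).smulRight H.z).comp
    (ContinuousLinearMap.fst ℝ V ℝ)).prod (ContinuousLinearMap.snd ℝ V ℝ)

theorem transDeriv_apply (p q : V × ℝ) :
    H.transDeriv p q = (H.flow (-p.2) q.1 - (1 / 2 * H.form p.1 q.1) • H.z, q.2) := rfl

theorem flow_neg_flow (t : ℝ) (v : V) : H.flow (-t) (H.flow t v) = v := by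
  rw [← flow_add_apply]; simp

theorem flow_flow_neg (t : ℝ) (v : V) : H.flow t (H.flow (-t) v) = v := by
  rw [← flow_add_apply]; simp

theorem hasFDerivAt_inv_mul (p : V × ℝ) :
    HasFDerivAt (fun q => H.mul (H.inv p) q) (H.transDeriv p) p := by
  have h : (fun q => H.mul (H.inv p) q) =
      fun q => H.transDeriv p q - (H.flow (-p.2) p.1, p.2) := by
    ext1 q
    rw [transDeriv_apply]
    refine Prod.ext ?_ (by simp [mul, inv]; ring)
    simp only [mul, inv, map_neg, neg_apply, form_flow, Prod.fst_sub]
    module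
  rw [h]
  exact (H.transDeriv p).hasFDerivAt.sub_const _

theorem bijective_transDeriv (p : V × ℝ) : Function.Bijective (H.transDeriv p) := by
  constructor
  · rw [injective_iff_map_eq_zero]
    rintro ⟨w, τ⟩ h
    rw [transDeriv_apply, Prod.mk_eq_zero] at h
    obtain ⟨h1, h2⟩ := h
    have h3 := congrArg (H.flow p.2) h1
    rw [map_sub, flow_flow_neg, map_smul, flow_z, map_zero, sub_eq_zero] at h3
    have h4 : H.form p.1 (w, τ).1 = 0 := by
      rw [h3]; simp
    rw [h4] at h3
    simp only [mul_zero, zero_smul] at h3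
    exact Prod.ext h3 h2
  · rintro ⟨w, τ⟩
    refine ⟨(H.flow p.2 w + (1 / 2 * H.form p.1 (H.flow p.2 w)) • H.z, τ), ?_⟩
    rw [transDeriv_apply]
    refine Prod.ext ?_ rfl
    simp [flow_neg_flow, flow_z]

end HeisenbergData

variable {E : Type*} [NormedAddCommGroup E] [NormedSpace ℝ E] [FiniteDimensional ℝ E]
  {G : Type*} [TopologicalSpace G] [ChartedSpace E G] [Group G]
  [LieGroup 𝓘(ℝ, E) ∞ G]

theorem bijective_leftDeriv (g : G) : Function.Bijective (leftDeriv E g) := by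
  have h1 : HasMFDerivAt 𝓘(ℝ, E) 𝓘(ℝ, E) (g⁻¹ * · : G → G) (g * 1)
      (mfderiv 𝓘(ℝ, E) 𝓘(ℝ, E) (g⁻¹ * · : G → G) (g * 1)) :=
    (mdifferentiableAt_leftMul _ _).hasMFDerivAt
  have h2 : HasMFDerivAt 𝓘(ℝ, E) 𝓘(ℝ, E) (g * · : G → G) 1 (leftDeriv E g) := hasMFDerivAt_leftMul g
  have h6 := h1.comp 1 h2
  have h7 : (g⁻¹ * · : G → G) ∘ (g * ·) = id := by
    ext x; simp
  rw [h7] at h6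
  have h8 := hasMFDerivAt_unique (hasMFDerivAt_id (I := 𝓘(ℝ, E)) (1 : G)) h6
  have h9 : Function.Injective (leftDeriv E g) :=
    Function.LeftInverse.injective (g := mfderiv 𝓘(ℝ, E) 𝓘(ℝ, E) (g⁻¹ * · : G → G) (g * 1))
      fun v => (DFunLike.congr_fun h8 v).symm
  exact ⟨h9, (LinearMap.injective_iff_surjective (f := (leftDeriv E g : E →ₗ[ℝ] E))).1 h9⟩

namespace HeisenbergData.Realization

variable [T2Space G] {H : HeisenbergData V} (R : H.Realization (E := E) G)

theorem hasMFDerivAt_ofPair_comp {B : Type*} [NormedAddCommGroup B] [NormedSpace ℝ B]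
    {f : B → V × ℝ} {T : B →L[ℝ] V × ℝ} {u : B} (hf : HasFDerivAt f T u) :
    HasMFDerivAt 𝓘(ℝ, B) 𝓘(ℝ, E) (fun w => R.ofPair (f w)) u
      ((leftDeriv E (R.ofPair (f u))).comp
        ((R.lin : V × ℝ →L[ℝ] E).comp ((H.transDeriv (f u)).comp T))) := by
  refine (hasMFDerivAt_iff_leftTranslate (f := fun w => R.ofPair (f w))).2 ⟨?_, ?_⟩
  · exact R.contMDiff_ofPair.continuous.continuousAt.comp hf.continuousAt
  · have h1 := HasFDerivAt.comp (g := fun q => H.mul (H.inv (f u)) q) (f := f) u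
      (H.hasFDerivAt_inv_mul (f u)) hf
    have h2 : H.mul (H.inv (f u)) (f u) = 0 := H.inv_mul' _
    have h3 := HasFDerivAt.comp (g := fun p => idChart E G (R.ofPair p))
      (f := fun w => H.mul (H.inv (f u)) (f w)) u
      (by rw [h2]; exact R.hasStrictFDerivAt_idChart_ofPair.hasFDerivAt) h1
    refine h3.congr_of_eventuallyEq (Eventually.of_forall fun w => ?_)
    simp [ofPair_mul, ofPair_inv]

theorem hasLeftVelocity_ofPair_comp {c : ℝ → V × ℝ} {c' : V × ℝ} {t : ℝ} (hc : HasDerivAt c c' t) :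
    HasLeftVelocity (fun s => R.ofPair (c s)) (R.lin (H.transDeriv (c t) c')) t := by
  have h := (hasMFDerivAt_iff_leftTranslate (f := fun w => R.ofPair (c w))).1
    (R.hasMFDerivAt_ofPair_comp hc.hasFDerivAt)
  refine ⟨h.1, ?_⟩
  refine h.2.hasDerivAt.congr_deriv ?_
  change R.lin (H.transDeriv (c t) ((1 : ℝ) • c')) = _
  rw [one_smul]

variable [SimplyConnectedSpace G]

theorem bijective_ofPair : Function.Bijective R.ofPair := ⟨R.injective_param, R.surjective_param⟩

/-- The inverse of the parametrization `ofPair`: global coordinates on the simply connected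
group. -/
def toPair (g : G) : V × ℝ := (Equiv.ofBijective _ R.bijective_ofPair).symm g

@[simp] theorem ofPair_toPair (g : G) : R.ofPair (R.toPair g) = g :=
  (Equiv.ofBijective _ R.bijective_ofPair).apply_symm_apply g

@[simp] theorem toPair_ofPair (p : V × ℝ) : R.toPair (R.ofPair p) = p :=
  (Equiv.ofBijective _ R.bijective_ofPair).symm_apply_apply p

theorem contMDiff_toPair : ContMDiff 𝓘(ℝ, E) 𝓘(ℝ, V × ℝ) ∞ R.toPair := by
  have : CompleteSpace V := FiniteDimensional.complete ℝ V
  have h0 : ContMDiffAt 𝓘(ℝ, E) 𝓘(ℝ, V × ℝ) ∞ R.toPair 1 := by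
    have h1 := R.contDiffAt_idChart_ofPair.to_localInverse
      R.hasStrictFDerivAt_idChart_ofPair.hasFDerivAt (by simp)
    rw [ofPair_zero] at h1
    have h2 := ContMDiffAt.comp (1 : G) h1.contMDiffAt
      (contMDiffAt_idChart (E := E) (G := G) one_mem_idChart_source)
    refine h2.congr_of_eventuallyEq ?_
    rw [EventuallyEq, ← R.map_ofPair_nhds, eventually_map]
    filter_upwards [R.hasStrictFDerivAt_idChart_ofPair.eventually_left_inverse] with p hp
    rw [toPair_ofPair]
    exact hp.symm
  intro g
  have h3 : R.toPair = (fun q => H.mul (R.toPair g) q) ∘ R.toPair ∘ (g⁻¹ * ·) := by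
    ext1 h
    refine R.bijective_ofPair.1 ?_
    simp [ofPair_mul]
  rw [h3]
  refine ContMDiffAt.comp (I' := 𝓘(ℝ, V × ℝ)) g ?_ (ContMDiffAt.comp (I' := 𝓘(ℝ, E)) g ?_
    (contMDiff_leftMul g⁻¹).contMDiffAt)
  · exact (H.contDiff_mul.comp (contDiff_const.prodMk contDiff_id)).contMDiff.contMDiffAt
  · rw [inv_mul_cancel]; exact h0

theorem exists_hasDerivAt_toPair {γ : ℝ → G} {ξ : E} {t : ℝ} (hγ : HasLeftVelocity γ ξ t) :
    ∃ c', HasDerivAt (fun s => R.toPair (γ s)) c' t ∧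
      R.lin (H.transDeriv (R.toPair (γ t)) c') = ξ := by
  have h1 := (R.contMDiff_toPair.mdifferentiable (by simp) (γ t)).hasMFDerivAt.comp t
    (hasLeftVelocity_iff_hasMFDerivAt.1 hγ)
  have h2 : HasDerivAt (fun s => R.toPair (γ s)) _ t :=
    h1.mdifferentiableAt.differentiableAt.hasDerivAt
  refine ⟨_, h2, ?_⟩
  have h3 := R.hasLeftVelocity_ofPair_comp h2
  simp only [ofPair_toPair] at h3
  exact h3.2.unique hγ.2

end HeisenbergData.Realization

end Translation

/-! ### Absolutely continuous functions -/

section AbsolutelyContinuous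

theorem AbsolutelyContinuousOnInterval.of_dist_le {X X' : Type*} [PseudoMetricSpace X]
    [PseudoMetricSpace X'] {h : ℝ → X} {c : ℝ → X'} {a b K : ℝ}
    (hh : AbsolutelyContinuousOnInterval h a b)
    (hK : ∀ s ∈ uIcc a b, ∀ t ∈ uIcc a b, dist (c s) (c t) ≤ K * dist (h s) (h t)) :
    AbsolutelyContinuousOnInterval c a b := by
  unfold AbsolutelyContinuousOnInterval at hh ⊢
  refine squeeze_zero' (Eventually.of_forall fun _ => Finset.sum_nonneg fun i _ => dist_nonneg) ?_
    (by simpa using hh.const_mul K)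
  rw [eventually_inf_principal]
  filter_upwards with E hE
  rw [Finset.mul_sum]
  exact Finset.sum_le_sum fun i hi => hK _ (hE.1 i hi).1 _ (hE.1 i hi).2

theorem LipschitzOnWith.comp_absolutelyContinuousOnInterval {X X' : Type*} [PseudoMetricSpace X]
    [PseudoMetricSpace X'] {h : ℝ → X} {f : X → X'} {a b : ℝ} {K : NNReal} {s : Set X}
    (hf : LipschitzOnWith K f s) (hh : AbsolutelyContinuousOnInterval h a b)
    (hs : MapsTo h (uIcc a b) s) : AbsolutelyContinuousOnInterval (f ∘ h) a b :=
  hh.of_dist_le fun _ hx _ hy => hf.dist_le_mul _ (hs hx) _ (hs hy)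

variable {W W' : Type*} [NormedAddCommGroup W] [NormedSpace ℝ W] [NormedAddCommGroup W']
  [NormedSpace ℝ W']

theorem ContDiff.comp_absolutelyContinuousOnInterval [FiniteDimensional ℝ W] {h : ℝ → W}
    {f : W → W'} {a b : ℝ} (hf : ContDiff ℝ 1 f) (hh : AbsolutelyContinuousOnInterval h a b) :
    AbsolutelyContinuousOnInterval (f ∘ h) a b := by
  have : ProperSpace W := FiniteDimensional.proper ℝ W
  obtain ⟨C, hC⟩ := hh.exists_bound
  obtain ⟨K, hK⟩ := (hf.contDiffOn (s := Metric.closedBall 0 C)).exists_lipschitzOnWith (by decide)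
    (convex_closedBall 0 C) (isCompact_closedBall 0 C)
  exact hK.comp_absolutelyContinuousOnInterval hh fun t ht => by simpa using hC t ht

theorem ContinuousLinearMap.comp_absolutelyContinuousOnInterval {h : ℝ → W} {a b : ℝ}
    (L : W →L[ℝ] W') (hh : AbsolutelyContinuousOnInterval h a b) :
    AbsolutelyContinuousOnInterval (fun t => L (h t)) a b :=
  (L.lipschitz.lipschitzOnWith (s := univ)).comp_absolutelyContinuousOnInterval hh
    (mapsTo_univ _ _)

theorem absolutelyContinuousOnInterval_primitive {f : ℝ → W} {a b : ℝ}
    (hf : IntervalIntegrable f volume a b) :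
    AbsolutelyContinuousOnInterval (fun t => ∫ s in a..t, f s) a b := by
  refine (hf.norm.absolutelyContinuousOnInterval_intervalIntegral (left_mem_uIcc)).of_dist_le
    (K := 1) ?_
  have hi : ∀ t ∈ uIcc a b, IntervalIntegrable f volume a t := fun t ht =>
    hf.mono_set (uIcc_subset_uIcc_left ht)
  intro s hs t ht
  rw [dist_eq_norm, dist_eq_norm, intervalIntegral.integral_interval_sub_left (hi s hs) (hi t ht),
    intervalIntegral.integral_interval_sub_left (hi s hs).norm (hi t ht).norm, one_mul]
  exact intervalIntegral.norm_integral_le_abs_integral_norm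

theorem AbsolutelyContinuousOnInterval.eqOn_of_ae_hasDerivAt {f g f' : ℝ → W} {a b : ℝ}
    (hf : AbsolutelyContinuousOnInterval f a b) (hg : AbsolutelyContinuousOnInterval g a b)
    (h0 : f a = g a) (hf' : ∀ᵐ t, t ∈ uIcc a b → HasDerivAt f (f' t) t)
    (hg' : ∀ᵐ t, t ∈ uIcc a b → HasDerivAt g (f' t) t) : EqOn f g (uIcc a b) := by
  obtain ⟨C, hC⟩ := (hf.sub hg).const_of_ae_hasDerivAt_zero (by
    filter_upwards [hf', hg'] with t h1 h2 ht
    simpa using (h1 ht).sub (h2 ht))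
  intro t ht
  have h1 := hC a left_mem_uIcc
  have h2 := hC t ht
  simp only [Pi.sub_apply, h0, sub_self] at h1 h2
  rw [← h1] at h2
  exact sub_eq_zero.1 h2

end AbsolutelyContinuous

/-! ### Horizontal curves and the endpoint map -/

section HorizontalCurves

variable {V : Type*} [NormedAddCommGroup V] [NormedSpace ℝ V] [FiniteDimensional ℝ V]

namespace HeisenbergData

variable (H : HeisenbergData V) (e : V)

/-- The `X₁`-coordinate of the lifted curve: the primitive of `q₁`. -/
def xCurve (q₁ : ℝ → ℝ) (t : ℝ) : ℝ := ∫ s in (0 : ℝ)..t, q₁ s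

/-- The curve in `V` solving `p' = q₂ exp (xD) e`, where `x' = q₁`. -/
def pCurve (q₁ q₂ : ℝ → ℝ) (t : ℝ) : V :=
  ∫ s in (0 : ℝ)..t, q₂ s • H.flow (xCurve q₁ s) e

/-- The central correction: half of the symplectic area swept out by `pCurve`. -/
def areaCurve (q₁ q₂ : ℝ → ℝ) (t : ℝ) : ℝ :=
  ∫ s in (0 : ℝ)..t, q₂ s • (1 / 2 * H.form (H.pCurve e q₁ q₂ s) (H.flow (xCurve q₁ s) e))

/-- The lift of the control `q₁ X₁ + q₂ e` to the model group. -/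
def liftCurve (q₁ q₂ : ℝ → ℝ) (t : ℝ) : V × ℝ :=
  (H.pCurve e q₁ q₂ t + H.areaCurve e q₁ q₂ t • H.z, xCurve q₁ t)

variable {e} {q₁ q₂ : ℝ → ℝ}

theorem continuous_flow : Continuous H.flow := H.contDiff_flow.continuous

theorem continuous_xCurve (h₁ : Integrable q₁) : Continuous (xCurve q₁) :=
  intervalIntegral.continuous_primitive (fun _ _ => h₁.intervalIntegrable) 0

theorem continuous_flow_xCurve (h₁ : Integrable q₁) (v : V) :
    Continuous fun s => H.flow (xCurve q₁ s) v :=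
  (H.continuous_flow.comp (continuous_xCurve h₁)).clm_apply continuous_const

theorem intervalIntegrable_pCurve (h₁ : Integrable q₁) (h₂ : Integrable q₂) (a b : ℝ) :
    IntervalIntegrable (fun s => q₂ s • H.flow (xCurve q₁ s) e) volume a b :=
  h₂.intervalIntegrable.smul_continuousOn (H.continuous_flow_xCurve h₁ e).continuousOn

theorem continuous_pCurve (h₁ : Integrable q₁) (h₂ : Integrable q₂) :
    Continuous (H.pCurve e q₁ q₂) :=
  intervalIntegral.continuous_primitive (fun _ _ => H.intervalIntegrable_pCurve h₁ h₂ _ _) 0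

theorem intervalIntegrable_areaCurve (h₁ : Integrable q₁) (h₂ : Integrable q₂) (a b : ℝ) :
    IntervalIntegrable (fun s => q₂ s •
      (1 / 2 * H.form (H.pCurve e q₁ q₂ s) (H.flow (xCurve q₁ s) e))) volume a b :=
  h₂.intervalIntegrable.smul_continuousOn (continuous_const.mul
    ((H.form.continuous.comp (H.continuous_pCurve h₁ h₂)).clm_apply
      (H.continuous_flow_xCurve h₁ e))).continuousOn

theorem ae_hasDerivAt_liftCurve (h₁ : Integrable q₁) (h₂ : Integrable q₂) :
    ∀ᵐ t, t ∈ uIcc (0 : ℝ) 1 → HasDerivAt (xCurve q₁) (q₁ t) t ∧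
      HasDerivAt (H.pCurve e q₁ q₂) (q₂ t • H.flow (xCurve q₁ t) e) t ∧
      HasDerivAt (H.areaCurve e q₁ q₂)
        (q₂ t • (1 / 2 * H.form (H.pCurve e q₁ q₂ t) (H.flow (xCurve q₁ t) e))) t := by
  have : CompleteSpace V := FiniteDimensional.complete ℝ V
  filter_upwards [(h₁.intervalIntegrable (a := 0) (b := 1)).ae_hasDerivAt_integral,
    (H.intervalIntegrable_pCurve (e := e) h₁ h₂ 0 1).ae_hasDerivAt_integral,
    (H.intervalIntegrable_areaCurve (e := e) h₁ h₂ 0 1).ae_hasDerivAt_integral] with t a b c ht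
  exact ⟨a ht 0 left_mem_uIcc, b ht 0 left_mem_uIcc, c ht 0 left_mem_uIcc⟩

theorem absolutelyContinuous_xCurve (h₁ : Integrable q₁) :
    AbsolutelyContinuousOnInterval (xCurve q₁) 0 1 :=
  absolutelyContinuousOnInterval_primitive h₁.intervalIntegrable

theorem absolutelyContinuous_pCurve (h₁ : Integrable q₁) (h₂ : Integrable q₂) :
    AbsolutelyContinuousOnInterval (H.pCurve e q₁ q₂) 0 1 :=
  absolutelyContinuousOnInterval_primitive (H.intervalIntegrable_pCurve h₁ h₂ _ _)

theorem absolutelyContinuous_fst_liftCurve (h₁ : Integrable q₁) (h₂ : Integrable q₂) :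
    AbsolutelyContinuousOnInterval (fun t => (H.liftCurve e q₁ q₂ t).1) 0 1 :=
  (H.absolutelyContinuous_pCurve h₁ h₂).add
    (((ContinuousLinearMap.id ℝ ℝ).smulRight H.z).comp_absolutelyContinuousOnInterval
      (absolutelyContinuousOnInterval_primitive
        (H.intervalIntegrable_areaCurve h₁ h₂ _ _)))

theorem absolutelyContinuous_liftCurve (h₁ : Integrable q₁) (h₂ : Integrable q₂) :
    AbsolutelyContinuousOnInterval (H.liftCurve e q₁ q₂) 0 1 := by
  have h := ((ContinuousLinearMap.inl ℝ V ℝ).comp_absolutelyContinuousOnInterval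
    (H.absolutelyContinuous_fst_liftCurve (e := e) h₁ h₂)).add
    ((ContinuousLinearMap.inr ℝ V ℝ).comp_absolutelyContinuousOnInterval
      (absolutelyContinuous_xCurve h₁))
  refine h.of_dist_le (K := 1) fun s _ t _ => ?_
  simp [liftCurve]

theorem continuous_liftCurve (h₁ : Integrable q₁) (h₂ : Integrable q₂) :
    Continuous (H.liftCurve e q₁ q₂) :=
  ((H.continuous_pCurve h₁ h₂).add ((intervalIntegral.continuous_primitive
    (fun _ _ => H.intervalIntegrable_areaCurve h₁ h₂ _ _) 0).smul continuous_const)).prodMk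
    (continuous_xCurve h₁)

theorem liftCurve_zero : H.liftCurve e q₁ q₂ 0 = 0 := by
  simp [liftCurve, pCurve, areaCurve, xCurve]

end HeisenbergData

variable {E : Type*} [NormedAddCommGroup E] [NormedSpace ℝ E] [FiniteDimensional ℝ E]
  {G : Type*} [TopologicalSpace G] [ChartedSpace E G] [Group G]
  [LieGroup 𝓘(ℝ, E) ∞ G] [T2Space G]

namespace HeisenbergData.Realization

variable {H : HeisenbergData V} (R : H.Realization (E := E) G) {e : V} {q₁ q₂ : ℝ → ℝ}
  {r : ℕ} {Y : Fin r → E} {u : Control r}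

theorem isHorizontalCurve_liftCurve (h₁ : Integrable q₁) (h₂ : Integrable q₂)
    (hY : ∀ᵐ t ∂(volume.restrict (Icc (0 : ℝ) 1)),
      ∑ i, (u t) i • Y i = R.lin (q₂ t • e, q₁ t)) :
    IsHorizontalCurve (G := G) Y u (fun t => R.ofPair (H.liftCurve e q₁ q₂ t)) where
  map_zero := by rw [liftCurve_zero, ofPair_zero]
  continuousOn := (R.contMDiff_ofPair.continuous.comp (H.continuous_liftCurve h₁ h₂)).continuousOn
  absolutelyContinuous φ hφ := by
    have h1 : ContDiff ℝ 1 (fun p => φ (R.ofPair p)) :=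
      (contMDiff_iff_contDiff.1 (hφ.comp R.contMDiff_ofPair)).of_le (by simp)
    exact h1.comp_absolutelyContinuousOnInterval (H.absolutelyContinuous_liftCurve h₁ h₂)
  hasDeriv := by
    rw [ae_restrict_iff' measurableSet_Icc] at hY ⊢
    have h3 := H.ae_hasDerivAt_liftCurve (e := e) h₁ h₂
    rw [uIcc_of_le zero_le_one] at h3
    filter_upwards [hY, h3] with t hYt h3t ht
    obtain ⟨hx, hp, ha⟩ := h3t ht
    have h4 : HasDerivAt (H.liftCurve e q₁ q₂) _ t := (hp.add (ha.smul_const H.z)).prodMk hx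
    have h5 := hasLeftVelocity_iff_hasMFDerivAt.1 (R.hasLeftVelocity_ofPair_comp h4)
    have h6 : H.transDeriv (H.liftCurve e q₁ q₂ t)
        (q₂ t • H.flow (xCurve q₁ t) e + (q₂ t • (1 / 2 * H.form (H.pCurve e q₁ q₂ t)
          (H.flow (xCurve q₁ t) e))) • H.z, q₁ t) = (q₂ t • e, q₁ t) := by
      rw [transDeriv_apply]
      refine Prod.ext ?_ rfl
      simp only [liftCurve, map_add, map_smul, flow_neg_flow, flow_z, add_apply, smul_apply,
        form_z, form_z_right, smul_eq_mul]
      module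
    rw [h6, ← hYt ht] at h5
    exact h5

variable [SimplyConnectedSpace G]

/-- Uniqueness of the horizontal curve with a given control. In the coordinates of the model group
its equation is triangular, so that the `X₁`-coordinate, the pairings with the form and the remaining
coordinates are determined one after the other, each as an absolutely continuous function with known
derivative. -/
theorem eqOn_liftCurve {γ : ℝ → G} (h₁ : Integrable q₁) (h₂ : Integrable q₂)
    (hY : ∀ᵐ t ∂(volume.restrict (Icc (0 : ℝ) 1)),
      ∑ i, (u t) i • Y i = R.lin (q₂ t • e, q₁ t)) (hγ : IsHorizontalCurve (G := G) Y u γ) :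
    EqOn (fun t => R.toPair (γ t)) (H.liftCurve e q₁ q₂) (uIcc 0 1) := by
  set c := fun t => R.toPair (γ t)
  have hc0 : c 0 = 0 := R.bijective_ofPair.1 (by simp [c, hγ.map_zero])
  have hac : ∀ L : V × ℝ →L[ℝ] ℝ, AbsolutelyContinuousOnInterval (fun t => L (c t)) 0 1 :=
    fun L => hγ.absolutelyContinuous (fun g => L (R.toPair g))
      (L.contDiff.contMDiff.comp R.contMDiff_toPair)
  have hd : ∀ᵐ t, t ∈ uIcc (0 : ℝ) 1 → ∃ c', HasDerivAt c c' t ∧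
      H.transDeriv (c t) c' = (q₂ t • e, q₁ t) := by
    have h := hγ.hasDeriv
    rw [ae_restrict_iff' measurableSet_Icc] at h hY
    rw [uIcc_of_le zero_le_one]
    filter_upwards [h, hY] with t ht hYt htI
    have h1 := ht htI
    obtain ⟨c', h2, h3⟩ := R.exists_hasDerivAt_toPair (hasLeftVelocity_iff_hasMFDerivAt.2 h1)
    refine ⟨c', h2, R.lin.injective ?_⟩
    exact h3.trans (hYt htI)
  have hl := H.ae_hasDerivAt_liftCurve (e := e) h₁ h₂
  have hx : EqOn (fun t => (c t).2) (xCurve q₁) (uIcc 0 1) := by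
    refine (hac (ContinuousLinearMap.snd ℝ V ℝ)).eqOn_of_ae_hasDerivAt (f' := q₁)
      (absolutelyContinuous_xCurve h₁) (by simp [hc0, xCurve]) ?_ ?_
    · filter_upwards [hd] with t ht htI
      obtain ⟨c', h2, h3⟩ := ht htI
      have h4 : c'.2 = q₁ t := congrArg Prod.snd h3
      exact h4 ▸ h2.snd
    · filter_upwards [hl] with t ht htI using (ht htI).1
  have hv : ∀ᵐ t, t ∈ uIcc (0 : ℝ) 1 → ∃ v', HasDerivAt (fun t => (c t).1) v' t ∧
      v' = q₂ t • H.flow (xCurve q₁ t) e + (1 / 2 * H.form (c t).1 v') • H.z := by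
    filter_upwards [hd] with t ht htI
    obtain ⟨c', h2, h3⟩ := ht htI
    refine ⟨c'.1, h2.fst, ?_⟩
    have h4 : H.flow (-(c t).2) c'.1 - (1 / 2 * H.form (c t).1 c'.1) • H.z = q₂ t • e :=
      congrArg Prod.fst h3
    have h5 := congrArg (H.flow (c t).2) h4
    rw [map_sub, flow_flow_neg, map_smul, flow_z, map_smul, sub_eq_iff_eq_add] at h5
    rw [← hx htI]
    exact h5
  have hω : ∀ w, EqOn (fun t => H.form w (c t).1) (fun t => H.form w (H.pCurve e q₁ q₂ t))
      (uIcc 0 1) := by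
    intro w
    refine (hac ((H.form w).comp (ContinuousLinearMap.fst ℝ V ℝ))).eqOn_of_ae_hasDerivAt
      (f' := fun t => H.form w (q₂ t • H.flow (xCurve q₁ t) e))
      ((H.form w).comp_absolutelyContinuousOnInterval (H.absolutelyContinuous_pCurve h₁ h₂))
      (by simp [hc0, pCurve]) ?_ ?_
    · filter_upwards [hv] with t ht htI
      obtain ⟨v', h2, h3⟩ := ht htI
      have h4 := (H.form w).hasFDerivAt.comp_hasDerivAt t h2
      refine h4.congr_deriv ?_
      rw [h3]; simp
    · filter_upwards [hl] with t ht htI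
      exact (H.form w).hasFDerivAt.comp_hasDerivAt t (ht htI).2.1
  have hV : ∀ L : V →L[ℝ] ℝ, EqOn (fun t => L (c t).1) (fun t => L (H.liftCurve e q₁ q₂ t).1)
      (uIcc 0 1) := by
    intro L
    refine (hac (L.comp (ContinuousLinearMap.fst ℝ V ℝ))).eqOn_of_ae_hasDerivAt
      (f' := fun t => L (q₂ t • H.flow (xCurve q₁ t) e + (q₂ t • (1 / 2 *
        H.form (H.pCurve e q₁ q₂ t) (H.flow (xCurve q₁ t) e))) • H.z))
      (L.comp_absolutelyContinuousOnInterval (H.absolutelyContinuous_fst_liftCurve h₁ h₂))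
      (by simp [hc0, liftCurve_zero]) ?_ ?_
    · filter_upwards [hv] with t ht htI
      obtain ⟨v', h2, h3⟩ := ht htI
      have h4 := L.hasFDerivAt.comp_hasDerivAt t h2
      refine h4.congr_deriv ?_
      have h5 : H.form (c t).1 v' = q₂ t * H.form (H.pCurve e q₁ q₂ t) (H.flow (xCurve q₁ t) e) := by
        rw [h3, map_add, map_smul, map_smul, form_z_right, smul_zero, add_zero, smul_eq_mul,
          H.form_swap (c t).1, H.form_swap (H.pCurve e q₁ q₂ t)]
        have := hω (H.flow (xCurve q₁ t) e) htI
        dsimp only at this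
        rw [this]
      rw [h3, h5]
      congr 3
      simp only [smul_eq_mul]; ring
    · filter_upwards [hl] with t ht htI
      exact L.hasFDerivAt.comp_hasDerivAt t ((ht htI).2.1.add ((ht htI).2.2.smul_const H.z))
  intro t ht
  refine Prod.ext ?_ (hx ht)
  rw [← sub_eq_zero, ← Module.forall_dual_apply_eq_zero_iff ℝ]
  intro L
  have h := hV (LinearMap.toContinuousLinearMap L) ht
  simpa [sub_eq_zero] using h

theorem endpointMap_eq (h₁ : Integrable q₁) (h₂ : Integrable q₂)
    (hY : ∀ᵐ t ∂(volume.restrict (Icc (0 : ℝ) 1)),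
      ∑ i, (u t) i • Y i = R.lin (q₂ t • e, q₁ t)) :
    endpointMap (G := G) Y u = R.ofPair (H.liftCurve e q₁ q₂ 1) := by
  have hex : ∃ γ : ℝ → G, IsHorizontalCurve Y u γ := ⟨_, R.isHorizontalCurve_liftCurve h₁ h₂ hY⟩
  have h1 : endpointMap (G := G) Y u = hex.choose 1 := dif_pos hex
  rw [h1, ← R.eqOn_liftCurve h₁ h₂ hY hex.choose_spec right_mem_uIcc]
  simp

end HeisenbergData.Realization

end HorizontalCurves

/-! ### A calculus of absolutely continuous functions on the unit interval -/

section ACDeriv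

variable {W W' W'' : Type*} [NormedAddCommGroup W] [NormedSpace ℝ W] [NormedAddCommGroup W']
  [NormedSpace ℝ W'] [NormedAddCommGroup W''] [NormedSpace ℝ W'']

/-- On `[0, 1]`, the function `f` is absolutely continuous with a.e. derivative `f'`. -/
structure HasACDeriv (f f' : ℝ → W) : Prop where
  ac : AbsolutelyContinuousOnInterval f 0 1
  deriv : ∀ᵐ t, t ∈ uIcc (0 : ℝ) 1 → HasDerivAt f (f' t) t

namespace HasACDeriv

variable {f f' g g' : ℝ → W} {h h' : ℝ → W'}

theorem add (hf : HasACDeriv f f') (hg : HasACDeriv g g') :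
    HasACDeriv (fun t => f t + g t) (fun t => f' t + g' t) :=
  ⟨hf.ac.add hg.ac, by
    filter_upwards [hf.deriv, hg.deriv] with t h1 h2 ht using (h1 ht).add (h2 ht)⟩

theorem sub (hf : HasACDeriv f f') (hg : HasACDeriv g g') :
    HasACDeriv (fun t => f t - g t) (fun t => f' t - g' t) :=
  ⟨hf.ac.sub hg.ac, by
    filter_upwards [hf.deriv, hg.deriv] with t h1 h2 ht using (h1 ht).sub (h2 ht)⟩

theorem const (c : W) : HasACDeriv (fun _ => c) (fun _ => 0) :=
  ⟨((LipschitzWith.const c).lipschitzOnWith (s := uIcc 0 1)).absolutelyContinuousOnInterval,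
    Eventually.of_forall fun _ _ => hasDerivAt_const _ _⟩

theorem congr_deriv (hf : HasACDeriv f f') (h : ∀ᵐ t, t ∈ uIcc (0 : ℝ) 1 → f' t = g' t) :
    HasACDeriv f g' :=
  ⟨hf.ac, by filter_upwards [hf.deriv, h] with t h1 h2 ht using h2 ht ▸ h1 ht⟩

theorem eqOn (hf : HasACDeriv f f') (hg : HasACDeriv g g') (h0 : f 0 = g 0)
    (h : ∀ᵐ t, t ∈ uIcc (0 : ℝ) 1 → f' t = g' t) : EqOn f g (uIcc 0 1) :=
  (hf.congr_deriv h).ac.eqOn_of_ae_hasDerivAt hg.ac h0 (hf.congr_deriv h).deriv hg.deriv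

theorem eqOn_const (hf : HasACDeriv f f') (h : ∀ᵐ t, t ∈ uIcc (0 : ℝ) 1 → f' t = 0) :
    ∀ t ∈ uIcc (0 : ℝ) 1, f t = f 0 :=
  hf.eqOn (const (f 0)) rfl h

theorem clm (hf : HasACDeriv f f') (L : W →L[ℝ] W') :
    HasACDeriv (fun t => L (f t)) (fun t => L (f' t)) :=
  ⟨L.comp_absolutelyContinuousOnInterval hf.ac, by
    filter_upwards [hf.deriv] with t h1 ht using L.hasFDerivAt.comp_hasDerivAt t (h1 ht)⟩

theorem prodMk (hf : HasACDeriv f f') (hh : HasACDeriv h h') :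
    HasACDeriv (fun t => (f t, h t)) (fun t => (f' t, h' t)) := by
  have h1 := (hf.clm (ContinuousLinearMap.inl ℝ W W')).add
    (hh.clm (ContinuousLinearMap.inr ℝ W W'))
  simpa using h1

theorem comp [FiniteDimensional ℝ W] (hf : HasACDeriv f f') {φ : W → W'} (hφ : ContDiff ℝ 1 φ)
    {φ' : W → W → W'} (hφ' : ∀ w v : W, fderiv ℝ φ w v = φ' w v) :
    HasACDeriv (fun t => φ (f t)) (fun t => φ' (f t) (f' t)) :=
  ⟨hφ.comp_absolutelyContinuousOnInterval hf.ac, by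
    filter_upwards [hf.deriv] with t h1 ht
    rw [← hφ']
    exact (hφ.differentiable (by simp) (f t)).hasFDerivAt.comp_hasDerivAt t (h1 ht)⟩

theorem bilin [FiniteDimensional ℝ W] [FiniteDimensional ℝ W'] (hf : HasACDeriv f f')
    (hh : HasACDeriv h h') (B : W →L[ℝ] W' →L[ℝ] W'') :
    HasACDeriv (fun t => B (f t) (h t)) (fun t => B (f' t) (h t) + B (f t) (h' t)) := by
  refine (hf.prodMk hh).comp (φ := fun p : W × W' => B p.1 p.2)
    (φ' := fun p v => B v.1 p.2 + B p.1 v.2) ?_ ?_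
  · exact (B.contDiff.comp contDiff_fst).clm_apply contDiff_snd
  · rintro ⟨w, w'⟩ ⟨v, v'⟩
    have h1 := B.isBoundedBilinearMap.hasFDerivAt (w, w')
    rw [h1.fderiv]
    simp [add_comm]

theorem smul [FiniteDimensional ℝ W] {a a' : ℝ → ℝ} (ha : HasACDeriv a a')
    (hf : HasACDeriv f f') :
    HasACDeriv (fun t => a t • f t) (fun t => a' t • f t + a t • f' t) :=
  ha.bilin hf (ContinuousLinearMap.lsmul ℝ ℝ)

theorem mul {a a' b b' : ℝ → ℝ} (ha : HasACDeriv a a') (hb : HasACDeriv b b') :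
    HasACDeriv (fun t => a t * b t) (fun t => a' t * b t + a t * b' t) :=
  ha.smul hb

theorem primitive [CompleteSpace W] (hf : IntervalIntegrable f volume 0 1) :
    HasACDeriv (fun t => ∫ s in (0 : ℝ)..t, f s) f :=
  ⟨absolutelyContinuousOnInterval_primitive hf, by
    filter_upwards [hf.ae_hasDerivAt_integral] with t h1 ht using h1 ht 0 left_mem_uIcc⟩

end HasACDeriv

end ACDeriv

/-! ### Integral operators on `L¹` -/

section Operators

/-- The space `L¹([0,1], ℝ)`. -/
abbrev UnitL1 : Type := Lp ℝ 1 (volume.restrict (Icc (0 : ℝ) 1))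

namespace UnitL1

/-- The extension by zero to the real line of an integrable function on `[0, 1]`. -/
def ext (q : UnitL1) : ℝ → ℝ := (Icc (0 : ℝ) 1).indicator q

theorem integrable_ext (q : UnitL1) : Integrable q.ext :=
  (integrable_indicator_iff measurableSet_Icc).2 (L1.integrable_coeFn q)

theorem ext_ae_eq {q : UnitL1} {f : ℝ → ℝ} (h : q =ᵐ[volume.restrict (Icc (0 : ℝ) 1)] f) :
    ∀ᵐ t, t ∈ uIcc (0 : ℝ) 1 → q.ext t = f t := by
  rw [uIcc_of_le zero_le_one]
  rw [EventuallyEq, ae_restrict_iff' measurableSet_Icc] at h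
  filter_upwards [h] with t ht htI
  rw [ext, indicator_of_mem htI, ht htI]

theorem ext_add (p q : UnitL1) : ∀ᵐ t, (p + q).ext t = p.ext t + q.ext t := by
  have h := ext_ae_eq (Lp.coeFn_add p q)
  filter_upwards [h] with t ht
  by_cases htI : t ∈ Icc (0 : ℝ) 1
  · rw [ht (by rwa [uIcc_of_le zero_le_one])]
    simp [ext, htI]
  · simp [ext, htI]

theorem ext_smul (c : ℝ) (q : UnitL1) : ∀ᵐ t, (c • q).ext t = c * q.ext t := by
  have h := ext_ae_eq (Lp.coeFn_smul c q)
  filter_upwards [h] with t ht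
  by_cases htI : t ∈ Icc (0 : ℝ) 1
  · rw [ht (by rwa [uIcc_of_le zero_le_one])]
    simp [ext, htI]
  · simp [ext, htI]

theorem norm_eq (q : UnitL1) : ‖q‖ = ∫ t, ‖q.ext t‖ := by
  rw [L1.norm_eq_integral_norm, ← integral_indicator measurableSet_Icc]
  congr 1
  ext t
  rw [ext, norm_indicator_eq_indicator_norm]

variable {W : Type*} [NormedAddCommGroup W] [NormedSpace ℝ W]

theorem intervalIntegrable_ext_smul (q : UnitL1) {g : ℝ → W} (hg : Continuous g) (a b : ℝ) :
    IntervalIntegrable (fun s => q.ext s • g s) volume a b :=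
  q.integrable_ext.intervalIntegrable.smul_continuousOn hg.continuousOn

/-- Multiplication by a continuous function followed by integration from `0`, as a bounded bilinear
operator. -/
def primitiveL : C(Icc (0 : ℝ) 1, W) →L[ℝ] UnitL1 →L[ℝ] C(Icc (0 : ℝ) 1, W) :=
  have hc : ∀ g : C(Icc (0 : ℝ) 1, W), Continuous fun s => g (projIcc 0 1 zero_le_one s) :=
    fun g => g.continuous.comp continuous_projIcc
  have hi : ∀ (g : C(Icc (0 : ℝ) 1, W)) (q : UnitL1) (a b : ℝ), IntervalIntegrable
      (fun s => q.ext s • g (projIcc 0 1 zero_le_one s)) volume a b :=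
    fun g q => q.intervalIntegrable_ext_smul (hc g)
  LinearMap.mkContinuous₂ (LinearMap.mk₂ ℝ
    (fun g q => (⟨fun t => ∫ s in (0 : ℝ)..t, q.ext s • g (projIcc 0 1 zero_le_one s),
      (intervalIntegral.continuous_primitive (hi g q) 0).comp continuous_subtype_val⟩ :
        C(Icc (0 : ℝ) 1, W)))
    (fun g g' q => by
      ext t
      simp only [ContinuousMap.add_apply, ContinuousMap.coe_mk, smul_add]
      exact intervalIntegral.integral_add (hi g q _ _) (hi g' q _ _))
    (fun c g q => by
      ext t
      simp only [ContinuousMap.smul_apply, ContinuousMap.coe_mk]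
      rw [← intervalIntegral.integral_smul]
      simp only [smul_comm c])
    (fun g q q' => by
      ext t
      simp only [ContinuousMap.add_apply, ContinuousMap.coe_mk]
      rw [← intervalIntegral.integral_add (hi g q _ _) (hi g q' _ _)]
      refine intervalIntegral.integral_congr_ae ?_
      filter_upwards [ext_add q q'] with s hs _
      rw [hs, add_smul])
    (fun c g q => by
      ext t
      simp only [ContinuousMap.smul_apply, ContinuousMap.coe_mk]
      rw [← intervalIntegral.integral_smul]
      refine intervalIntegral.integral_congr_ae ?_
      filter_upwards [ext_smul c q] with s hs _
      rw [hs, smul_smul])) 1 (fun g q => by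
    rw [one_mul, ContinuousMap.norm_le _ (by positivity)]
    intro t
    refine intervalIntegral.norm_integral_le_integral_norm_uIoc.trans ?_
    rw [norm_eq, ← integral_const_mul]
    refine (integral_mono_of_nonneg (Eventually.of_forall fun _ => norm_nonneg _)
      ((q.integrable_ext.norm.const_mul ‖g‖).integrableOn) (Eventually.of_forall fun s => ?_)).trans
      (setIntegral_le_integral (q.integrable_ext.norm.const_mul _)
        (Eventually.of_forall fun s => by positivity))
    simp only [norm_smul]
    rw [mul_comm]
    gcongr
    exact g.norm_coe_le_norm _)

theorem primitiveL_apply (g : C(Icc (0 : ℝ) 1, W)) (q : UnitL1) (t : Icc (0 : ℝ) 1) :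
    primitiveL g q t = ∫ s in (0 : ℝ)..t, q.ext s • g (projIcc 0 1 zero_le_one s) := rfl

end UnitL1

/-- A bounded bilinear map, applied pointwise to continuous functions. -/
def ContinuousLinearMap.pointwise {K W W' W'' : Type*} [TopologicalSpace K] [CompactSpace K]
    [NormedAddCommGroup W] [NormedSpace ℝ W] [NormedAddCommGroup W']
    [NormedSpace ℝ W'] [NormedAddCommGroup W''] [NormedSpace ℝ W''] (B : W →L[ℝ] W' →L[ℝ] W'') :
    C(K, W) →L[ℝ] C(K, W') →L[ℝ] C(K, W'') :=
  LinearMap.mkContinuous₂ (LinearMap.mk₂ ℝ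
    (fun f g => (⟨fun t => B (f t) (g t),
      (B.continuous.comp f.continuous).clm_apply g.continuous⟩ : C(K, W'')))
    (fun _ _ _ => by ext; simp) (fun _ _ _ => by ext; simp) (fun _ _ _ => by ext; simp)
    (fun _ _ _ => by ext; simp)) ‖B‖ (fun f g => by
    rw [ContinuousMap.norm_le _ (by positivity)]
    intro t
    refine (B.le_opNorm₂ _ _).trans ?_
    gcongr
    · exact f.norm_coe_le_norm t
    · exact g.norm_coe_le_norm t)

theorem ContinuousLinearMap.pointwise_apply {K W W' W'' : Type*} [TopologicalSpace K]
    [CompactSpace K] [NormedAddCommGroup W] [NormedSpace ℝ W] [NormedAddCommGroup W']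
    [NormedSpace ℝ W'] [NormedAddCommGroup W''] [NormedSpace ℝ W''] (B : W →L[ℝ] W' →L[ℝ] W'')
    (f : C(K, W)) (g : C(K, W')) (t : K) : B.pointwise f g t = B (f t) (g t) := rfl

end Operators

/-! ### The differential of the endpoint map -/

section EndpointDerivative

variable {V : Type*} [NormedAddCommGroup V] [NormedSpace ℝ V] [FiniteDimensional ℝ V]

namespace HeisenbergData

variable (H : HeisenbergData V) {N : ℕ} (e : V)

theorem flow_apply_eq_sum (hN : H.D ^ N = 0) (t : ℝ) (v : V) :
    H.flow t v = ∑ k ∈ Finset.range N, ((k.factorial : ℝ)⁻¹ * t ^ k) • (H.D ^ k) v := by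
  have h : H.flow t = ∑ k ∈ Finset.range N, (k.factorial : ℝ)⁻¹ • (t • H.D) ^ k := by
    rw [flow, NormedSpace.exp_eq_tsum ℝ]
    refine tsum_eq_sum fun k hk => ?_
    rw [smul_pow, ← Nat.sub_add_cancel (not_lt.1 (mt Finset.mem_range.2 hk)), pow_add H.D, hN]
    simp
  rw [h]
  simp [smul_pow, smul_smul]

/-- The curve `t ↦ exp (x(t) D) e` as a function of the continuous function `x`. -/
def flowCurve (x : C(Icc (0 : ℝ) 1, ℝ)) : C(Icc (0 : ℝ) 1, V) :=
  ⟨fun t => H.flow (x t) e, (H.continuous_flow.comp x.continuous).clm_apply continuous_const⟩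

theorem flowCurve_apply (x : C(Icc (0 : ℝ) 1, ℝ)) (t : Icc (0 : ℝ) 1) :
    H.flowCurve e x t = H.flow (x t) e := rfl

/-- As `D` is nilpotent, `exp (x D) e` is a polynomial in `x`. -/
theorem differentiable_flowCurve (hN : H.D ^ N = 0) : Differentiable ℝ (H.flowCurve e) := by
  have h : H.flowCurve e = fun x => ∑ k ∈ Finset.range N,
      (((k.factorial : ℝ)⁻¹ • ContinuousLinearMap.toSpanSingleton ℝ ((H.D ^ k) e)).compLeftContinuous
        ℝ (Icc (0 : ℝ) 1)) (x ^ k) := by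
    ext x t
    rw [flowCurve_apply, H.flow_apply_eq_sum hN]
    simp [ContinuousMap.sum_apply, smul_smul]
  rw [h]
  refine Differentiable.fun_sum fun k _ => ?_
  exact (ContinuousLinearMap.differentiable _).comp (differentiable_id.pow k)

theorem fderiv_flowCurve (hN : H.D ^ N = 0) (x h : C(Icc (0 : ℝ) 1, ℝ)) (t : Icc (0 : ℝ) 1) :
    fderiv ℝ (H.flowCurve e) x h t = h t • H.D (H.flow (x t) e) := by
  have h1 : HasFDerivAt (H.flowCurve e) (fderiv ℝ (H.flowCurve e) x) (x + (0 : ℝ) • h) := by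
    rw [zero_smul, add_zero]
    exact (H.differentiable_flowCurve e hN x).hasFDerivAt
  have h2 := HasFDerivAt.comp_hasDerivAt (f := fun s : ℝ => x + s • h) 0 h1
    (((hasDerivAt_id (0 : ℝ)).smul_const h).const_add x)
  have h3 := (ContinuousMap.evalCLM ℝ t : C(Icc (0 : ℝ) 1, V) →L[ℝ] V).hasFDerivAt.comp_hasDerivAt
    0 h2
  have h4 : HasDerivAt (fun s : ℝ => x t + s * h t) (1 * h t) 0 :=
    ((hasDerivAt_id (0 : ℝ)).mul_const (h t)).const_add (x t)
  have h5 := HasDerivAt.scomp (h := fun s : ℝ => x t + s * h t) (0 : ℝ)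
    (by simpa using H.hasDerivAt_flow e (x t)) h4
  simpa using h3.unique h5

/-- The time-one value of the lift of a control, as a map on `L¹ × L¹`. -/
def liftEndpoint (q : UnitL1 × UnitL1) : V × ℝ := H.liftCurve e q.1.ext q.2.ext 1

/-- The curve `xCurve` as a bounded operator. -/
def xOp : UnitL1 →L[ℝ] C(Icc (0 : ℝ) 1, ℝ) := UnitL1.primitiveL 1

theorem xOp_apply (q : UnitL1) (t : Icc (0 : ℝ) 1) : xOp q t = xCurve q.ext t := by
  simp [xOp, xCurve, UnitL1.primitiveL_apply]

/-- The curve `pCurve` as a map into the continuous functions. -/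
def pOp (q : UnitL1 × UnitL1) : C(Icc (0 : ℝ) 1, V) :=
  UnitL1.primitiveL (H.flowCurve e (xOp q.1)) q.2

/-- The curve `areaCurve` as a map into the continuous functions. -/
def areaOp (q : UnitL1 × UnitL1) : C(Icc (0 : ℝ) 1, ℝ) :=
  UnitL1.primitiveL (((1 / 2 : ℝ) • H.form).pointwise (H.pOp e q) (H.flowCurve e (xOp q.1))) q.2

theorem integral_projIcc_congr {W : Type*} [NormedAddCommGroup W] [NormedSpace ℝ W]
    {q : UnitL1} {g : Icc (0 : ℝ) 1 → W} {g' : ℝ → W} (h : ∀ t : Icc (0 : ℝ) 1, g t = g' t)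
    (t : Icc (0 : ℝ) 1) :
    ∫ s in (0 : ℝ)..t, q.ext s • g (projIcc 0 1 zero_le_one s) =
      ∫ s in (0 : ℝ)..t, q.ext s • g' s := by
  refine intervalIntegral.integral_congr fun s hs => ?_
  rw [uIcc_of_le t.2.1] at hs
  have hs' : s ∈ Icc (0 : ℝ) 1 := ⟨hs.1, hs.2.trans t.2.2⟩
  rw [h, projIcc_of_mem _ hs']

theorem pOp_apply (q : UnitL1 × UnitL1) (t : Icc (0 : ℝ) 1) :
    H.pOp e q t = H.pCurve e q.1.ext q.2.ext t := by
  rw [pOp, UnitL1.primitiveL_apply, pCurve]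
  refine integral_projIcc_congr (fun t => ?_) t
  rw [flowCurve_apply, xOp_apply]

theorem areaOp_apply (q : UnitL1 × UnitL1) (t : Icc (0 : ℝ) 1) :
    H.areaOp e q t = H.areaCurve e q.1.ext q.2.ext t := by
  rw [areaOp, UnitL1.primitiveL_apply, areaCurve]
  refine integral_projIcc_congr (g' := fun s => 1 / 2 * H.form (H.pCurve e q.1.ext q.2.ext s)
    (H.flow (xCurve q.1.ext s) e)) (fun t => ?_) t
  rw [ContinuousLinearMap.pointwise_apply, flowCurve_apply, xOp_apply, pOp_apply]
  simp

theorem liftEndpoint_eq (q : UnitL1 × UnitL1) : H.liftEndpoint e q =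
    (H.pOp e q 1 + H.areaOp e q 1 • H.z, xOp q.1 1) := by
  rw [pOp_apply, areaOp_apply, xOp_apply]; rfl

/-- The variation of `pCurve` in the direction of the control variation `(δ₁, δ₂)`. -/
def pVariation (q δ : UnitL1 × UnitL1) (t : ℝ) : V :=
  (∫ s in (0 : ℝ)..t, q.2.ext s • xCurve δ.1.ext s • H.D (H.flow (xCurve q.1.ext s) e)) +
    ∫ s in (0 : ℝ)..t, δ.2.ext s • H.flow (xCurve q.1.ext s) e

/-- The variation of `areaCurve` in the direction of the control variation `(δ₁, δ₂)`. -/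
def areaVariation (q δ : UnitL1 × UnitL1) (t : ℝ) : ℝ :=
  (∫ s in (0 : ℝ)..t, q.2.ext s • (1 / 2 *
    (H.form (H.pVariation e q δ s) (H.flow (xCurve q.1.ext s) e) +
      H.form (H.pCurve e q.1.ext q.2.ext s)
        (xCurve δ.1.ext s • H.D (H.flow (xCurve q.1.ext s) e))))) +
    ∫ s in (0 : ℝ)..t, δ.2.ext s • (1 / 2 *
      H.form (H.pCurve e q.1.ext q.2.ext s) (H.flow (xCurve q.1.ext s) e))

theorem hasFDerivAt_xOp_fst (q : UnitL1 × UnitL1) :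
    HasFDerivAt (fun q : UnitL1 × UnitL1 => xOp q.1)
      (xOp.comp (ContinuousLinearMap.fst ℝ UnitL1 UnitL1)) q :=
  (xOp.comp (ContinuousLinearMap.fst ℝ UnitL1 UnitL1)).hasFDerivAt

theorem exists_hasFDerivAt_flowCurve (hN : H.D ^ N = 0) (q : UnitL1 × UnitL1) :
    ∃ T : UnitL1 × UnitL1 →L[ℝ] C(Icc (0 : ℝ) 1, V),
      HasFDerivAt (fun q : UnitL1 × UnitL1 => H.flowCurve e (xOp q.1)) T q ∧
      ∀ δ t, T δ t = xCurve δ.1.ext t • H.D (H.flow (xCurve q.1.ext t) e) := by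
  refine ⟨_, HasFDerivAt.comp (g := H.flowCurve e) (f := fun q : UnitL1 × UnitL1 => xOp q.1) q
    (H.differentiable_flowCurve e hN (xOp q.1)).hasFDerivAt (hasFDerivAt_xOp_fst q),
    fun δ t => ?_⟩
  simp only [ContinuousLinearMap.comp_apply]
  rw [H.fderiv_flowCurve e hN]
  simp [xOp_apply]

theorem exists_hasFDerivAt_pOp (hN : H.D ^ N = 0) (q : UnitL1 × UnitL1) :
    ∃ T : UnitL1 × UnitL1 →L[ℝ] C(Icc (0 : ℝ) 1, V), HasFDerivAt (H.pOp e) T q ∧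
      ∀ δ t, T δ t = H.pVariation e q δ t := by
  obtain ⟨T, hT, hTδ⟩ := H.exists_hasFDerivAt_flowCurve e hN q
  refine ⟨_, UnitL1.primitiveL.hasFDerivAt_of_bilinear hT hasFDerivAt_snd, fun δ t => ?_⟩
  rw [pVariation, add_comm]
  simp only [add_apply, ContinuousLinearMap.precompR_apply, ContinuousLinearMap.precompL_apply,
    ContinuousMap.add_apply, UnitL1.primitiveL_apply]
  congr 1
  · exact integral_projIcc_congr (hTδ δ) t
  · refine integral_projIcc_congr (g' := fun s => H.flow (xCurve q.1.ext s) e) (fun t => ?_) t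
    rw [flowCurve_apply, xOp_apply]

theorem exists_hasFDerivAt_areaOp (hN : H.D ^ N = 0) (q : UnitL1 × UnitL1) :
    ∃ T : UnitL1 × UnitL1 →L[ℝ] C(Icc (0 : ℝ) 1, ℝ), HasFDerivAt (H.areaOp e) T q ∧
      ∀ δ t, T δ t = H.areaVariation e q δ t := by
  obtain ⟨T, hT, hTδ⟩ := H.exists_hasFDerivAt_flowCurve e hN q
  obtain ⟨P, hP, hPδ⟩ := H.exists_hasFDerivAt_pOp e hN q
  refine ⟨_, UnitL1.primitiveL.hasFDerivAt_of_bilinear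
    (((1 / 2 : ℝ) • H.form).pointwise.hasFDerivAt_of_bilinear hP hT) hasFDerivAt_snd,
    fun δ t => ?_⟩
  rw [areaVariation, add_comm]
  simp only [add_apply, ContinuousLinearMap.precompR_apply, ContinuousLinearMap.precompL_apply,
    ContinuousMap.add_apply, UnitL1.primitiveL_apply]
  congr 1
  · refine integral_projIcc_congr (g := fun t =>
      ((1 / 2 : ℝ) • H.form).pointwise (H.pOp e q) (T δ) t +
        ((1 / 2 : ℝ) • H.form).pointwise (P δ) (H.flowCurve e (xOp q.1)) t) (g' := fun s => 1 / 2 *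
      (H.form (H.pVariation e q δ s) (H.flow (xCurve q.1.ext s) e) +
        H.form (H.pCurve e q.1.ext q.2.ext s)
          (xCurve δ.1.ext s • H.D (H.flow (xCurve q.1.ext s) e)))) (fun t => ?_) t
    rw [ContinuousLinearMap.pointwise_apply, ContinuousLinearMap.pointwise_apply, hTδ, hPδ,
      flowCurve_apply, xOp_apply, pOp_apply]
    simp only [smul_apply, smul_eq_mul]
    ring
  · refine integral_projIcc_congr (g' := fun s => 1 / 2 *
      H.form (H.pCurve e q.1.ext q.2.ext s) (H.flow (xCurve q.1.ext s) e)) (fun t => ?_) t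
    rw [ContinuousLinearMap.pointwise_apply, flowCurve_apply, xOp_apply, pOp_apply]
    simp

/-- The differential of the endpoint map in the coordinates of the model group. -/
theorem exists_hasFDerivAt_liftEndpoint (hN : H.D ^ N = 0) (q : UnitL1 × UnitL1) :
    ∃ T : UnitL1 × UnitL1 →L[ℝ] V × ℝ, HasFDerivAt (H.liftEndpoint e) T q ∧
      ∀ δ, T δ = (H.pVariation e q δ 1 + H.areaVariation e q δ 1 • H.z, xCurve δ.1.ext 1) := by
  obtain ⟨P, hP, hPδ⟩ := H.exists_hasFDerivAt_pOp e hN q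
  obtain ⟨A, hA, hAδ⟩ := H.exists_hasFDerivAt_areaOp e hN q
  have hP1 := (ContinuousMap.evalCLM ℝ (1 : Icc (0 : ℝ) 1)).hasFDerivAt.comp q hP
  have hA1 := (ContinuousMap.evalCLM ℝ (1 : Icc (0 : ℝ) 1)).hasFDerivAt.comp q hA
  have hx1 := (ContinuousMap.evalCLM ℝ (1 : Icc (0 : ℝ) 1)).hasFDerivAt.comp q
    (hasFDerivAt_xOp_fst q)
  refine ⟨_, ((hP1.add (hA1.smul_const H.z)).prodMk hx1).congr_of_eventuallyEq
    (Eventually.of_forall fun q => H.liftEndpoint_eq e q), fun δ => ?_⟩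
  refine Prod.ext ?_ ?_
  · simp [hPδ, hAδ]
  · simp [xOp_apply]

end HeisenbergData

end EndpointDerivative

/-! ### Abnormal controls and switching functions -/

section Abnormal

theorem HasACDeriv.ae_eq_zero {W : Type*} [NormedAddCommGroup W] [NormedSpace ℝ W] {f f' : ℝ → W}
    (hf : HasACDeriv f f') (h : ∀ t ∈ uIcc (0 : ℝ) 1, f t = 0) :
    ∀ᵐ t, t ∈ uIcc (0 : ℝ) 1 → f' t = 0 := by
  rw [uIcc_of_le zero_le_one] at h
  have h0 : ∀ᵐ t : ℝ, t ≠ 0 := by simp [ae_iff]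
  have h1 : ∀ᵐ t : ℝ, t ≠ 1 := by simp [ae_iff]
  filter_upwards [hf.deriv, h0, h1] with t ht ht0 ht1 htI
  have hd := ht htI
  rw [uIcc_of_le zero_le_one] at htI
  have hmem : Icc (0 : ℝ) 1 ∈ 𝓝 t :=
    Icc_mem_nhds (lt_of_le_of_ne htI.1 ht0.symm) (lt_of_le_of_ne htI.2 ht1)
  refine hd.unique ((hasDerivAt_const t (0 : W)).congr_of_eventuallyEq ?_)
  filter_upwards [hmem] with s hs using h s hs

theorem UnitL1.exists_ext_eq {f : ℝ → ℝ} (hf : IntegrableOn f (Icc 0 1)) :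
    ∃ q : UnitL1, ∀ᵐ t, t ∈ uIcc (0 : ℝ) 1 → q.ext t = f t :=
  ⟨Integrable.toL1 f hf, UnitL1.ext_ae_eq (Integrable.coeFn_toL1 hf)⟩

variable {V : Type*} [NormedAddCommGroup V] [NormedSpace ℝ V] [FiniteDimensional ℝ V]

namespace HeisenbergData

variable (H : HeisenbergData V) (e : V) (q δ : UnitL1 × UnitL1)

theorem hasACDeriv_xCurve (q : UnitL1) : HasACDeriv (xCurve q.ext) q.ext :=
  HasACDeriv.primitive q.integrable_ext.intervalIntegrable

@[simp] theorem xCurve_zero (f : ℝ → ℝ) : xCurve f 0 = 0 := by simp [xCurve]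

@[simp] theorem pCurve_zero (f g : ℝ → ℝ) : H.pCurve e f g 0 = 0 := by simp [pCurve]

@[simp] theorem areaCurve_zero (f g : ℝ → ℝ) : H.areaCurve e f g 0 = 0 := by simp [areaCurve]

@[simp] theorem pVariation_zero : H.pVariation e q δ 0 = 0 := by simp [pVariation]

@[simp] theorem areaVariation_zero : H.areaVariation e q δ 0 = 0 := by simp [areaVariation]

theorem hasACDeriv_flow (v : V) : HasACDeriv (fun t => H.flow (xCurve q.1.ext t) v)
    (fun t => q.1.ext t • H.D (H.flow (xCurve q.1.ext t) v)) := by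
  refine (hasACDeriv_xCurve q.1).comp (φ := fun s => H.flow s v)
    (φ' := fun s r => r • H.D (H.flow s v)) ?_ fun s r => ?_
  · exact (H.contDiff_flow.clm_apply contDiff_const).of_le (by simp)
  · rw [(H.hasDerivAt_flow v s).hasFDerivAt.fderiv]; simp

theorem hasACDeriv_pCurve : HasACDeriv (H.pCurve e q.1.ext q.2.ext)
    (fun t => q.2.ext t • H.flow (xCurve q.1.ext t) e) :=
  have : CompleteSpace V := FiniteDimensional.complete ℝ V
  HasACDeriv.primitive (H.intervalIntegrable_pCurve q.1.integrable_ext q.2.integrable_ext _ _)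

theorem hasACDeriv_areaCurve : HasACDeriv (H.areaCurve e q.1.ext q.2.ext)
    (fun t => q.2.ext t • (1 / 2 * H.form (H.pCurve e q.1.ext q.2.ext t)
      (H.flow (xCurve q.1.ext t) e))) :=
  HasACDeriv.primitive (H.intervalIntegrable_areaCurve q.1.integrable_ext q.2.integrable_ext _ _)

theorem continuous_flow_ext (v : V) : Continuous fun t => H.flow (xCurve q.1.ext t) v :=
  H.continuous_flow_xCurve q.1.integrable_ext v

theorem continuous_pCurve_ext : Continuous (H.pCurve e q.1.ext q.2.ext) :=
  H.continuous_pCurve q.1.integrable_ext q.2.integrable_ext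

theorem continuous_smul_D : Continuous fun s => xCurve δ.1.ext s •
    H.D (H.flow (xCurve q.1.ext s) e) :=
  (continuous_xCurve δ.1.integrable_ext).smul (H.D.continuous.comp (H.continuous_flow_ext q e))

theorem continuous_pVariation : Continuous (H.pVariation e q δ) :=
  (intervalIntegral.continuous_primitive (fun _ _ => UnitL1.intervalIntegrable_ext_smul q.2
    (H.continuous_smul_D e q δ) _ _) 0).add
    (intervalIntegral.continuous_primitive (fun _ _ => UnitL1.intervalIntegrable_ext_smul δ.2
      (H.continuous_flow_ext q e) _ _) 0)

theorem hasACDeriv_pVariation : HasACDeriv (H.pVariation e q δ)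
    (fun t => q.2.ext t • xCurve δ.1.ext t • H.D (H.flow (xCurve q.1.ext t) e) +
      δ.2.ext t • H.flow (xCurve q.1.ext t) e) :=
  have : CompleteSpace V := FiniteDimensional.complete ℝ V
  (HasACDeriv.primitive (UnitL1.intervalIntegrable_ext_smul q.2
    (H.continuous_smul_D e q δ) _ _)).add
    (HasACDeriv.primitive (UnitL1.intervalIntegrable_ext_smul δ.2
      (H.continuous_flow_ext q e) _ _))

theorem hasACDeriv_areaVariation : HasACDeriv (H.areaVariation e q δ)
    (fun t => q.2.ext t • (1 / 2 *
    (H.form (H.pVariation e q δ t) (H.flow (xCurve q.1.ext t) e) +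
      H.form (H.pCurve e q.1.ext q.2.ext t)
        (xCurve δ.1.ext t • H.D (H.flow (xCurve q.1.ext t) e)))) +
      δ.2.ext t • (1 / 2 *
      H.form (H.pCurve e q.1.ext q.2.ext t) (H.flow (xCurve q.1.ext t) e))) := by
  refine (HasACDeriv.primitive (UnitL1.intervalIntegrable_ext_smul q.2 ?_ _ _)).add
    (HasACDeriv.primitive (UnitL1.intervalIntegrable_ext_smul δ.2 ?_ _ _))
  · exact continuous_const.mul (((H.form.continuous.comp (H.continuous_pVariation e q δ)).clm_apply
      (H.continuous_flow_ext q e)).add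
      ((H.form.continuous.comp (H.continuous_pCurve_ext e q)).clm_apply
      (H.continuous_smul_D e q δ)))
  · exact continuous_const.mul ((H.form.continuous.comp (H.continuous_pCurve_ext e q)).clm_apply
      (H.continuous_flow_ext q e))

/-- The differential at the control `q` of the endpoint map, in the coordinates of the model group,
applied to the variation `δ`. -/
def variation : V × ℝ :=
  (H.pVariation e q δ 1 + H.areaVariation e q δ 1 • H.z, xCurve δ.1.ext 1)

/-- The control `q` is abnormal: the differential of the endpoint map at `q` is not surjective. -/
def IsAbnormal : Prop := ¬ Function.Surjective (H.variation e q)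

variable {δ}

theorem xCurve_congr {f g : ℝ → ℝ} (h : ∀ᵐ t, t ∈ uIcc (0 : ℝ) 1 → f t = g t) {t : ℝ}
    (ht : t ∈ uIcc (0 : ℝ) 1) : xCurve f t = xCurve g t := by
  refine intervalIntegral.integral_congr_ae ?_
  filter_upwards [h] with s hs hst
  exact hs (uIcc_subset_uIcc_left ht (uIoc_subset_uIcc hst))

/-- The switching functions of the covector `μ`: `switching k` is the pairing of the covector
transported along the curve with `D ^ k e`. -/
def switching (μ : V →L[ℝ] ℝ) (k : ℕ) (t : ℝ) : ℝ :=
  (μ - (1 / 2 * μ H.z) • H.form (H.pCurve e q.1.ext q.2.ext 1))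
      (H.flow (xCurve q.1.ext t) ((H.D ^ k) e)) +
    μ H.z * H.form (H.pCurve e q.1.ext q.2.ext t) (H.flow (xCurve q.1.ext t) ((H.D ^ k) e))

theorem switching_at_zero (μ : V →L[ℝ] ℝ) (k : ℕ) : H.switching e q μ k 0 =
    (μ - (1 / 2 * μ H.z) • H.form (H.pCurve e q.1.ext q.2.ext 1)) ((H.D ^ k) e) := by
  simp [switching]

theorem continuous_switching (μ : V →L[ℝ] ℝ) (k : ℕ) : Continuous (H.switching e q μ k) :=
  ((ContinuousLinearMap.continuous _).comp (H.continuous_flow_ext q _)).add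
    (continuous_const.mul ((H.form.continuous.comp (H.continuous_pCurve_ext e q)).clm_apply
      (H.continuous_flow_ext q _)))

/-- The derivative of the switching function `σₖ` is `q₁ σₖ₊₁ + μ(z) q₂ form(e, Dᵏ e)`. -/
theorem hasACDeriv_switching (μ : V →L[ℝ] ℝ) (k : ℕ) : HasACDeriv (H.switching e q μ k)
    (fun t => q.1.ext t * H.switching e q μ (k + 1) t +
      μ H.z * (q.2.ext t * H.form e ((H.D ^ k) e))) := by
  have h1 := H.hasACDeriv_flow q ((H.D ^ k) e)
  have h2 := (h1.clm (μ - (1 / 2 * μ H.z) • H.form (H.pCurve e q.1.ext q.2.ext 1))).add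
    (((H.hasACDeriv_pCurve e q).bilin h1 H.form).clm (μ H.z • ContinuousLinearMap.id ℝ ℝ))
  have h3 : ∀ t, H.D (H.flow (xCurve q.1.ext t) ((H.D ^ k) e)) =
      H.flow (xCurve q.1.ext t) ((H.D ^ (k + 1)) e) := fun t => by
    rw [D_flow, pow_succ']; rfl
  refine h2.congr_deriv (Eventually.of_forall fun t _ => ?_)
  simp only [h3, switching]
  simp only [map_smul, smul_apply, form_flow, smul_eq_mul, sub_apply,
    ContinuousLinearMap.id_apply]
  ring

/-- A covector annihilating the image of the differential of the endpoint map has vanishing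
zeroth switching function. -/
theorem switching_zero_eq_zero {μ : V →L[ℝ] ℝ} {c : ℝ}
    (hμ : ∀ δ, μ (H.variation e q δ).1 + c * (H.variation e q δ).2 = 0) :
    ∀ t ∈ uIcc (0 : ℝ) 1, H.switching e q μ 0 t = 0 := by
  -- For the variation with `δ₁ = 0` and `δ₂` the switching function itself, the pairing with the
  -- covector is the integral of the square of the switching function.
  obtain ⟨δ₂, hδ₂⟩ := UnitL1.exists_ext_eq
    (H.continuous_switching e q μ 0).integrableOn_Icc
  obtain ⟨δ₁, hδ₁⟩ := UnitL1.exists_ext_eq (f := fun _ => 0) (by simp)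
  have hx : ∀ t ∈ uIcc (0 : ℝ) 1, xCurve δ₁.ext t = 0 := fun t ht => by
    rw [xCurve_congr hδ₁ ht]; simp [xCurve]
  let δ : UnitL1 × UnitL1 := (δ₁, δ₂)
  have hp := H.hasACDeriv_pVariation e q δ
  have ha := H.hasACDeriv_areaVariation e q δ
  have hB := (hp.clm (μ - (1 / 2 * μ H.z) • H.form (H.pCurve e q.1.ext q.2.ext 1))).add
    ((ha.sub ((hp.bilin (H.hasACDeriv_pCurve e q) H.form).clm
      ((1 / 2 : ℝ) • ContinuousLinearMap.id ℝ ℝ))).clm (μ H.z • ContinuousLinearMap.id ℝ ℝ))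
  have hsq : Continuous fun t => H.switching e q μ 0 t ^ 2 := (H.continuous_switching e q μ 0).pow 2
  have hF := hB.eqOn (HasACDeriv.primitive (f := fun t => H.switching e q μ 0 t ^ 2)
    (hsq.intervalIntegrable _ _)) (by simp) (by
      filter_upwards [hδ₂] with t ht htI
      have h1 := hx t htI
      have h2 := ht htI
      simp only [δ, h1, zero_smul, smul_zero, zero_add, map_zero, add_zero, map_smul, smul_apply,
        sub_apply, smul_eq_mul, ContinuousLinearMap.id_apply, h2]
      have h3 : H.switching e q μ 0 t = (μ - (1 / 2 * μ H.z) • H.form (H.pCurve e q.1.ext q.2.ext 1))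
          (H.flow (xCurve q.1.ext t) e) +
        μ H.z * H.form (H.pCurve e q.1.ext q.2.ext t) (H.flow (xCurve q.1.ext t) e) := by
        simp [switching]
      rw [sq]
      nth_rw 5 [h3]
      rw [H.form_swap (H.flow (xCurve q.1.ext t) e)]
      simp only [smul_apply, sub_apply, smul_eq_mul]
      ring) right_mem_uIcc
  have h0 := hμ δ
  have h1 : ∫ s in (0 : ℝ)..1, H.switching e q μ 0 s ^ 2 = 0 := by
    refine hF.symm.trans ?_
    simp only [variation, map_add, map_smul, smul_eq_mul] at h0
    rw [show xCurve δ.1.ext 1 = 0 from hx 1 right_mem_uIcc] at h0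
    simp only [sub_apply, smul_apply, smul_eq_mul, ContinuousLinearMap.id_apply,
      H.form_swap (H.pCurve e q.1.ext q.2.ext 1)]
    linarith
  rw [intervalIntegral.integral_eq_zero_iff_of_le_of_nonneg_ae zero_le_one
    (Eventually.of_forall fun t => sq_nonneg _) (hsq.intervalIntegrable _ _)] at h1
  rw [uIcc_of_le zero_le_one]
  intro t ht
  rw [restrict_Ioc_eq_restrict_Icc] at h1
  have h2 := Measure.eqOn_Icc_of_ae_eq volume zero_ne_one h1 hsq.continuousOn continuousOn_const ht
  exact pow_eq_zero_iff two_ne_zero |>.1 h2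

/-- The first-order condition for abnormal controls: some covector annihilates the image of the
differential, and its restriction to `V` is non-zero because the `X₁`-coordinate of the differential
is onto. -/
theorem exists_covector (hN : ∃ N, H.D ^ N = 0) (h : H.IsAbnormal e q) :
    ∃ μ : V →L[ℝ] ℝ, μ ≠ 0 ∧ ∀ t ∈ uIcc (0 : ℝ) 1, H.switching e q μ 0 t = 0 := by
  obtain ⟨N, hN⟩ := hN
  obtain ⟨T, -, hT⟩ := H.exists_hasFDerivAt_liftEndpoint e hN q
  have h1 : LinearMap.range (T : UnitL1 × UnitL1 →ₗ[ℝ] V × ℝ) < ⊤ := by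
    rw [lt_top_iff_ne_top, Ne, LinearMap.range_eq_top]
    rwa [IsAbnormal, show H.variation e q = T from funext fun δ => (hT δ).symm] at h
  obtain ⟨L, hL0, hL⟩ := Submodule.exists_le_ker_of_lt_top _ h1
  let μ : V →L[ℝ] ℝ := LinearMap.toContinuousLinearMap (L.comp (LinearMap.inl ℝ V ℝ))
  have h2 : ∀ p : V × ℝ, L p = μ p.1 + L (0, 1) * p.2 := by
    intro p
    have : p = (p.1, 0) + p.2 • (0, 1) := by simp
    conv_lhs => rw [this, map_add, map_smul]
    simp [μ, mul_comm]
  have h3 : ∀ δ, μ (H.variation e q δ).1 + L (0, 1) * (H.variation e q δ).2 = 0 := by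
    intro δ
    rw [← h2, show H.variation e q δ = T δ from (hT δ).symm]
    exact hL ⟨δ, rfl⟩
  refine ⟨μ, fun hμ => hL0 ?_, H.switching_zero_eq_zero e q h3⟩
  obtain ⟨δ₁, hδ₁⟩ := UnitL1.exists_ext_eq (f := fun _ => 1) (by simp)
  have h4 := h3 (δ₁, 0)
  rw [hμ] at h4
  have h5 : (H.variation e q (δ₁, 0)).2 = 1 :=
    (xCurve_congr hδ₁ right_mem_uIcc).trans (by simp [xCurve])
  rw [h5] at h4
  simp only [zero_apply, mul_one, zero_add] at h4
  refine LinearMap.ext fun p => ?_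
  rw [h2, hμ, h4]; simp

variable {e q}

/-- As long as the brackets `form e (D ^ k e)` vanish, the vanishing of the zeroth switching function
implies that of the following ones, unless `q₁ = 0`. Indeed `σₖ = 0` gives `q₁ σₖ₊₁ = 0`, so the
derivative `2 q₁ σₖ₊₁ σₖ₊₂` of `σₖ₊₁²` vanishes: either the constant `σₖ₊₁²` is zero or
`q₁ = 0`. -/
theorem switching_eq_zero {m : ℕ} (hm : ∀ k < m, H.form e ((H.D ^ k) e) = 0) {μ : V →L[ℝ] ℝ}
    (h0 : ∀ t ∈ uIcc (0 : ℝ) 1, H.switching e q μ 0 t = 0)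
    (hq : ¬ ∀ᵐ t, t ∈ uIcc (0 : ℝ) 1 → q.1.ext t = 0) :
    ∀ k < m, ∀ t ∈ uIcc (0 : ℝ) 1, H.switching e q μ k t = 0 := by
  intro k
  induction k with
  | zero => exact fun _ => h0
  | succ k ih =>
    intro hk
    have h1 := (H.hasACDeriv_switching e q μ k).ae_eq_zero (ih (by omega))
    have h2 := H.hasACDeriv_switching e q μ (k + 1)
    have h3 := (h2.mul h2).eqOn_const (by
      filter_upwards [h1] with t ht htI
      have h4 := ht htI
      rw [hm k (by omega)] at h4
      rw [hm (k + 1) hk]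
      simp only [mul_zero, add_zero] at h4 ⊢
      linear_combination (2 * H.switching e q μ (k + 1 + 1) t) * h4)
    by_cases h5 : H.switching e q μ (k + 1) 0 = 0
    · intro t ht
      have h6 := h3 t ht
      rw [h5, mul_zero] at h6
      exact mul_self_eq_zero.1 h6
    · exfalso
      refine hq ?_
      filter_upwards [h1] with t ht htI
      have h4 := ht htI
      rw [hm k (by omega)] at h4
      simp only [mul_zero, add_zero] at h4
      refine (mul_eq_zero.1 h4).resolve_right fun h7 => h5 ?_
      have h6 := h3 t htI
      rw [h7, mul_zero] at h6
      exact mul_self_eq_zero.1 h6.symm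

end HeisenbergData

end Abnormal

/-! ### Endpoints of abnormal controls -/

section AbnormalEndpoints

theorem UnitL1.exists_ext_eq_indicator (a u v : ℝ) (huv : u ≤ v) (hu : 0 ≤ u) :
    ∃ q : UnitL1, (∀ᵐ t, t ∈ uIcc (0 : ℝ) 1 → q.ext t = (Ioc u v).indicator (fun _ => a) t) ∧
      (∀ t ∈ uIcc (0 : ℝ) 1, t ≤ u → HeisenbergData.xCurve q.ext t = 0) ∧
      (∀ t ∈ uIcc (0 : ℝ) 1, v ≤ t → HeisenbergData.xCurve q.ext t = (v - u) * a) := by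
  have hi : Integrable ((Ioc u v).indicator (fun _ => a)) :=
    (integrable_indicator_iff measurableSet_Ioc).2 (by simp)
  obtain ⟨q, hq⟩ := UnitL1.exists_ext_eq hi.integrableOn
  refine ⟨q, hq, fun t ht htu => ?_, fun t ht htv => ?_⟩
  · rw [HeisenbergData.xCurve_congr hq ht, HeisenbergData.xCurve]
    rw [uIcc_of_le zero_le_one] at ht
    rw [intervalIntegral.integral_of_le ht.1, setIntegral_indicator measurableSet_Ioc,
      Ioc_inter_Ioc, Ioc_eq_empty (by simp [htu, hu])]
    simp
  · rw [HeisenbergData.xCurve_congr hq ht, HeisenbergData.xCurve]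
    rw [uIcc_of_le zero_le_one] at ht
    rw [intervalIntegral.integral_of_le ht.1, setIntegral_indicator measurableSet_Ioc,
      Ioc_inter_Ioc, sup_eq_right.2 hu, inf_eq_right.2 htv]
    simp [huv]

variable {V : Type*} [NormedAddCommGroup V] [NormedSpace ℝ V] [FiniteDimensional ℝ V]

namespace HeisenbergData

variable (H : HeisenbergData V) (e : V)

/-- The algebraic properties of a filiform Lie algebra of type I, with `e = X₂`: the vectors
`Dᵏ e` span `V`. -/
structure IsTypeOne : Prop where
  nilpotent : ∃ N, H.D ^ N = 0
  form_eq_zero : H.form = 0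
  span : ∀ μ : V →L[ℝ] ℝ, (∀ k, μ ((H.D ^ k) e) = 0) → μ = 0
  exists_coord : ∃ ζ : V →L[ℝ] ℝ, ζ ≠ 0 ∧ ζ e = 0 ∧ ζ (H.D e) = 0

/-- The algebraic properties of a filiform Lie algebra of type II and step `m + 2`, with
`e = X₂`: the vectors `e, …, Dᵐ e` and `z` span `V`, and `Dᵐ e` is the first of them whose bracket
with `e` is non-zero. -/
structure IsTypeTwo (m : ℕ) : Prop where
  nilpotent : ∃ N, H.D ^ N = 0
  two_le : 2 ≤ m
  form_eq_zero : ∀ k < m, H.form e ((H.D ^ k) e) = 0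
  form_eq_one : H.form e ((H.D ^ m) e) = 1
  pow_succ : (H.D ^ (m + 1)) e = 0
  span : ∀ μ : V →L[ℝ] ℝ, (∀ k ≤ m, μ ((H.D ^ k) e) = 0) → μ H.z = 0 → μ = 0
  exists_coord : ∃ ζ : V →L[ℝ] ℝ, (∀ v, ζ (H.D v) = 0) ∧ ζ e = 0 ∧ ζ H.z = 1

variable {H e} {q : UnitL1 × UnitL1}

theorem IsTypeOne.eq_zero_of_isAbnormal (h : H.IsTypeOne e) (hq : H.IsAbnormal e q) :
    ∀ᵐ t, t ∈ uIcc (0 : ℝ) 1 → q.1.ext t = 0 := by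
  obtain ⟨μ, hμ, h0⟩ := H.exists_covector e q h.nilpotent hq
  by_contra hne
  refine hμ (h.span μ fun k => ?_)
  have h1 := H.switching_eq_zero (m := k + 1) (fun k _ => by simp [h.form_eq_zero]) h0 hne k
    (by omega) 0 left_mem_uIcc
  rw [switching_at_zero] at h1
  simpa [h.form_eq_zero] using h1

theorem xCurve_eq_zero_of_ae {q : UnitL1} (hq : ∀ᵐ t, t ∈ uIcc (0 : ℝ) 1 → q.ext t = 0) :
    ∀ t ∈ uIcc (0 : ℝ) 1, xCurve q.ext t = 0 := fun t ht => by
  rw [(hasACDeriv_xCurve q).eqOn_const hq t ht, xCurve_zero]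

theorem IsTypeOne.isAbnormal (h : H.IsTypeOne e)
    (hq : ∀ᵐ t, t ∈ uIcc (0 : ℝ) 1 → q.1.ext t = 0) : H.IsAbnormal e q := by
  obtain ⟨ζ, hζ, h0, h1⟩ := h.exists_coord
  obtain ⟨v, hv⟩ := DFunLike.exists_ne hζ
  intro hsurj
  obtain ⟨δ, hδ⟩ := hsurj (v, 0)
  refine hv ?_
  have h2 := ((H.hasACDeriv_pVariation e q δ).clm ζ).eqOn_const (by
    filter_upwards with t htI
    rw [xCurve_eq_zero_of_ae hq t htI]
    simp [h0, h1]) 1 right_mem_uIcc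
  have h3 : H.areaVariation e q δ 1 = 0 := by
    simp [areaVariation, h.form_eq_zero]
  have h4 := congrArg Prod.fst hδ
  simp only [variation, h3, zero_smul, add_zero] at h4
  rw [← h4, h2]
  simp

theorem IsTypeOne.liftEndpoint_eq (h : H.IsTypeOne e)
    (hq : ∀ᵐ t, t ∈ uIcc (0 : ℝ) 1 → q.1.ext t = 0) :
    H.liftEndpoint e q = (xCurve q.2.ext 1 • e, 0) := by
  have hx := xCurve_eq_zero_of_ae hq
  have h1 : H.pCurve e q.1.ext q.2.ext 1 = xCurve q.2.ext 1 • e :=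
    (H.hasACDeriv_pCurve e q).eqOn ((hasACDeriv_xCurve q.2).clm
      ((1 : ℝ →L[ℝ] ℝ).smulRight e)) (by simp) (by
      filter_upwards with t htI
      rw [hx t htI]; simp) right_mem_uIcc
  have h2 : H.areaCurve e q.1.ext q.2.ext 1 = 0 := by
    simp [areaCurve, h.form_eq_zero]
  rw [liftEndpoint, liftCurve, h1, h2, hx 1 right_mem_uIcc]
  simp

/-- The abnormal endpoints in type I. -/
theorem IsTypeOne.image_isAbnormal (h : H.IsTypeOne e) :
    H.liftEndpoint e '' {q | H.IsAbnormal e q} = {p | ∃ t : ℝ, p = (t • e, 0)} := by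
  ext p
  constructor
  · rintro ⟨q, hq, rfl⟩
    exact ⟨_, h.liftEndpoint_eq (h.eq_zero_of_isAbnormal hq)⟩
  · rintro ⟨t, rfl⟩
    obtain ⟨q₁, hq₁⟩ := UnitL1.exists_ext_eq (f := fun _ => 0) (by simp)
    obtain ⟨q₂, hq₂⟩ := UnitL1.exists_ext_eq (f := fun _ => t) (by simp)
    refine ⟨(q₁, q₂), h.isAbnormal hq₁, ?_⟩
    rw [h.liftEndpoint_eq (q := (q₁, q₂)) hq₁, xCurve_congr hq₂ right_mem_uIcc]
    simp [xCurve]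

/-- For an abnormal control in type II, `q₁` vanishes almost everywhere off a level set of the
primitive of `q₂`: the last switching function is an affine function of this primitive. -/
theorem IsTypeTwo.exists_mul_eq_zero {m : ℕ} (h : H.IsTypeTwo e m) (hq : H.IsAbnormal e q) :
    ∃ a : ℝ, ∀ᵐ t, t ∈ uIcc (0 : ℝ) 1 → q.1.ext t * (xCurve q.2.ext t - a) = 0 := by
  obtain ⟨μ, hμ, h0⟩ := H.exists_covector e q h.nilpotent hq
  by_cases hne : ∀ᵐ t, t ∈ uIcc (0 : ℝ) 1 → q.1.ext t = 0
  · refine ⟨0, ?_⟩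
    filter_upwards [hne] with t ht htI
    rw [ht htI, zero_mul]
  have h1 := H.switching_eq_zero h.form_eq_zero h0 hne
  have hm1 : m - 1 + 1 = m := by have := h.two_le; omega
  have h2 := (H.hasACDeriv_switching e q μ (m - 1)).ae_eq_zero (h1 (m - 1) (by omega))
  rw [hm1, h.form_eq_zero (m - 1) (by omega)] at h2
  have h3 : ∀ t ∈ uIcc (0 : ℝ) 1, H.switching e q μ m t =
      H.switching e q μ m 0 + μ H.z * xCurve q.2.ext t := by
    refine (H.hasACDeriv_switching e q μ m).eqOn ((HasACDeriv.const _).add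
      ((hasACDeriv_xCurve q.2).clm (μ H.z • ContinuousLinearMap.id ℝ ℝ))) (by simp) ?_
    filter_upwards with t htI
    rw [h.form_eq_one]
    simp [switching, h.pow_succ]
  by_cases hz : μ H.z = 0
  · by_cases hc : H.switching e q μ m 0 = 0
    · refine absurd (h.span μ (fun k hk => ?_) hz) hμ
      have h4 : H.switching e q μ k 0 = 0 := by
        rcases hk.eq_or_lt with rfl | hk
        · exact hc
        · exact h1 k hk 0 left_mem_uIcc
      rw [switching_at_zero, hz] at h4
      simpa using h4
    · refine absurd ?_ hne
      filter_upwards [h2] with t ht htI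
      have h4 := ht htI
      rw [h3 t htI, hz] at h4
      simpa [hc] using h4
  · refine ⟨-(H.switching e q μ m 0) / μ H.z, ?_⟩
    filter_upwards [h2] with t ht htI
    have h4 := ht htI
    rw [h3 t htI] at h4
    field_simp
    linear_combination h4

theorem IsTypeTwo.form_D_e {m : ℕ} (h : H.IsTypeTwo e m) : H.form e (H.D e) = 0 := by
  simpa using h.form_eq_zero 1 h.two_le

theorem pCurve_eq_of_mul_eq_zero (H : HeisenbergData V) (e : V) {a : ℝ}
    (hq : ∀ᵐ t, t ∈ uIcc (0 : ℝ) 1 → q.1.ext t * (xCurve q.2.ext t - a) = 0) :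
    ∀ t ∈ uIcc (0 : ℝ) 1, H.pCurve e q.1.ext q.2.ext t =
      (xCurve q.2.ext t - a) • H.flow (xCurve q.1.ext t) e + a • e := by
  refine (H.hasACDeriv_pCurve e q).eqOn ((((hasACDeriv_xCurve q.2).sub (HasACDeriv.const a)).smul
    (H.hasACDeriv_flow q e)).add (HasACDeriv.const (a • e))) (by simp) ?_
  filter_upwards [hq] with t ht htI
  rw [smul_smul, mul_comm (_ - a), ht htI]
  simp

/-- If `q₁` is supported on the level set `a` of the primitive of `q₂`, then the curve ends where
the concatenation of three segments in the directions `e`, `X₁` and `e` does. -/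
theorem liftEndpoint_eq_of_mul_eq_zero (H : HeisenbergData V) (e : V) {a : ℝ}
    (hq : ∀ᵐ t, t ∈ uIcc (0 : ℝ) 1 → q.1.ext t * (xCurve q.2.ext t - a) = 0) :
    H.liftEndpoint e q = H.mul (H.mul (a • e, 0) (0, xCurve q.1.ext 1))
      ((xCurve q.2.ext 1 - a) • e, 0) := by
  have hp := H.pCurve_eq_of_mul_eq_zero e hq
  have h2 : H.areaCurve e q.1.ext q.2.ext 1 =
      (1 / 2 * a) * ((xCurve q.2.ext 1 - a) * H.form e (H.flow (xCurve q.1.ext 1) e)) := by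
    refine (H.hasACDeriv_areaCurve e q).eqOn ((((hasACDeriv_xCurve q.2).sub
      (HasACDeriv.const a)).mul ((H.hasACDeriv_flow q e).clm (H.form e))).clm
      ((1 / 2 * a) • ContinuousLinearMap.id ℝ ℝ)) (by simp [H.form_self]) ?_ right_mem_uIcc
    filter_upwards [hq] with t ht htI
    rw [hp t htI]
    simp only [map_add, map_smul, add_apply, smul_apply, form_self, smul_eq_mul,
      ContinuousLinearMap.id_apply]
    linear_combination (-(1 / 2) * a * H.form e (H.D (H.flow (xCurve q.1.ext t) e))) * ht htI
  rw [liftEndpoint, liftCurve, hp 1 right_mem_uIcc, h2]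
  refine Prod.ext ?_ (by simp [mul])
  simp only [mul, map_smul, smul_apply, map_zero, mul_zero, zero_smul,
    add_zero, zero_add, smul_eq_mul]
  module

/-- Along such a curve the area variation is a function of the variation of `pCurve`, and the
coordinate `ζ` of the latter vanishes; so the differential misses the vector `z`. -/
theorem IsTypeTwo.isAbnormal {m : ℕ} (h : H.IsTypeTwo e m) {a : ℝ}
    (hq : ∀ᵐ t, t ∈ uIcc (0 : ℝ) 1 → q.1.ext t * (xCurve q.2.ext t - a) = 0) :
    H.IsAbnormal e q := by
  obtain ⟨ζ, hζD, hζe, hζz⟩ := h.exists_coord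
  have hp := H.pCurve_eq_of_mul_eq_zero e hq
  have hform : ∀ t, H.form (H.flow t e) (H.D (H.flow t e)) = 0 := fun t => by
    rw [D_flow, form_flow, h.form_D_e]
  have harea : ∀ δ, H.areaVariation e q δ 1 =
      1 / 2 * (H.form (H.pVariation e q δ 1) (H.pCurve e q.1.ext q.2.ext 1 - (2 * a) • e)) := by
    intro δ
    refine (H.hasACDeriv_areaVariation e q δ).eqOn ((((H.hasACDeriv_pVariation e q δ).bilin
      ((H.hasACDeriv_pCurve e q).sub (HasACDeriv.const ((2 * a) • e))) H.form)).clm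
      ((1 / 2 : ℝ) • ContinuousLinearMap.id ℝ ℝ)) (by simp) ?_ right_mem_uIcc
    filter_upwards with t htI
    rw [hp t htI]
    have h1 := hform (xCurve q.1.ext t)
    have h2 := H.form_swap (H.D (H.flow (xCurve q.1.ext t) e)) (H.flow (xCurve q.1.ext t) e)
    have h3 := H.form_swap (H.D (H.flow (xCurve q.1.ext t) e)) e
    have h4 := H.form_swap (H.flow (xCurve q.1.ext t) e) e
    simp only [map_add, map_smul, map_sub, add_apply, smul_apply, form_self, smul_eq_mul,
      ContinuousLinearMap.id_apply, map_zero, h1, h2, h3, h4]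
    ring
  have hζp : ∀ δ, ζ (H.pVariation e q δ 1) = 0 := by
    intro δ
    refine (((H.hasACDeriv_pVariation e q δ).clm ζ).eqOn_const ?_ 1 right_mem_uIcc).trans (by simp)
    filter_upwards with t htI
    have h5 : ζ (H.flow (xCurve q.1.ext t) e) = 0 := by
      have h6 := is_const_of_deriv_eq_zero (f := fun s => ζ (H.flow s e))
        (fun s => (ζ.hasFDerivAt.comp_hasDerivAt s (H.hasDerivAt_flow e s)).differentiableAt)
        (fun s => (ζ.hasFDerivAt.comp_hasDerivAt s (H.hasDerivAt_flow e s)).deriv.trans (hζD _))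
        (xCurve q.1.ext t) 0
      rw [h6]; simpa using hζe
    simp [hζD, h5]
  intro hsurj
  obtain ⟨δ, hδ⟩ := hsurj (H.z, 0)
  have h1 := congrArg Prod.fst hδ
  simp only [variation] at h1
  have h2 := congrArg ζ h1
  rw [map_add, map_smul, hζp, hζz] at h2
  have h3 := congrArg (fun v => H.form v (H.pCurve e q.1.ext q.2.ext 1 - (2 * a) • e)) h1
  simp only [map_add, map_smul, add_apply, smul_apply, form_z, smul_zero, add_zero] at h3
  rw [harea, h3] at h2
  simp at h2

/-- The abnormal endpoints in type II. -/
theorem IsTypeTwo.image_isAbnormal {m : ℕ} (h : H.IsTypeTwo e m) :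
    H.liftEndpoint e '' {q | H.IsAbnormal e q} =
      {p | ∃ a b c : ℝ, p = H.mul (H.mul (a • e, 0) (0, b)) (c • e, 0)} := by
  ext p
  constructor
  · rintro ⟨q, hq, rfl⟩
    obtain ⟨a, ha⟩ := h.exists_mul_eq_zero hq
    exact ⟨a, _, _, H.liftEndpoint_eq_of_mul_eq_zero e ha⟩
  · rintro ⟨a, b, c, rfl⟩
    -- The control is `e`, `X₁`, `e` (up to scalars) on the three thirds of the interval.
    obtain ⟨q₁, hq₁, -, hq₁'⟩ := UnitL1.exists_ext_eq_indicator (3 * b) (1 / 3) (2 / 3)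
      (by norm_num) (by norm_num)
    obtain ⟨f, hf, -, hf'⟩ := UnitL1.exists_ext_eq_indicator (3 * a) 0 (1 / 3)
      (by norm_num) (by norm_num)
    obtain ⟨g, hg, hg0, hg'⟩ := UnitL1.exists_ext_eq_indicator (3 * c) (2 / 3) 1
      (by norm_num) (by norm_num)
    have hadd : ∀ t ∈ uIcc (0 : ℝ) 1, xCurve (f + g).ext t = xCurve f.ext t + xCurve g.ext t := by
      refine (hasACDeriv_xCurve (f + g)).eqOn ((hasACDeriv_xCurve f).add (hasACDeriv_xCurve g))
        (by simp) ?_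
      filter_upwards [UnitL1.ext_add f g] with t ht _ using ht
    have hq : ∀ᵐ t, t ∈ uIcc (0 : ℝ) 1 → q₁.ext t * (xCurve (f + g).ext t - a) = 0 := by
      filter_upwards [hq₁] with t ht htI
      rw [ht htI]
      by_cases h1 : t ∈ Ioc (1 / 3 : ℝ) (2 / 3)
      · rw [hadd t htI, hf' t htI h1.1.le, hg0 t htI h1.2]
        ring
      · rw [indicator_of_notMem h1, zero_mul]
    refine ⟨(q₁, f + g), h.isAbnormal hq, ?_⟩
    rw [H.liftEndpoint_eq_of_mul_eq_zero e (q := (q₁, f + g)) hq]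
    dsimp only
    rw [hadd 1 right_mem_uIcc, hf' 1 right_mem_uIcc (by norm_num),
      hg' 1 right_mem_uIcc (by norm_num), hq₁' 1 right_mem_uIcc (by norm_num)]
    congr 3 <;> ring_nf

end HeisenbergData

end AbnormalEndpoints

/-! ### Singular controls of the group and abnormal controls of the model -/

section Bridge

/-- The components of a control with respect to two linear functionals. -/
def controlPair {r : ℕ} (A B : EuclideanSpace ℝ (Fin r) →L[ℝ] ℝ) :
    Control r →L[ℝ] UnitL1 × UnitL1 :=
  (A.compLpL 1 _).prod (B.compLpL 1 _)

theorem surjective_controlPair {r : ℕ} {A B : EuclideanSpace ℝ (Fin r) →L[ℝ] ℝ}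
    (hA : ∃ w, A w = 1 ∧ B w = 0) (hB : ∃ w, A w = 0 ∧ B w = 1) :
    Function.Surjective (controlPair A B) := by
  obtain ⟨w, hw1, hw0⟩ := hA
  obtain ⟨w', hw1', hw0'⟩ := hB
  rintro ⟨q₁, q₂⟩
  let M : ∀ w : EuclideanSpace ℝ (Fin r), UnitL1 →L[ℝ] Control r := fun w =>
    (ContinuousLinearMap.toSpanSingleton ℝ w).compLpL 1 _
  have hM : ∀ (L : EuclideanSpace ℝ (Fin r) →L[ℝ] ℝ) (w : EuclideanSpace ℝ (Fin r)) (q : UnitL1),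
      L.compLpL 1 _ (M w q) = L w • q := by
    intro L w q
    refine Lp.ext ?_
    filter_upwards [L.coeFn_compLpL (M w q),
      (ContinuousLinearMap.toSpanSingleton ℝ w).coeFn_compLpL (p := 1) q, Lp.coeFn_smul (L w) q]
      with t h1 h2 h3
    rw [h1, h3, show (M w q) t = _ from h2]
    simp [mul_comm]
  refine ⟨M w q₁ + M w' q₂, Prod.ext ?_ ?_⟩
  · simp [controlPair, hM, hw1, hw1']
  · simp [controlPair, hM, hw0, hw0']

variable {V : Type*} [NormedAddCommGroup V] [NormedSpace ℝ V] [FiniteDimensional ℝ V]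
  {E : Type*} [NormedAddCommGroup E] [NormedSpace ℝ E] [FiniteDimensional ℝ E]
  {G : Type*} [TopologicalSpace G] [ChartedSpace E G] [Group G]
  [LieGroup 𝓘(ℝ, E) ∞ G] [T2Space G] [SimplyConnectedSpace G]

namespace HeisenbergData.Realization

variable {H : HeisenbergData V} (R : H.Realization (E := E) G) {e : V}
  {r : ℕ} {Y : Fin r → E} {A B : EuclideanSpace ℝ (Fin r) →L[ℝ] ℝ}

theorem endpointMap_eq_ofPair (hY : ∀ w : EuclideanSpace ℝ (Fin r),
    ∑ i, w i • Y i = R.lin (B w • e, A w)) (u : Control r) :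
    endpointMap (G := G) Y u = R.ofPair (H.liftEndpoint e (controlPair A B u)) := by
  refine R.endpointMap_eq (UnitL1.integrable_ext _) (UnitL1.integrable_ext _) ?_
  have hI : ∀ᵐ t ∂(volume.restrict (Icc (0 : ℝ) 1)), t ∈ Icc (0 : ℝ) 1 :=
    ae_restrict_mem measurableSet_Icc
  filter_upwards [hI, A.coeFn_compLpL u, B.coeFn_compLpL u] with t ht h1 h2
  rw [hY, UnitL1.ext, UnitL1.ext, indicator_of_mem ht, indicator_of_mem ht]
  rw [show (controlPair A B u).1 t = _ from h1, show (controlPair A B u).2 t = _ from h2]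

theorem isSingularControl_iff (hN : ∃ N, H.D ^ N = 0)
    (hA : ∃ w, A w = 1 ∧ B w = 0) (hB : ∃ w, A w = 0 ∧ B w = 1)
    (hY : ∀ w : EuclideanSpace ℝ (Fin r), ∑ i, w i • Y i = R.lin (B w • e, A w)) (u : Control r) :
    IsSingularControl (G := G) Y u ↔ H.IsAbnormal e (controlPair A B u) := by
  obtain ⟨N, hN⟩ := hN
  obtain ⟨T, hT, hTδ⟩ := H.exists_hasFDerivAt_liftEndpoint e hN (controlPair A B u)
  have h1 := R.hasMFDerivAt_ofPair_comp
    (HasFDerivAt.comp (g := H.liftEndpoint e) (f := controlPair A B) u hT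
      (controlPair A B).hasFDerivAt)
  have h2 : endpointMap (G := G) Y = fun u => R.ofPair ((H.liftEndpoint e ∘ controlPair A B) u) :=
    funext fun u => R.endpointMap_eq_ofPair hY u
  have h3 : IsSingularControl (G := G) Y u ↔ ¬ Function.Surjective (leftDeriv E
      (R.ofPair ((H.liftEndpoint e ∘ controlPair A B) u)) ∘ R.lin ∘
        H.transDeriv ((H.liftEndpoint e ∘ controlPair A B) u) ∘ T ∘ controlPair A B) := by
    rw [← h2] at h1
    change ¬ Function.Surjective
      (mfderiv 𝓘(ℝ, Control r) 𝓘(ℝ, E) (endpointMap (G := G) Y) u) ↔ _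
    rw [h1.mfderiv]
    rfl
  rw [h3, IsAbnormal, Function.Surjective.of_comp_iff' (bijective_leftDeriv _),
    Function.Surjective.of_comp_iff' R.lin.bijective,
    Function.Surjective.of_comp_iff' (H.bijective_transDeriv _),
    Function.Surjective.of_comp_iff _ (surjective_controlPair hA hB),
    show H.variation e (controlPair A B u) = T from funext fun δ => (hTδ δ).symm]

/-- The critical values of the endpoint map, in the coordinates of the model group. -/
theorem image_isSingularControl (hN : ∃ N, H.D ^ N = 0)
    (hA : ∃ w, A w = 1 ∧ B w = 0) (hB : ∃ w, A w = 0 ∧ B w = 1)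
    (hY : ∀ w : EuclideanSpace ℝ (Fin r), ∑ i, w i • Y i = R.lin (B w • e, A w)) :
    endpointMap (G := G) Y '' {u | IsSingularControl (G := G) Y u} =
      R.ofPair '' (H.liftEndpoint e '' {q | H.IsAbnormal e q}) := by
  ext g
  constructor
  · rintro ⟨u, hu, rfl⟩
    exact ⟨_, ⟨_, (R.isSingularControl_iff hN hA hB hY u).1 hu, rfl⟩,
      (R.endpointMap_eq_ofPair hY u).symm⟩
  · rintro ⟨_, ⟨q, hq, rfl⟩, rfl⟩
    obtain ⟨u, rfl⟩ := surjective_controlPair hA hB q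
    exact ⟨u, (R.isSingularControl_iff hN hA hB hY u).2 hq, R.endpointMap_eq_ofPair hY u⟩

end HeisenbergData.Realization

end Bridge

/-! ### Varieties with a polynomial parametrization -/

section ParametrizedVariety

open MvPolynomial

/-- An algebra of finite type over a field which embeds into a polynomial ring in `d` variables has
Krull dimension at most `d`. -/
theorem ringKrullDim_le_of_injective_mvPolynomial {k R : Type*} [Field k] [CommRing R]
    [Algebra k R] [Algebra.FiniteType k R] {d : ℕ}
    (f : R →ₐ[k] MvPolynomial (Fin d) k) (hf : Function.Injective f) : ringKrullDim R ≤ d := by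
  have : Nontrivial R := f.toRingHom.domain_nontrivial
  obtain ⟨n, g, hg, hint⟩ := exists_integral_inj_algHom_of_fg k R
  have h1 : ringKrullDim R ≤ ringKrullDim (MvPolynomial (Fin n) k) := by
    let _ : Algebra (MvPolynomial (Fin n) k) R := g.toRingHom.toAlgebra
    have : Algebra.IsIntegral (MvPolynomial (Fin n) k) R := ⟨hint⟩
    refine Order.krullDim_le_of_strictMono
      (PrimeSpectrum.comap (algebraMap (MvPolynomial (Fin n) k) R)) fun p q hpq => ?_
    exact Ideal.IsIntegral.comap_lt_comap (R := MvPolynomial (Fin n) k) (I := p.asIdeal)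
      (J := q.asIdeal) hpq
  have h2 : n ≤ d := by
    have h3 := lift_trdeg_le_of_injective (f.comp g) (hf.comp hg)
    simpa [MvPolynomial.trdeg_of_isDomain] using h3
  refine h1.trans ?_
  rw [MvPolynomial.ringKrullDim_of_isNoetherianRing, ringKrullDim_eq_zero_of_field, zero_add]
  simpa using h2

variable {ι : Type*}

/-- The image of the polynomial map with components `P`. -/
def polyImage (P : ι → MvPolynomial (Fin 3) ℝ) : Set (ι → ℝ) :=
  range fun (y : Fin 3 → ℝ) i => eval y (P i)

variable {P : ι → MvPolynomial (Fin 3) ℝ}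

theorem eval_aeval_components (y : Fin 3 → ℝ) (F : MvPolynomial ι ℝ) :
    eval y (aeval P F) = eval (fun i => eval y (P i)) F := by
  have h := DFunLike.congr_fun (MvPolynomial.comp_aeval (R := ℝ) P
    (MvPolynomial.aeval (R := ℝ) y)) F
  simpa [coe_aeval_eq_eval] using h

theorem vanishingIdeal_polyImage :
    vanishingIdeal ℝ (polyImage P) = RingHom.ker (aeval (R := ℝ) P).toRingHom := by
  ext F
  rw [mem_vanishingIdeal_iff, RingHom.mem_ker]
  constructor
  · intro h
    refine MvPolynomial.funext fun y => ?_
    have h1 := h _ ⟨y, rfl⟩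
    rw [map_zero]
    exact (eval_aeval_components y F).trans (by simpa [coe_aeval_eq_eval] using h1)
  · rintro h _ ⟨y, rfl⟩
    have h1 := eval_aeval_components (P := P) y F
    rw [show aeval P F = 0 from h, map_zero] at h1
    simpa [coe_aeval_eq_eval] using h1.symm

/-- The polynomial map `(a, b, c) ↦ (b, a + c, b (c - a) / 2, …)` parametrizing the abnormal set;
`i₀`, `i₁`, `i₂` are the indices of the three coordinates displayed. -/
structure IsAbnormalParam (P : ι → MvPolynomial (Fin 3) ℝ) (i₀ i₁ i₂ : ι) : Prop where
  zero : P i₀ = X 1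
  one : P i₁ = X 0 + X 2
  two : 2 * P i₂ = X 1 * (X 2 - X 0)
  line : ∀ i ≠ i₁, ∀ y : Fin 3 → ℝ, y 1 = 0 → eval y (P i) = 0

namespace IsAbnormalParam

variable {i₀ i₁ i₂ : ι}

theorem two_mul_eval (h : IsAbnormalParam P i₀ i₁ i₂) (y : Fin 3 → ℝ) :
    2 * eval y (P i₂) = y 1 * (y 2 - y 0) := by
  have := congrArg (eval y) h.two
  simpa using this

theorem three_le_ringKrullDim (h : IsAbnormalParam P i₀ i₁ i₂) :
    3 ≤ ringKrullDim (MvPolynomial ι ℝ ⧸ vanishingIdeal ℝ (polyImage P)) := by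
  -- The images of `a = 0`, of `a = c = 0` and of the point `(0, 1, 0)` form, with the whole image,
  -- a chain of irreducible closed sets; `b (a + c) ∓ b (c - a)` and `b - 1` tell them apart.
  let ψ : (Fin 3 → MvPolynomial (Fin 3) ℝ) → MvPolynomial ι ℝ →ₐ[ℝ] MvPolynomial (Fin 3) ℝ :=
    fun S => (aeval S).comp (aeval P)
  let S : Fin 4 → Fin 3 → MvPolynomial (Fin 3) ℝ :=
    ![![X 0, X 1, X 2], ![0, X 1, X 2], ![0, X 1, 0], ![0, 1, 0]]
  let 𝔭 : Fin 4 → PrimeSpectrum (MvPolynomial ι ℝ) := fun j =>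
    ⟨RingHom.ker (ψ (S j)).toRingHom, RingHom.ker_isPrime _⟩
  have hψ0 : ∀ T, ψ T (X i₀) = T 1 := fun T => by simp [ψ, h.zero]
  have hψ1 : ∀ T, ψ T (X i₁) = T 0 + T 2 := fun T => by simp [ψ, h.one]
  have hψ2 : ∀ T, ψ T (2 * X i₂) = T 1 * (T 2 - T 0) := fun T => by
    have h1 : ψ T (2 * X i₂) = aeval T (2 * P i₂) := by
      simp only [ψ, AlgHom.comp_apply, map_mul, map_ofNat, aeval_X]
    rw [h1, h.two]; simp
  have hle : ∀ T T' : Fin 3 → MvPolynomial (Fin 3) ℝ, (∀ i, aeval T' (T i) = T' i) →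
      RingHom.ker (ψ T).toRingHom ≤ RingHom.ker (ψ T').toRingHom := by
    intro T T' hT F hF
    have h1 : ψ T' = (aeval T').comp (ψ T) := by
      have h2 : (aeval T' : MvPolynomial (Fin 3) ℝ →ₐ[ℝ] MvPolynomial (Fin 3) ℝ) =
          (aeval T').comp (aeval T) := by
        ext1 i; simp only [AlgHom.comp_apply, aeval_X, hT]
      change (aeval T').comp (aeval P) = (aeval T').comp ((aeval T).comp (aeval P))
      rw [← AlgHom.comp_assoc, ← h2]
    change ψ T' F = 0
    rw [h1, AlgHom.comp_apply, show ψ T F = 0 from hF, map_zero]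
  have hlt : ∀ (T T' : Fin 3 → MvPolynomial (Fin 3) ℝ) (F : MvPolynomial ι ℝ),
      (∀ i, aeval T' (T i) = T' i) → ψ T' F = 0 → ψ T F ≠ 0 →
      RingHom.ker (ψ T).toRingHom < RingHom.ker (ψ T').toRingHom := fun T T' F h1 h2 h3 =>
    lt_of_le_of_ne (hle T T' h1) fun heq => h3 (by
      have : F ∈ RingHom.ker (ψ T').toRingHom := h2
      rw [← heq] at this
      exact this)
  have hmono : StrictMono 𝔭 := by
    rw [Fin.strictMono_iff_lt_succ]
    intro j
    change RingHom.ker (ψ (S j.castSucc)).toRingHom < RingHom.ker (ψ (S j.succ)).toRingHom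
    fin_cases j
    · refine hlt _ _ (X i₀ * X i₁ - 2 * X i₂) (fun i => by fin_cases i <;> simp [S]) ?_ ?_
      · rw [map_sub, map_mul, hψ0, hψ1, hψ2]; simp [S]
      · rw [map_sub, map_mul, hψ0, hψ1, hψ2]
        intro h0
        have := congrArg (eval 1) h0
        simp [S] at this
    · refine hlt _ _ (X i₀ * X i₁ + 2 * X i₂) (fun i => by fin_cases i <;> simp [S]) ?_ ?_
      · rw [map_add, map_mul, hψ0, hψ1, hψ2]; simp [S]
      · rw [map_add, map_mul, hψ0, hψ1, hψ2]
        intro h0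
        have := congrArg (eval 1) h0
        simp [S] at this
    · refine hlt _ _ (X i₀ - 1) (fun i => by fin_cases i <;> simp [S]) ?_ ?_
      · rw [map_sub, hψ0, map_one]; simp [S]
      · rw [map_sub, hψ0, map_one]
        intro h0
        have := congrArg (eval 0) h0
        simp [S] at this
  have hS0 : ψ (S 0) = aeval P := by
    ext1 i
    have : S 0 = X := by ext1 i; fin_cases i <;> simp [S]
    simp [ψ, this]
  rw [ringKrullDim_quotient]
  let f : Fin 4 → PrimeSpectrum.zeroLocus
      (vanishingIdeal ℝ (polyImage P) : Set (MvPolynomial ι ℝ)) := fun j =>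
    ⟨𝔭 j, by
      have h1 : 𝔭 0 ≤ 𝔭 j := hmono.monotone (Fin.zero_le _)
      have h2 : vanishingIdeal ℝ (polyImage P) = (𝔭 0).asIdeal := by
        rw [vanishingIdeal_polyImage, ← hS0]
      rw [PrimeSpectrum.mem_zeroLocus, h2]
      exact h1⟩
  have hf : StrictMono f := fun i j hij => hmono hij
  exact_mod_cast Order.LTSeries.length_le_krullDim (LTSeries.mk 3 f hf)

theorem ringKrullDim_eq [Finite ι] (h : IsAbnormalParam P i₀ i₁ i₂) :
    ringKrullDim (MvPolynomial ι ℝ ⧸ vanishingIdeal ℝ (polyImage P)) = 3 := by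
  refine le_antisymm ?_ h.three_le_ringKrullDim
  rw [vanishingIdeal_polyImage]
  change ringKrullDim (MvPolynomial ι ℝ ⧸ RingHom.ker (aeval (R := ℝ) P)) ≤ 3
  have : Algebra.FiniteType ℝ (MvPolynomial ι ℝ ⧸ RingHom.ker (aeval (R := ℝ) P)) :=
    Algebra.FiniteType.of_surjective (Ideal.Quotient.mkₐ ℝ _) Ideal.Quotient.mk_surjective
  exact ringKrullDim_le_of_injective_mvPolynomial (d := 3)
    (Ideal.kerLiftAlg (aeval (R := ℝ) P)) (Ideal.kerLiftAlg_injective _)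

/-- Away from `b = 0` the parameters are rational functions of `b`, `a + c` and `b (c - a) / 2`,
with powers of `b` as denominators. -/
theorem exists_clear_denominators (i₀ i₁ i₂ : ι) (F : MvPolynomial (Fin 3) ℝ) :
    ∃ (N : ℕ) (K : MvPolynomial ι ℝ), ∀ x : ι → ℝ, x i₀ ≠ 0 → eval x K = x i₀ ^ N *
      eval ![x i₁ / 2 - x i₂ / x i₀, x i₀, x i₁ / 2 + x i₂ / x i₀] F := by
  induction F using MvPolynomial.induction_on with
  | C r => exact ⟨0, C r, fun x _ => by simp⟩
  | add F F' ih ih' =>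
    obtain ⟨N, K, hK⟩ := ih
    obtain ⟨N', K', hK'⟩ := ih'
    refine ⟨N + N', X i₀ ^ N' * K + X i₀ ^ N * K', fun x hx => ?_⟩
    simp only [map_add, map_mul, map_pow, eval_X, hK x hx, hK' x hx]
    ring
  | mul_X F i ih =>
    obtain ⟨N, K, hK⟩ := ih
    have h2 : ∃ L : MvPolynomial ι ℝ, ∀ x : ι → ℝ, x i₀ ≠ 0 → eval x L = x i₀ *
        ![x i₁ / 2 - x i₂ / x i₀, x i₀, x i₁ / 2 + x i₂ / x i₀] i := by
      fin_cases i
      · refine ⟨C (1 / 2) * X i₀ * X i₁ - X i₂, fun x hx => ?_⟩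
        simp; field_simp
      · refine ⟨X i₀ * X i₀, fun x hx => ?_⟩
        simp
      · refine ⟨C (1 / 2) * X i₀ * X i₁ + X i₂, fun x hx => ?_⟩
        simp; field_simp
    obtain ⟨L, hL⟩ := h2
    refine ⟨N + 1, K * L, fun x hx => ?_⟩
    simp only [map_mul, eval_X, hK x hx, hL x hx]
    ring

/-- The image is irreducible because its ideal is the kernel of a map to a domain. Away from
`x i₀ = 0` the parametrization is inverted by rational functions, so the image fills the open set
`x i₀ ≠ 0` of its closure; the rest of the image is the line `b = 0`. -/
theorem isConstructibleOfDim [Finite ι] (h : IsAbnormalParam P i₀ i₁ i₂) :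
    IsConstructibleOfDim (polyImage P) 3 where
  irreducible := by
    rw [vanishingIdeal_polyImage]
    exact RingHom.ker_isPrime _
  dim_eq := h.ringKrullDim_eq
  constructible := by
    refine ⟨X i₀, ?_, Ideal.span (X '' {i | i ≠ i₁}), ?_⟩
    · rw [mem_vanishingIdeal_iff]
      intro h0
      have := h0 _ ⟨1, rfl⟩
      simp [h.zero] at this
    · have hJ : zeroLocus ℝ (Ideal.span (X '' {i | i ≠ i₁}) : Ideal (MvPolynomial ι ℝ)) =
          {x : ι → ℝ | ∀ i ≠ i₁, x i = 0} := by
        rw [zeroLocus_span]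
        ext x
        simp
      rw [hJ]
      ext x
      constructor
      · rintro ⟨y, rfl⟩
        by_cases hy : y 1 = 0
        · exact Or.inr fun i hi => h.line i hi y hy
        · exact Or.inl ⟨zeroLocus_vanishingIdeal_le _ ⟨y, rfl⟩, by simpa [h.zero] using hy⟩
      · rintro (⟨hx, hx0⟩ | hx)
        · rw [eval_X] at hx0
          refine ⟨![x i₁ / 2 - x i₂ / x i₀, x i₀, x i₁ / 2 + x i₂ / x i₀], funext fun i => ?_⟩
          obtain ⟨N, K, hK⟩ := exists_clear_denominators i₀ i₁ i₂ (P i)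
          -- The `i`-th equation of the graph, cleared of denominators, vanishes on the image.
          have hmem : X i₀ * (X i₀ ^ N * X i - K) ∈ vanishingIdeal ℝ (polyImage P) := by
            rw [mem_vanishingIdeal_iff]
            rintro _ ⟨y, rfl⟩
            have e0 : eval y (P i₀) = y 1 := by simp [h.zero]
            have e1 : eval y (P i₁) = y 0 + y 2 := by simp [h.one]
            have e2 := h.two_mul_eval y
            by_cases hy : y 1 = 0
            · simp [e0, hy]
            · have h1 := hK (fun i => eval y (P i)) (by rwa [e0])
              have h2 : ![eval y (P i₁) / 2 - eval y (P i₂) / eval y (P i₀), eval y (P i₀),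
                  eval y (P i₁) / 2 + eval y (P i₂) / eval y (P i₀)] = y := by
                have e3 : eval y (P i₂) / eval y (P i₀) = (y 2 - y 0) / 2 := by
                  rw [e0, div_eq_iff hy]; linarith
                rw [e3, e0, e1]
                ext j
                fin_cases j <;> simp <;> ring
              rw [h2] at h1
              change eval (fun i => eval y (P i)) _ = 0
              simp [h1]
          have h3 := (mem_zeroLocus_iff.1 hx) _ hmem
          change eval x _ = 0 at h3
          simp only [map_mul, map_sub, map_pow, eval_X, hK x hx0] at h3
          have h4 := (mul_eq_zero.1 h3).resolve_left hx0
          rw [← mul_sub] at h4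
          have h5 := (mul_eq_zero.1 h4).resolve_left (pow_ne_zero _ hx0)
          exact (sub_eq_zero.1 h5).symm
        · refine ⟨![x i₁, 0, 0], funext fun i => ?_⟩
          by_cases hi : i = i₁
          · subst hi; simp [h.one]
          · rw [hx i hi]
            exact h.line i hi _ (by simp)

end IsAbnormalParam

end ParametrizedVariety

/-! ### Exponential coordinates of the first kind -/

section ExponentialCoordinates

variable {V : Type*} [NormedAddCommGroup V] [NormedSpace ℝ V] [FiniteDimensional ℝ V]

namespace HeisenbergData

variable (H : HeisenbergData V) {N : ℕ}

/-- The average `∫₀¹ exp (τ t D) dτ` of the flow of a derivation `D` with `D ^ N = 0`, as a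
truncated power series. -/
def flowAvg (N : ℕ) (t : ℝ) : V →L[ℝ] V :=
  ∑ k ∈ Finset.range N, (((k + 1).factorial : ℝ)⁻¹ * t ^ k) • H.D ^ k

/-- The central term of `exp (v + t X₁) * exp (-t X₁)`, half of the area swept out in `V` by
`τ ↦ ∫₀^τ exp (σ t D) v dσ`, for a derivation `D` with `D ^ N = 0`. -/
def expArea (N : ℕ) (t : ℝ) (v : V) : ℝ :=
  ∑ k ∈ Finset.range N, ∑ j ∈ Finset.range N,
    1 / 2 * (((k + 1).factorial : ℝ)⁻¹ * (j.factorial : ℝ)⁻¹ * t ^ (k + j) / (k + j + 2)) *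
      H.form ((H.D ^ k) v) ((H.D ^ j) v)

theorem flowAvg_apply (t : ℝ) (v : V) : H.flowAvg N t v =
    ∑ k ∈ Finset.range N, (((k + 1).factorial : ℝ)⁻¹ * t ^ k) • (H.D ^ k) v := by
  simp [flowAvg]

theorem D_pow_z {k : ℕ} (hk : k ≠ 0) : (H.D ^ k) H.z = 0 := by
  obtain ⟨j, rfl⟩ := Nat.exists_eq_succ_of_ne_zero hk
  rw [pow_succ]
  exact (congrArg (H.D ^ j) H.D_z).trans (map_zero _)

theorem flowAvg_z (hN : N ≠ 0) (t : ℝ) : H.flowAvg N t H.z = H.z := by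
  rw [flowAvg_apply, Finset.sum_eq_single_of_mem 0 (by simpa using Nat.pos_of_ne_zero hN)]
  · simp
  · intro k _ hk
    rw [H.D_pow_z hk, smul_zero]

theorem expArea_add_smul_z (t : ℝ) (v : V) (r : ℝ) :
    H.expArea N t (v + r • H.z) = H.expArea N t v := by
  refine Finset.sum_congr rfl fun k _ => Finset.sum_congr rfl fun j _ => ?_
  have h : ∀ (k : ℕ), ∃ r' : ℝ, (H.D ^ k) (v + r • H.z) = (H.D ^ k) v + r' • H.z := by
    intro k
    rcases eq_or_ne k 0 with rfl | hk
    · exact ⟨r, by simp⟩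
    · exact ⟨0, by rw [map_add, map_smul, H.D_pow_z hk, smul_zero, zero_smul]⟩
  obtain ⟨r₁, h₁⟩ := h k
  obtain ⟨r₂, h₂⟩ := h j
  rw [h₁, h₂]
  simp [H.form_z]

theorem exists_flowAvg_eq (t : ℝ) (hN : N ≠ 0) :
    ∃ A : V →L[ℝ] V, 1 - H.flowAvg N t = H.D * A ∧ Commute H.D A := by
  obtain ⟨M, rfl⟩ := Nat.exists_eq_succ_of_ne_zero hN
  refine ⟨-∑ k ∈ Finset.range M, (((k + 1 + 1).factorial : ℝ)⁻¹ * t ^ (k + 1)) • H.D ^ k, ?_, ?_⟩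
  · rw [flowAvg, Finset.sum_range_succ', mul_neg, Finset.mul_sum]
    simp [pow_succ' H.D]
  · exact (Commute.sum_right _ _ _ fun k _ => ((Commute.refl H.D).pow_right k).smul_right _).neg_right

/-- The inverse of `flowAvg`. -/
def flowAvgInv (N : ℕ) (t : ℝ) : V →L[ℝ] V :=
  ∑ j ∈ Finset.range N, (1 - H.flowAvg N t) ^ j

theorem one_sub_flowAvg_pow (hN : H.D ^ N = 0) (hN' : N ≠ 0) (t : ℝ) :
    (1 - H.flowAvg N t) ^ N = 0 := by
  obtain ⟨A, hA, hc⟩ := H.exists_flowAvg_eq t hN'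
  rw [hA, hc.mul_pow, hN, zero_mul]

theorem flowAvg_flowAvgInv (hN : H.D ^ N = 0) (hN' : N ≠ 0) (t : ℝ) (v : V) :
    H.flowAvg N t (H.flowAvgInv N t v) = v := by
  have h := mul_neg_geom_sum (1 - H.flowAvg N t) N
  rw [H.one_sub_flowAvg_pow hN hN', sub_sub_cancel, sub_zero] at h
  exact DFunLike.congr_fun h v

theorem flowAvgInv_flowAvg (hN : H.D ^ N = 0) (hN' : N ≠ 0) (t : ℝ) (v : V) :
    H.flowAvgInv N t (H.flowAvg N t v) = v := by
  have h := geom_sum_mul_neg (1 - H.flowAvg N t) N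
  rw [H.one_sub_flowAvg_pow hN hN', sub_sub_cancel, sub_zero] at h
  exact DFunLike.congr_fun h v

/-- The change from exponential coordinates of the first kind, `exp (v + t X₁)`, to those of the
second kind, `exp v * exp (t X₁)`. -/
def toSecondKind (N : ℕ) (t : ℝ) (v : V) : V := H.flowAvg N t v + H.expArea N t v • H.z

theorem injective_toSecondKind (hN : H.D ^ N = 0) (hN' : N ≠ 0) (t : ℝ) :
    Function.Injective (H.toSecondKind N t) := by
  intro v w h
  have hinj : Function.Injective (H.flowAvg N t) :=
    Function.LeftInverse.injective (H.flowAvgInv_flowAvg hN hN' t)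
  -- The two points differ by a central vector, which does not affect `expArea`.
  have h1 : v = w + (H.expArea N t w - H.expArea N t v) • H.z := hinj (by
    rw [map_add, map_smul, H.flowAvg_z hN', sub_smul]
    unfold toSecondKind at h
    rw [← add_sub_assoc, ← h, add_sub_cancel_right])
  have h2 : H.expArea N t v = H.expArea N t w := by
    conv_lhs => rw [h1]
    exact H.expArea_add_smul_z t w _
  rw [h1, h2]; simp

theorem hasDerivAt_flowAvg_curve (hN : H.D ^ N = 0) (t τ : ℝ) (v : V) :
    HasDerivAt (fun τ : ℝ => ∑ k ∈ Finset.range N,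
      (((k + 1).factorial : ℝ)⁻¹ * t ^ k * τ ^ (k + 1)) • (H.D ^ k) v) (H.flow (t * τ) v) τ := by
  rw [H.flow_apply_eq_sum hN]
  refine HasDerivAt.fun_sum fun k _ => ?_
  refine (((hasDerivAt_pow (k + 1) τ).const_mul _).smul_const _).congr_deriv ?_
  congr 1
  rw [Nat.factorial_succ]
  push_cast
  field_simp
  ring

theorem hasDerivAt_area_curve (hN : H.D ^ N = 0) (t τ : ℝ) (v : V) :
    HasDerivAt (fun τ : ℝ => ∑ k ∈ Finset.range N, ∑ j ∈ Finset.range N,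
      1 / 2 * (((k + 1).factorial : ℝ)⁻¹ * (j.factorial : ℝ)⁻¹ * t ^ (k + j) / (k + j + 2)) *
        H.form ((H.D ^ k) v) ((H.D ^ j) v) * τ ^ (k + j + 2))
      (1 / 2 * H.form (∑ k ∈ Finset.range N,
        (((k + 1).factorial : ℝ)⁻¹ * t ^ k * τ ^ (k + 1)) • (H.D ^ k) v) (H.flow (t * τ) v)) τ := by
  have h : 1 / 2 * H.form (∑ k ∈ Finset.range N,
        (((k + 1).factorial : ℝ)⁻¹ * t ^ k * τ ^ (k + 1)) • (H.D ^ k) v) (H.flow (t * τ) v) =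
      ∑ k ∈ Finset.range N, ∑ j ∈ Finset.range N, 1 / 2 *
        ((((k + 1).factorial : ℝ)⁻¹ * t ^ k * τ ^ (k + 1)) *
        (((j.factorial : ℝ)⁻¹ * (t * τ) ^ j) * H.form ((H.D ^ k) v) ((H.D ^ j) v))) := by
    rw [H.flow_apply_eq_sum hN]
    simp only [map_sum, map_smul, sum_apply, smul_apply, smul_eq_mul,
      Finset.mul_sum]
    rw [Finset.sum_comm]
    refine Finset.sum_congr rfl fun k _ => Finset.sum_congr rfl fun j _ => ?_
    ring
  rw [h]
  refine HasDerivAt.fun_sum fun k _ => HasDerivAt.fun_sum fun j _ => ?_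
  refine ((hasDerivAt_pow (k + j + 2) τ).const_mul _).congr_deriv ?_
  have h2 : ((k : ℝ) + j + 2) ≠ 0 := by positivity
  rw [show k + j + 2 - 1 = k + j + 1 by omega]
  push_cast
  field_simp
  ring

/-- The one-parameter subgroup of `v + t X₁` is `τ ↦ exp (w(τ) + α(τ) z) * exp (τ t X₁)`, where
`w(τ) = ∫₀^τ exp (σ t D) v dσ` and `α` is half of the area swept out by `w`. -/
theorem Realization.expMap_lin {E : Type*} [NormedAddCommGroup E] [NormedSpace ℝ E]
    [FiniteDimensional ℝ E] {G : Type*} [TopologicalSpace G] [ChartedSpace E G] [Group G]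
    [LieGroup 𝓘(ℝ, E) ∞ G] [T2Space G] {H : HeisenbergData V} (R : H.Realization (E := E) G)
    (hN : H.D ^ N = 0) (v : V) (t : ℝ) :
    expMap G (R.lin (v, t)) = R.ofPair (H.toSecondKind N t v, t) := by
  let w : ℝ → V := fun τ => ∑ k ∈ Finset.range N,
      (((k + 1).factorial : ℝ)⁻¹ * t ^ k * τ ^ (k + 1)) • (H.D ^ k) v
  let α : ℝ → ℝ := fun τ => ∑ k ∈ Finset.range N, ∑ j ∈ Finset.range N,
      1 / 2 * (((k + 1).factorial : ℝ)⁻¹ * (j.factorial : ℝ)⁻¹ * t ^ (k + j) / (k + j + 2)) *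
        H.form ((H.D ^ k) v) ((H.D ^ j) v) * τ ^ (k + j + 2)
  have h := eq_expMap_one (G := G) (v := R.lin (v, t))
    (γ := fun τ => R.ofPair (w τ + α τ • H.z, t * τ)) ?_ fun τ => ?_
  · rw [← h]
    simp [w, α, toSecondKind, flowAvg_apply, expArea]
  · have h0 : (w 0 + α 0 • H.z, t * 0) = (0 : V × ℝ) := by simp [w, α]
    rw [h0, R.ofPair_zero]
  · have h1 : HasDerivAt (fun τ => (w τ + α τ • H.z, t * τ))
        (H.flow (t * τ) v + (1 / 2 * H.form (w τ) (H.flow (t * τ) v)) • H.z, t * 1) τ :=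
      ((H.hasDerivAt_flowAvg_curve hN t τ v).add
        ((H.hasDerivAt_area_curve hN t τ v).smul_const H.z)).prodMk
        ((hasDerivAt_id τ).const_mul t)
    have h2 := R.hasLeftVelocity_ofPair_comp h1
    rw [transDeriv_apply] at h2
    simpa [flow_neg_flow, flow_z, H.form_z] using h2

end HeisenbergData

end ExponentialCoordinates

/-! ### Polynomial maps -/

section PolynomialMaps

open MvPolynomial

/-- Polynomial functions of three real variables. -/
def IsPolyFun (f : (Fin 3 → ℝ) → ℝ) : Prop := ∃ P : MvPolynomial (Fin 3) ℝ, ∀ y, f y = eval y P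

namespace IsPolyFun

variable {f g : (Fin 3 → ℝ) → ℝ}

theorem const (c : ℝ) : IsPolyFun fun _ => c := ⟨C c, fun y => by simp⟩

theorem coord (i : Fin 3) : IsPolyFun fun y => y i := ⟨X i, fun y => by simp⟩

theorem add (hf : IsPolyFun f) (hg : IsPolyFun g) : IsPolyFun fun y => f y + g y := by
  obtain ⟨P, hP⟩ := hf
  obtain ⟨Q, hQ⟩ := hg
  exact ⟨P + Q, fun y => by simp [hP, hQ]⟩

theorem mul (hf : IsPolyFun f) (hg : IsPolyFun g) : IsPolyFun fun y => f y * g y := by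
  obtain ⟨P, hP⟩ := hf
  obtain ⟨Q, hQ⟩ := hg
  exact ⟨P * Q, fun y => by simp [hP, hQ]⟩

theorem sub (hf : IsPolyFun f) (hg : IsPolyFun g) : IsPolyFun fun y => f y - g y := by
  obtain ⟨P, hP⟩ := hf
  obtain ⟨Q, hQ⟩ := hg
  exact ⟨P - Q, fun y => by simp [hP, hQ]⟩

theorem pow (hf : IsPolyFun f) (n : ℕ) : IsPolyFun fun y => f y ^ n := by
  obtain ⟨P, hP⟩ := hf
  exact ⟨P ^ n, fun y => by simp [hP]⟩

theorem sum {ι : Type*} (s : Finset ι) {f : ι → (Fin 3 → ℝ) → ℝ} (hf : ∀ i ∈ s, IsPolyFun (f i)) :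
    IsPolyFun fun y => ∑ i ∈ s, f i y := by
  classical
  induction s using Finset.induction_on with
  | empty => simpa using const 0
  | insert i s hi ih =>
    simp only [Finset.sum_insert hi]
    exact (hf i (by simp)).add (ih fun j hj => hf j (by simp [hj]))

end IsPolyFun

variable {V : Type*} [NormedAddCommGroup V] [NormedSpace ℝ V] [FiniteDimensional ℝ V]

/-- Polynomial maps of three real variables into a finite-dimensional vector space: all linear
functionals of the map are polynomial. -/
def IsPolyMap (F : (Fin 3 → ℝ) → V) : Prop := ∀ μ : V →L[ℝ] ℝ, IsPolyFun fun y => μ (F y)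

namespace IsPolyMap

variable {f : (Fin 3 → ℝ) → ℝ} {F F' : (Fin 3 → ℝ) → V}

theorem const (v : V) : IsPolyMap fun _ => v := fun μ => .const (μ v)

theorem add (hF : IsPolyMap F) (hF' : IsPolyMap F') : IsPolyMap fun y => F y + F' y := fun μ => by
  simpa using (hF μ).add (hF' μ)

theorem sub (hF : IsPolyMap F) (hF' : IsPolyMap F') : IsPolyMap fun y => F y - F' y := fun μ => by
  simpa using (hF μ).sub (hF' μ)

theorem smul (hf : IsPolyFun f) (hF : IsPolyMap F) : IsPolyMap fun y => f y • F y := fun μ => by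
  simpa using hf.mul (hF μ)

theorem sum {ι : Type*} (s : Finset ι) {F : ι → (Fin 3 → ℝ) → V} (hF : ∀ i ∈ s, IsPolyMap (F i)) :
    IsPolyMap fun y => ∑ i ∈ s, F i y := fun μ => by
  simpa using IsPolyFun.sum s fun i hi => hF i hi μ

theorem clm (A : V →L[ℝ] V) (hF : IsPolyMap F) : IsPolyMap fun y => A (F y) := fun μ =>
  hF (μ.comp A)

theorem bilin (B : V →L[ℝ] V →L[ℝ] ℝ) (hF : IsPolyMap F) (hF' : IsPolyMap F') :
    IsPolyFun fun y => B (F y) (F' y) := by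
  let b := Module.finBasis ℝ V
  have h : ∀ y, B (F y) (F' y) = ∑ i, LinearMap.toContinuousLinearMap (b.coord i) (F y) *
      B (b i) (F' y) := by
    intro y
    conv_lhs => rw [← b.sum_repr (F y)]
    simp only [map_sum, map_smul, sum_apply, smul_apply, smul_eq_mul]
    rfl
  simp only [h]
  exact IsPolyFun.sum _ fun i _ => (hF _).mul (hF' (B (b i)))

variable (H : HeisenbergData V) {N : ℕ}

theorem flow (hN : H.D ^ N = 0) (hf : IsPolyFun f) (hF : IsPolyMap F) :
    IsPolyMap fun y => H.flow (f y) (F y) := by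
  simp only [H.flow_apply_eq_sum hN]
  exact sum _ fun k _ => smul ((IsPolyFun.const _).mul (hf.pow k)) (hF.clm _)

theorem flowAvg (hf : IsPolyFun f) (hF : IsPolyMap F) :
    IsPolyMap fun y => H.flowAvg N (f y) (F y) := by
  simp only [H.flowAvg_apply]
  exact sum _ fun k _ => smul ((IsPolyFun.const _).mul (hf.pow k)) (hF.clm _)

theorem flowAvgInv (hf : IsPolyFun f) (hF : IsPolyMap F) :
    IsPolyMap fun y => H.flowAvgInv N (f y) (F y) := by
  have h : ∀ j : ℕ, IsPolyMap fun y => ((1 - H.flowAvg N (f y)) ^ j) (F y) := by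
    intro j
    induction j with
    | zero => simpa using hF
    | succ j ih =>
      simp only [pow_succ']
      exact ih.sub (ih.flowAvg H hf)
  simp only [HeisenbergData.flowAvgInv, sum_apply]
  exact sum _ fun j _ => h j

theorem expArea (hf : IsPolyFun f) (hF : IsPolyMap F) :
    IsPolyFun fun y => H.expArea N (f y) (F y) := by
  refine IsPolyFun.sum _ fun k _ => IsPolyFun.sum _ fun j _ => ?_
  simp only [div_eq_mul_inv]
  exact ((IsPolyFun.const _).mul (((IsPolyFun.const _).mul (hf.pow _)).mul (.const _))).mul
    (bilin H.form (hF.clm _) (hF.clm _))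

end IsPolyMap

end PolynomialMaps

/-! ### The abnormal set of type II in exponential coordinates -/

section AbnormalCoordinates

variable {V : Type*} [NormedAddCommGroup V] [NormedSpace ℝ V] [FiniteDimensional ℝ V]

namespace HeisenbergData

variable (H : HeisenbergData V) {N : ℕ} (e : V)

/-- The `V`-component of `exp (a e) * exp (b X₁) * exp (c e)` modulo the centre, in exponential
coordinates of the first kind. -/
def abnormalBase (N : ℕ) (y : Fin 3 → ℝ) : V :=
  H.flowAvgInv N (y 1) (y 0 • e + y 2 • H.flow (y 1) e)

/-- The `V`-component of `exp (a e) * exp (b X₁) * exp (c e)`, where `(a, b, c) = y`, in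
exponential coordinates of the first kind. -/
def abnormalPoint (N : ℕ) (y : Fin 3 → ℝ) : V :=
  H.abnormalBase e N y + (1 / 2 * H.form (y 0 • e) (y 2 • H.flow (y 1) e) -
    H.expArea N (y 1) (H.abnormalBase e N y)) • H.z

theorem isPolyMap_abnormalPoint (hN : H.D ^ N = 0) : IsPolyMap (H.abnormalPoint e N) := by
  have h1 : IsPolyMap fun y : Fin 3 → ℝ => y 0 • e := .smul (.coord 0) (.const e)
  have h2 : IsPolyMap fun y : Fin 3 → ℝ => y 2 • H.flow (y 1) e :=
    .smul (.coord 2) (.flow H hN (.coord 1) (.const e))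
  have h3 : IsPolyMap (H.abnormalBase e N) := (h1.add h2).flowAvgInv H (.coord 1)
  exact h3.add (.smul (((IsPolyFun.const _).mul (h1.bilin H.form h2)).sub (h3.expArea H (.coord 1)))
    (.const H.z))

theorem flowAvg_abnormalBase (hN : H.D ^ N = 0) (hN' : N ≠ 0) (y : Fin 3 → ℝ) :
    H.flowAvg N (y 1) (H.abnormalBase e N y) = y 0 • e + y 2 • H.flow (y 1) e :=
  H.flowAvg_flowAvgInv hN hN' _ _

theorem toSecondKind_abnormalPoint (hN : H.D ^ N = 0) (hN' : N ≠ 0) (y : Fin 3 → ℝ) :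
    (H.toSecondKind N (y 1) (H.abnormalPoint e N y), y 1) =
      H.mul (H.mul (y 0 • e, 0) (0, y 1)) (y 2 • e, 0) := by
  have h : H.expArea N (y 1) (H.abnormalPoint e N y) =
      H.expArea N (y 1) (H.abnormalBase e N y) := H.expArea_add_smul_z _ _ _
  rw [toSecondKind, h, abnormalPoint, map_add, map_smul, H.flowAvg_z hN',
    H.flowAvg_abnormalBase e hN hN']
  simp only [mul, Prod.mk.injEq]
  constructor
  · simp only [map_zero, map_smul, mul_zero, zero_smul, add_zero, zero_add]
    module
  · simp

/-- The parametrization of the abnormal set of type II in exponential coordinates. -/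
theorem exists_coords_iff (hN : H.D ^ N = 0) (hN' : N ≠ 0) (v : V) (t : ℝ) :
    (∃ a b c : ℝ, (H.toSecondKind N t v, t) = H.mul (H.mul (a • e, 0) (0, b)) (c • e, 0)) ↔
      ∃ y : Fin 3 → ℝ, v = H.abnormalPoint e N y ∧ t = y 1 := by
  constructor
  · rintro ⟨a, b, c, h⟩
    have h1 := h.trans (H.toSecondKind_abnormalPoint e hN hN' ![a, b, c]).symm
    have ht : t = b := congrArg Prod.snd h1
    subst ht
    exact ⟨![a, t, c], H.injective_toSecondKind hN hN' t (congrArg Prod.fst h1), rfl⟩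
  · rintro ⟨y, rfl, rfl⟩
    exact ⟨y 0, y 1, y 2, H.toSecondKind_abnormalPoint e hN hN' y⟩

theorem abnormalPoint_of_eq_zero (hN : H.D ^ N = 0) (hN' : N ≠ 0) (y : Fin 3 → ℝ) (hy : y 1 = 0) :
    H.abnormalPoint e N y = (y 0 + y 2) • e := by
  refine H.injective_toSecondKind hN hN' (y 1) ?_
  have h := congrArg Prod.fst (H.toSecondKind_abnormalPoint e hN hN' y)
  refine h.trans ?_
  obtain ⟨M, rfl⟩ := Nat.exists_eq_succ_of_ne_zero hN'
  have hA : H.expArea (M + 1) 0 ((y 0 + y 2) • e) = 0 := by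
    refine Finset.sum_eq_zero fun k _ => Finset.sum_eq_zero fun j _ => ?_
    rcases eq_or_ne (k + j) 0 with h0 | h0
    · obtain ⟨rfl, rfl⟩ := Nat.add_eq_zero_iff.1 h0
      simp [H.form_self]
    · simp [zero_pow h0]
  have hT : ∀ v, H.flowAvg (M + 1) 0 v = v := fun v => by
    rw [flowAvg_apply, Finset.sum_range_succ']
    simp
  rw [toSecondKind, hy, hA, hT]
  simp [mul, H.form_self, add_smul]

variable {H e}

/-- A coordinate which vanishes on `[X₁, 𝔤]` is additive along the product. -/
theorem coord_abnormalPoint (hN : H.D ^ N = 0) (hN' : N ≠ 0) {ζ : V →L[ℝ] ℝ}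
    (hD : ∀ v, ζ (H.D v) = 0) (hz : ζ H.z = 0) (he : ζ e = 1) (y : Fin 3 → ℝ) :
    ζ (H.abnormalPoint e N y) = y 0 + y 2 := by
  have hk : ∀ k v, ζ ((H.D ^ (k + 1)) v) = 0 := fun k v => by
    rw [pow_succ']; exact hD _
  have h := congrArg ζ (H.flowAvg_abnormalBase e hN hN' y)
  obtain ⟨M, rfl⟩ := Nat.exists_eq_succ_of_ne_zero hN'
  rw [flowAvg_apply, H.flow_apply_eq_sum hN, Finset.sum_range_succ', Finset.sum_range_succ'] at h
  simp only [map_add, map_sum, map_smul, hk] at h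
  simp only [abnormalPoint, map_add, map_smul, hz]
  simpa [he] using h

/-- The next coordinate, dual to `D e`. -/
theorem coord_D_abnormalPoint (hN : H.D ^ N = 0) (hN' : 2 ≤ N) {ζ η : V →L[ℝ] ℝ}
    (hD : ∀ v, ζ (H.D v) = 0) (hz : ζ H.z = 0) (he : ζ e = 1) (ηD : ∀ v, η (H.D v) = ζ v)
    (ηz : η H.z = 0) (ηe : η e = 0) (y : Fin 3 → ℝ) :
    2 * η (H.abnormalPoint e N y) = y 1 * (y 2 - y 0) := by
  have h1 := coord_abnormalPoint hN (by omega) hD hz he y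
  have hk : ∀ k v, η ((H.D ^ (k + 1 + 1)) v) = 0 := fun k v => by
    rw [pow_succ', pow_succ']; exact (ηD _).trans (hD _)
  have h := congrArg η (H.flowAvg_abnormalBase e hN (by omega) y)
  obtain ⟨M, rfl⟩ := Nat.exists_eq_add_of_le' hN'
  rw [flowAvg_apply, H.flow_apply_eq_sum hN, Finset.sum_range_succ', Finset.sum_range_succ',
    Finset.sum_range_succ', Finset.sum_range_succ'] at h
  simp only [map_add, map_sum, map_smul, hk] at h
  simp only [abnormalPoint, map_add, map_smul, hz, ηz, smul_zero, add_zero] at h1 ⊢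
  simp [ηD, he, ηe, h1] at h
  linarith

end HeisenbergData

end AbnormalCoordinates

/-! ### Filiform Lie algebras -/

section FiliformAlgebra

variable {𝔤 : Type*} [LieRing 𝔤] [LieAlgebra ℝ 𝔤] {n : ℕ}

/-- The common features of the two types of filiform Lie algebras: the vectors `X₂, …` span an ideal
whose brackets are multiples of the last vector of the basis, and this vector is central. -/
structure IsHeisenbergBasis (X : Module.Basis (Fin (n + 2)) ℝ 𝔤) : Prop where
  lie_first : ∀ j : Fin (n + 1), X.repr ⁅X 0, X j.succ⁆ 0 = 0
  lie_mem : ∀ i j : Fin (n + 1), ∃ c : ℝ, ⁅X i.succ, X j.succ⁆ = c • X (Fin.last (n + 1))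
  lie_last : ∀ x : 𝔤, ⁅x, X (Fin.last (n + 1))⁆ = 0

namespace IsHeisenbergBasis

/-- The embedding of `V = ℝⁿ⁺¹` as the span of all vectors of the basis but the first. -/
def tailMap (X : Module.Basis (Fin (n + 2)) ℝ 𝔤) : (Fin (n + 1) → ℝ) →ₗ[ℝ] 𝔤 :=
  Fintype.linearCombination ℝ fun j => X j.succ

variable {X : Module.Basis (Fin (n + 2)) ℝ 𝔤}

theorem tailMap_apply (v : Fin (n + 1) → ℝ) : tailMap X v = ∑ j, v j • X j.succ := rfl

@[simp] theorem tailMap_single (j : Fin (n + 1)) : tailMap X (Pi.single j 1) = X j.succ := by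
  rw [tailMap_apply, Finset.sum_eq_single j] <;> simp +contextual

theorem repr_tailMap (v : Fin (n + 1) → ℝ) (j : Fin (n + 1)) :
    X.repr (tailMap X v) j.succ = v j := by
  classical
  rw [tailMap_apply, map_sum, Finsupp.finsetSum_apply, Finset.sum_eq_single j]
  · simp
  · intro i _ hi
    simp [hi]
  · simp

theorem repr_tailMap_zero (v : Fin (n + 1) → ℝ) : X.repr (tailMap X v) 0 = 0 := by
  rw [tailMap_apply, map_sum, Finsupp.finsetSum_apply]
  refine Finset.sum_eq_zero fun i _ => ?_
  simp

theorem injective_tailMap : Function.Injective (tailMap X) := fun v w h => by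
  ext j
  rw [← repr_tailMap (X := X) v j, h, repr_tailMap]

theorem eq_tailMap_add (x : 𝔤) :
    x = tailMap X (fun j => X.repr x j.succ) + X.repr x 0 • X 0 := by
  conv_lhs => rw [← X.sum_repr x, Fin.sum_univ_succ]
  rw [tailMap_apply, add_comm]

variable (X) in
/-- The coordinates of the bracket with the first vector of the basis. -/
def derivation : (Fin (n + 1) → ℝ) →ₗ[ℝ] (Fin (n + 1) → ℝ) :=
  LinearMap.pi fun j => X.coord j.succ ∘ₗ (LieAlgebra.ad ℝ 𝔤 (X 0) : 𝔤 →ₗ[ℝ] 𝔤) ∘ₗ tailMap X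

variable (X) in
/-- The last coordinate of the bracket. -/
def bracketForm : (Fin (n + 1) → ℝ) →ₗ[ℝ] (Fin (n + 1) → ℝ) →ₗ[ℝ] ℝ :=
  LinearMap.mk₂ ℝ (fun v w => X.coord (Fin.last (n + 1)) ⁅tailMap X v, tailMap X w⁆)
    (fun v v' w => by simp only [map_add, add_lie]) (fun c v w => by simp only [map_smul, smul_lie])
    (fun v w w' => by simp only [map_add, lie_add]) (fun c v w => by simp only [map_smul, lie_smul])

theorem bracketForm_apply (v w : Fin (n + 1) → ℝ) :
    bracketForm X v w = X.repr ⁅tailMap X v, tailMap X w⁆ (Fin.last (n + 1)) := rfl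

theorem tailMap_derivation (h : IsHeisenbergBasis X) (v : Fin (n + 1) → ℝ) :
    tailMap X (derivation X v) = ⁅X 0, tailMap X v⁆ := by
  have h0 : X.repr ⁅X 0, tailMap X v⁆ 0 = 0 := by
    rw [tailMap_apply, lie_sum, map_sum, Finsupp.finsetSum_apply]
    refine Finset.sum_eq_zero fun j _ => ?_
    rw [lie_smul, map_smul, Finsupp.smul_apply, h.lie_first, smul_zero]
  have h1 := eq_tailMap_add (X := X) ⁅X 0, tailMap X v⁆
  rw [h0, zero_smul, add_zero] at h1
  exact h1.symm

theorem lie_tailMap (h : IsHeisenbergBasis X) (v w : Fin (n + 1) → ℝ) :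
    ⁅tailMap X v, tailMap X w⁆ = bracketForm X v w • X (Fin.last (n + 1)) := by
  have h1 : ⁅tailMap X v, tailMap X w⁆ ∈ Submodule.span ℝ {X (Fin.last (n + 1))} := by
    simp only [tailMap_apply, sum_lie, lie_sum, smul_lie, lie_smul]
    refine Submodule.sum_mem _ fun i _ => Submodule.smul_mem _ _ <|
      Submodule.sum_mem _ fun j _ => Submodule.smul_mem _ _ ?_
    obtain ⟨c, hc⟩ := h.lie_mem j i
    exact Submodule.mem_span_singleton.2 ⟨c, hc.symm⟩
  obtain ⟨c, hc⟩ := Submodule.mem_span_singleton.1 h1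
  rw [bracketForm_apply, ← hc]
  simp

theorem derivation_single_of_eq (h : IsHeisenbergBasis X) {j k : Fin (n + 1)}
    (hjk : ⁅X 0, X j.succ⁆ = X k.succ) : derivation X (Pi.single j 1) = Pi.single k 1 :=
  injective_tailMap (X := X) (by rw [h.tailMap_derivation]; simpa using hjk)

theorem derivation_single_of_eq_zero (h : IsHeisenbergBasis X) {j : Fin (n + 1)}
    (hj : ⁅X 0, X j.succ⁆ = 0) : derivation X (Pi.single j 1) = 0 :=
  injective_tailMap (X := X) (by rw [h.tailMap_derivation]; simpa using hj)

/-- The description of the Lie algebra as `ℝ ⋉ V`, with `V = ℝⁿ⁺¹` the coordinates with respect to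
`X₂, …`. -/
def data (h : IsHeisenbergBasis X) : HeisenbergData (Fin (n + 1) → ℝ) where
  D := LinearMap.toContinuousLinearMap (derivation X)
  form := (bracketForm X).toContinuousBilinearMap
  z := Pi.single (Fin.last n) 1
  form_self v := by simp [bracketForm_apply]
  D_z := h.derivation_single_of_eq_zero (h.lie_last _)
  form_z v := by
    rw [LinearMap.toContinuousBilinearMap_apply, bracketForm_apply, tailMap_single, ← lie_skew,
      Fin.succ_last, h.lie_last]
    simp
  form_D v w := by
    have h1 := leibniz_lie (X 0) (tailMap X v) (tailMap X w)
    rw [h.lie_tailMap, lie_smul, h.lie_last, smul_zero, ← h.tailMap_derivation,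
      ← h.tailMap_derivation, h.lie_tailMap, h.lie_tailMap, ← add_smul] at h1
    exact ((smul_eq_zero.1 h1.symm).resolve_right (X.ne_zero _))

theorem data_D_apply (h : IsHeisenbergBasis X) (v : Fin (n + 1) → ℝ) :
    h.data.D v = derivation X v := rfl

theorem data_form_apply (h : IsHeisenbergBasis X) (v w : Fin (n + 1) → ℝ) :
    h.data.form v w = bracketForm X v w := rfl

theorem data_z (h : IsHeisenbergBasis X) : h.data.z = Pi.single (Fin.last n) 1 := rfl

theorem bracketForm_single (i j : Fin (n + 1)) : bracketForm X (Pi.single i 1) (Pi.single j 1) =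
    X.repr ⁅X i.succ, X j.succ⁆ (Fin.last (n + 1)) := by
  rw [bracketForm_apply, tailMap_single, tailMap_single]

theorem clm_eq_zero {μ : (Fin (n + 1) → ℝ) →L[ℝ] ℝ} (hμ : ∀ j, μ (Pi.single j 1) = 0) : μ = 0 := by
  ext v
  rw [pi_eq_sum_univ' v]
  simp [hμ]

theorem D_pow_single (h : IsHeisenbergBasis X) {L : ℕ}
    (hD : ∀ j k : Fin (n + 1), k.val = j.val + 1 → k.val ≤ L → ⁅X 0, X j.succ⁆ = X k.succ)
    (k : Fin (n + 1)) (hk : k.val ≤ L) : (h.data.D ^ k.val) (Pi.single 0 1) = Pi.single k 1 := by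
  obtain ⟨k, hkn⟩ := k
  induction k with
  | zero => rfl
  | succ k ih =>
    have ih' := ih (by omega) (by simp at hk ⊢; omega)
    simp only at ih' ⊢
    rw [pow_succ']
    change h.data.D ((h.data.D ^ k) (Pi.single 0 1)) = _
    rw [ih']
    exact h.derivation_single_of_eq (hD _ _ rfl hk)

theorem D_pow_succ_single (h : IsHeisenbergBasis X) {L : ℕ} (hL : L ≤ n)
    (hD : ∀ j k : Fin (n + 1), k.val = j.val + 1 → k.val ≤ L → ⁅X 0, X j.succ⁆ = X k.succ)
    (hD' : ∀ j : Fin (n + 1), L ≤ j.val → ⁅X 0, X j.succ⁆ = 0) :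
    (h.data.D ^ (L + 1)) (Pi.single 0 1) = 0 := by
  have h1 := h.D_pow_single hD ⟨L, by omega⟩ le_rfl
  rw [pow_succ']
  change h.data.D ((h.data.D ^ L) (Pi.single 0 1)) = _
  simp only at h1
  rw [h1]
  exact h.derivation_single_of_eq_zero (hD' _ le_rfl)

/-- If `D` shifts the vectors of the basis up to the index `L` and kills those beyond, it is
nilpotent. -/
theorem D_pow_succ_eq_zero (h : IsHeisenbergBasis X) {L : ℕ} (hL : L ≤ n)
    (hD : ∀ j k : Fin (n + 1), k.val = j.val + 1 → k.val ≤ L → ⁅X 0, X j.succ⁆ = X k.succ)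
    (hD' : ∀ j : Fin (n + 1), L ≤ j.val → ⁅X 0, X j.succ⁆ = 0) : h.data.D ^ (L + 1) = 0 := by
  ext v
  rw [pi_eq_sum_univ' v, map_sum]
  have h0 : ∀ j : Fin (n + 1), (h.data.D ^ (L + 1)) (Pi.single j 1) = 0 := by
    intro j
    rcases le_or_gt j.val L with hj | hj
    · rw [← h.D_pow_single hD j hj]
      change (h.data.D ^ (L + 1) * h.data.D ^ j.val) (Pi.single 0 1) = 0
      rw [← pow_add, add_comm (L + 1), pow_add]
      change (h.data.D ^ j.val) ((h.data.D ^ (L + 1)) (Pi.single 0 1)) = 0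
      rw [h.D_pow_succ_single hL hD hD', map_zero]
    · rw [pow_succ]
      change (h.data.D ^ L) (h.data.D (Pi.single j 1)) = 0
      rw [data_D_apply, h.derivation_single_of_eq_zero (hD' j hj.le), map_zero]
  simp [h0]

end IsHeisenbergBasis

variable {X : Module.Basis (Fin (n + 2)) ℝ 𝔤} {S : Stratification 𝔤 (n + 1)}

theorem IsFiliformBasis.lie_last (h : IsFiliformBasis S X) (hn : 1 ≤ n) (x : 𝔤) :
    ⁅x, X (Fin.last (n + 1))⁆ = 0 := by
  refine S.lie_layer_last x _ ?_
  have h1 := h.layer_eq (Fin.last (n + 1)) (by simpa using hn)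
  rw [Fin.val_last] at h1
  rw [h1]
  exact Submodule.mem_span_singleton_self _

theorem IsTypeI.lie_first_succ (h : IsTypeI S X) (j k : Fin (n + 1)) (hjk : k.val = j.val + 1) :
    ⁅X 0, X j.succ⁆ = X k.succ := h.lie_first _ _ (by simp) (by simp [hjk])

theorem IsTypeI.lie_first_eq_zero (h : IsTypeI S X) (j : Fin (n + 1)) (hj : n ≤ j.val) :
    ⁅X 0, X j.succ⁆ = 0 := by
  have : j = Fin.last n := Fin.ext (by simp; omega)
  rw [this, Fin.succ_last]
  exact h.lie_first_last

theorem IsTypeI.isHeisenbergBasis (h : IsTypeI S X) (hn : 1 ≤ n) : IsHeisenbergBasis X where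
  lie_first j := by
    rcases le_or_gt n j.val with hj | hj
    · rw [h.lie_first_eq_zero j hj]; simp
    · rw [h.lie_first_succ j ⟨j.val + 1, by omega⟩ rfl]; simp
  lie_mem i j := ⟨0, by rw [h.lie_eq_zero _ _ (by simp) (by simp), zero_smul]⟩
  lie_last := h.toIsFiliformBasis.lie_last hn

theorem IsTypeI.isTypeOne (h : IsTypeI S X) (hn : 2 ≤ n) :
    (h.isHeisenbergBasis (by omega)).data.IsTypeOne (Pi.single 0 1) := by
  have hb := h.isHeisenbergBasis (by omega)
  have hpow := hb.D_pow_single (L := n) (fun j k hjk _ => h.lie_first_succ j k hjk)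
  refine ⟨⟨n + 1, hb.D_pow_succ_eq_zero le_rfl (fun j k hjk _ => h.lie_first_succ j k hjk)
    h.lie_first_eq_zero⟩, ?_, fun μ hμ => ?_, ?_⟩
  · refine ContinuousLinearMap.ext fun v => ContinuousLinearMap.ext fun w => ?_
    change IsHeisenbergBasis.bracketForm X v w = 0
    rw [pi_eq_sum_univ' v, pi_eq_sum_univ' w]
    simp only [map_sum, map_smul, LinearMap.sum_apply, LinearMap.smul_apply,
      IsHeisenbergBasis.bracketForm_single]
    simp [h.lie_eq_zero]
  · exact IsHeisenbergBasis.clm_eq_zero fun j => by rw [← hpow j (by omega)]; exact hμ _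
  · refine ⟨ContinuousLinearMap.proj (Fin.last n), fun h0 => ?_, ?_, ?_⟩
    · simpa using DFunLike.congr_fun h0 (Pi.single (Fin.last n) 1)
    · have : (0 : Fin (n + 1)) ≠ Fin.last n := fun h => by
        have := congrArg Fin.val h; simp at this; omega
      simp [this]
    · have h1 := hpow ⟨1, by omega⟩ (by simp; omega)
      simp only [pow_one] at h1
      rw [h1]
      have : Fin.last n ≠ ⟨1, by omega⟩ := fun h => by
        have := congrArg Fin.val h; simp at this; omega
      simp [this]

theorem IsTypeII.lie_first_succ (h : IsTypeII S X) (j k : Fin (n + 1)) (hjk : k.val = j.val + 1)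
    (hk : k.val ≤ n - 1) : ⁅X 0, X j.succ⁆ = X k.succ :=
  h.lie_first _ _ (by simp) (by simp [hjk]) (by have := h.five_le; simp; omega)

theorem IsTypeII.lie_first_succ_eq_zero (h : IsTypeII S X) (j : Fin (n + 1)) (hj : n - 1 ≤ j.val) :
    ⁅X 0, X j.succ⁆ = 0 := h.lie_first_eq_zero _ (by simp; omega)

theorem IsTypeII.isHeisenbergBasis (h : IsTypeII S X) : IsHeisenbergBasis X where
  lie_first j := by
    rcases le_or_gt (n - 1) j.val with hj | hj
    · rw [h.lie_first_succ_eq_zero j hj]; simp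
    · rw [h.lie_first_succ j ⟨j.val + 1, by omega⟩ rfl (by simp; omega)]; simp
  lie_mem i j := by
    by_cases hij : i.succ.val + j.succ.val = n + 1
    · exact ⟨_, h.lie_eq_last _ _ (by simp) (by simp) hij⟩
    · exact ⟨0, by rw [h.lie_eq_zero _ _ (by simp) (by simp) hij, zero_smul]⟩
  lie_last := h.toIsFiliformBasis.lie_last (by have := h.five_le; omega)

theorem IsTypeII.D_pow (h : IsTypeII S X) (k : Fin (n + 1)) (hk : k.val ≤ n - 1) :
    (h.isHeisenbergBasis.data.D ^ k.val) (Pi.single 0 1) = Pi.single k 1 :=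
  h.isHeisenbergBasis.D_pow_single h.lie_first_succ k hk

theorem IsTypeII.D_pow_eq_zero (h : IsTypeII S X) : h.isHeisenbergBasis.data.D ^ n = 0 := by
  have h5 := h.five_le
  have := h.isHeisenbergBasis.D_pow_succ_eq_zero
    (Nat.sub_le n 1) h.lie_first_succ h.lie_first_succ_eq_zero
  rwa [Nat.sub_add_cancel (by omega)] at this

theorem IsTypeII.clm_eq_zero (h : IsTypeII S X) {μ : (Fin (n + 1) → ℝ) →L[ℝ] ℝ}
    (hμ : ∀ k ≤ n - 1, μ ((h.isHeisenbergBasis.data.D ^ k) (Pi.single 0 1)) = 0)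
    (hz : μ h.isHeisenbergBasis.data.z = 0) : μ = 0 := by
  refine IsHeisenbergBasis.clm_eq_zero fun j => ?_
  rcases le_or_gt j.val (n - 1) with hj | hj
  · rw [← h.D_pow j hj]; exact hμ _ hj
  · have : j = Fin.last n := Fin.ext (by simp; omega)
    rw [this]; exact hz

theorem IsTypeII.clm_comp_D_eq_zero (h : IsTypeII S X) {μ : (Fin (n + 1) → ℝ) →L[ℝ] ℝ}
    (hμ : ∀ k : Fin (n + 1), 1 ≤ k.val → k.val ≤ n - 1 → μ (Pi.single k 1) = 0)
    (v : Fin (n + 1) → ℝ) : μ (h.isHeisenbergBasis.data.D v) = 0 := by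
  have h5 := h.five_le
  have h0 : μ.comp h.isHeisenbergBasis.data.D = 0 := by
    refine h.clm_eq_zero (fun k hk => ?_) ?_
    · change μ ((h.isHeisenbergBasis.data.D * h.isHeisenbergBasis.data.D ^ k) _) = 0
      rw [← pow_succ']
      rcases eq_or_lt_of_le hk with rfl | hk
      · rw [Nat.sub_add_cancel (by omega), h.D_pow_eq_zero]; simp
      · have := h.D_pow ⟨k + 1, by omega⟩ (by simp; omega)
        simp only at this
        rw [this]
        exact hμ _ (by simp) (by simp; omega)
    · change μ (h.isHeisenbergBasis.data.D _) = 0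
      rw [HeisenbergData.D_z, map_zero]
  exact DFunLike.congr_fun h0 v

theorem IsTypeII.D_apply_one (h : IsTypeII S X) (v : Fin (n + 1) → ℝ) :
    h.isHeisenbergBasis.data.D v 1 = v 0 := by
  have h5 := h.five_le
  have h1 : (1 : Fin (n + 1)) = ⟨1, by omega⟩ :=
    Fin.ext (Nat.mod_eq_of_lt (show 1 < n + 1 by omega))
  have h0 : (ContinuousLinearMap.proj (1 : Fin (n + 1))).comp h.isHeisenbergBasis.data.D -
      ContinuousLinearMap.proj (R := ℝ) (φ := fun _ => ℝ) (0 : Fin (n + 1)) = 0 := by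
    refine h.clm_eq_zero (fun k hk => ?_) ?_
    · have hD := h.D_pow ⟨k, by omega⟩ hk
      simp only at hD
      change (h.isHeisenbergBasis.data.D * h.isHeisenbergBasis.data.D ^ k) (Pi.single 0 1) 1 -
        (h.isHeisenbergBasis.data.D ^ k) (Pi.single 0 1) 0 = 0
      rw [← pow_succ', hD]
      have hD' : (h.isHeisenbergBasis.data.D ^ (k + 1)) (Pi.single 0 1) 1 =
          if k = 0 then 1 else 0 := by
        rcases eq_or_lt_of_le hk with rfl | hk
        · rw [Nat.sub_add_cancel (by omega), h.D_pow_eq_zero, if_neg (by omega)]; simp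
        · have hD := h.D_pow ⟨k + 1, by omega⟩ (by simp; omega)
          simp only at hD
          rw [hD, h1, Pi.single_apply]
          simp
      rw [hD', Pi.single_apply]
      have h2 : ((0 : Fin (n + 1)) = ⟨k, by omega⟩) ↔ k = 0 := by simp [Fin.ext_iff, eq_comm]
      simp [h2]
    · change h.isHeisenbergBasis.data.D _ 1 - h.isHeisenbergBasis.data.z 0 = 0
      rw [HeisenbergData.D_z, IsHeisenbergBasis.data_z, Pi.single_eq_of_ne]
      · simp
      · simp [Fin.ext_iff]; omega
  exact sub_eq_zero.1 (DFunLike.congr_fun h0 v)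

theorem IsTypeII.isTypeTwo (h : IsTypeII S X) :
    h.isHeisenbergBasis.data.IsTypeTwo (Pi.single 0 1) (n - 1) := by
  have h5 := h.five_le
  refine ⟨⟨n, h.D_pow_eq_zero⟩, by omega, fun k hk => ?_, ?_, ?_, fun μ => h.clm_eq_zero, ?_⟩
  · have := h.D_pow ⟨k, by omega⟩ hk.le
    simp only at this
    rw [this, IsHeisenbergBasis.data_form_apply, IsHeisenbergBasis.bracketForm_single,
      h.lie_eq_zero _ _ (by simp) (by simp) (by simp; omega)]
    simp
  · have := h.D_pow ⟨n - 1, by omega⟩ le_rfl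
    simp only at this
    rw [this, IsHeisenbergBasis.data_form_apply, IsHeisenbergBasis.bracketForm_single,
      h.lie_eq_last _ _ (by simp) (by simp) (by simp; omega)]
    simp
  · rw [Nat.sub_add_cancel (by omega), h.D_pow_eq_zero]; simp
  · refine ⟨ContinuousLinearMap.proj (Fin.last n), h.clm_comp_D_eq_zero fun k _ hk => ?_, ?_, ?_⟩
    · have : Fin.last n ≠ k := fun h => by
        have := congrArg Fin.val h; simp at this; omega
      simp [this]
    · have : (0 : Fin (n + 1)) ≠ Fin.last n := fun h => by
        have := congrArg Fin.val h; simp at this; omega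
      simp [this]
    · simp [IsHeisenbergBasis.data_z]

end FiliformAlgebra

/-! ### Filiform Carnot groups -/

section CarnotGroup

variable {E : Type*} [NormedAddCommGroup E] [NormedSpace ℝ E] [FiniteDimensional ℝ E]
  {G : Type*} [TopologicalSpace G] [ChartedSpace E G] [Group G] [LieGroup 𝓘(ℝ, E) ∞ G] {n : ℕ}
  {X : Module.Basis (Fin (n + 2)) ℝ (GroupLieAlgebra 𝓘(ℝ, E) G)}

/-- The Lie algebra of `G` as a realization of the abstract Lie algebra `ℝ ⋉ V`. -/
def IsHeisenbergBasis.realization (h : IsHeisenbergBasis X) : h.data.Realization (E := E) G where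
  incl := LinearMap.toContinuousLinearMap
    (F' := E) (tailMap X : (Fin (n + 1) → ℝ) →ₗ[ℝ] GroupLieAlgebra 𝓘(ℝ, E) G)
  X₁ := X 0
  bracket_first v := (h.tailMap_derivation v).symm
  bracket_incl v w := by
    have h1 := h.lie_tailMap v w
    rw [← Fin.succ_last, ← tailMap_single (X := X)] at h1
    exact h1
  bijective := by
    constructor
    · rintro ⟨v, a⟩ ⟨w, b⟩ hvw
      have hvw' : tailMap X v + a • X 0 = tailMap X w + b • X 0 := hvw
      have h0 : a = b := by
        have := congrArg (fun x => X.repr x 0) hvw'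
        simpa [repr_tailMap_zero] using this
      subst h0
      rw [injective_tailMap (add_right_cancel hvw')]
    · exact fun x => ⟨(_, _), (eq_tailMap_add (X := X) x).symm⟩

theorem IsHeisenbergBasis.realization_lin (h : IsHeisenbergBasis X) (p : (Fin (n + 1) → ℝ) × ℝ) :
    h.realization.lin p = tailMap X p.1 + p.2 • X 0 := rfl

theorem IsHeisenbergBasis.realization_lin_single (h : IsHeisenbergBasis X) (a b : ℝ) :
    h.realization.lin (b • Pi.single 0 1, a) = b • X 1 + a • X 0 := by
  rw [h.realization_lin, map_smul, tailMap_single]; rfl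

theorem IsHeisenbergBasis.ofPair_smul [T2Space G] (h : IsHeisenbergBasis X) (a : ℝ) :
    h.realization.ofPair (a • Pi.single 0 1, 0) = lieExp (a • X 1) := by
  have h1 : h.realization.incl (a • Pi.single 0 1) = a • X 1 := by
    have h2 : tailMap X (a • Pi.single 0 1) = a • X 1 := by rw [map_smul, tailMap_single]; rfl
    exact h2
  rw [HeisenbergData.Realization.ofPair, h1, zero_smul, expMap_zero, mul_one]
  rfl

theorem IsHeisenbergBasis.ofPair_zero_left [T2Space G] (h : IsHeisenbergBasis X) (b : ℝ) :
    h.realization.ofPair (0, b) = lieExp (b • X 0) := by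
  rw [HeisenbergData.Realization.ofPair, map_zero, expMap_zero, one_mul]
  rfl

/-- The abnormal set in the coordinates of the model group. The control `∑ wᵢ Yᵢ` in the given
frame `Y` of the first layer is `A(w) X₁ + B(w) X₂` for two linear functionals `A` and `B`. -/
theorem abnormalSet_eq [T2Space G] [SimplyConnectedSpace G] (h : IsHeisenbergBasis X)
    {S : Stratification (GroupLieAlgebra 𝓘(ℝ, E) G) (n + 1)} (hS : IsFiliformBasis S X)
    (hN : ∃ N, h.data.D ^ N = 0) : abnormalSet S = h.realization.ofPair ''
      (h.data.liftEndpoint (Pi.single 0 1) '' {q | h.data.IsAbnormal (Pi.single 0 1) q}) := by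
  let Φ : EuclideanSpace ℝ (Fin (Module.finrank ℝ (S.layer 1))) →ₗ[ℝ]
      GroupLieAlgebra 𝓘(ℝ, E) G :=
    { toFun := fun w => ∑ i, w i • (Module.finBasis ℝ (S.layer 1) i : GroupLieAlgebra 𝓘(ℝ, E) G)
      map_add' := fun v w => by simp [add_smul, Finset.sum_add_distrib]
      map_smul' := fun c w => by simp [Finset.smul_sum, smul_smul] }
  have hΦ : ∀ x ∈ S.layer 1, ∃ w, Φ w = x := fun x hx => by
    refine ⟨WithLp.toLp 2 ((Module.finBasis ℝ (S.layer 1)).repr ⟨x, hx⟩), ?_⟩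
    have h1 := congrArg (S.layer 1).subtype ((Module.finBasis ℝ (S.layer 1)).sum_repr ⟨x, hx⟩)
    rw [map_sum] at h1
    exact h1
  have hmem : X 0 ∈ S.layer 1 ∧ X 1 ∈ S.layer 1 := by
    rw [hS.layer_one]
    exact ⟨Submodule.subset_span (by simp), Submodule.subset_span (by simp)⟩
  refine h.realization.image_isSingularControl (e := Pi.single 0 1)
    (A := LinearMap.toContinuousLinearMap (X.coord 0 ∘ₗ Φ))
    (B := LinearMap.toContinuousLinearMap (X.coord 1 ∘ₗ Φ)) hN ?_ ?_ fun w => ?_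
  · obtain ⟨w, hw⟩ := hΦ _ hmem.1
    exact ⟨w, by simp [hw], by simp [hw]⟩
  · obtain ⟨w, hw⟩ := hΦ _ hmem.2
    exact ⟨w, by simp [hw], by simp [hw]⟩
  · rw [h.realization_lin_single]
    have h1 : Φ w ∈ Submodule.span ℝ {X 0, X 1} := by
      rw [← hS.layer_one]
      change ∑ i, w i • (Module.finBasis ℝ (S.layer 1) i : GroupLieAlgebra 𝓘(ℝ, E) G) ∈ _
      exact Submodule.sum_mem _ fun i _ => Submodule.smul_mem _ _ (Subtype.coe_prop _)
    obtain ⟨a, b, hab⟩ := Submodule.mem_span_pair.1 h1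
    change Φ w = X.repr (Φ w) 1 • X 1 + X.repr (Φ w) 0 • X 0
    rw [← hab]
    simp [add_comm]

theorem IsTypeI.abnormalSet_eq [T2Space G] [SimplyConnectedSpace G]
    {S : Stratification (GroupLieAlgebra 𝓘(ℝ, E) G) (n + 1)} (h : IsTypeI S X) (hn : 2 ≤ n) :
    abnormalSet S = {g | ∃ t : ℝ, g = lieExp (t • X 1)} := by
  have h1 := h.isTypeOne hn
  rw [_root_.abnormalSet_eq (h.isHeisenbergBasis (by omega)) h.toIsFiliformBasis h1.nilpotent,
    h1.image_isAbnormal]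
  ext g
  constructor
  · rintro ⟨_, ⟨t, rfl⟩, rfl⟩
    exact ⟨t, IsHeisenbergBasis.ofPair_smul _ t⟩
  · rintro ⟨t, rfl⟩
    exact ⟨_, ⟨t, rfl⟩, IsHeisenbergBasis.ofPair_smul _ t⟩

namespace IsTypeII

variable [T2Space G] [SimplyConnectedSpace G]
  {S : Stratification (GroupLieAlgebra 𝓘(ℝ, E) G) (n + 1)}

theorem abnormalSet_eq_image (h : IsTypeII S X) :
    abnormalSet S = h.isHeisenbergBasis.realization.ofPair '' {p | ∃ a b c : ℝ,
      p = h.isHeisenbergBasis.data.mul (h.isHeisenbergBasis.data.mul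
        (a • Pi.single 0 1, 0) (0, b)) (c • Pi.single 0 1, 0)} := by
  rw [_root_.abnormalSet_eq h.isHeisenbergBasis h.toIsFiliformBasis h.isTypeTwo.nilpotent,
    h.isTypeTwo.image_isAbnormal]

theorem abnormalSet_eq (h : IsTypeII S X) : abnormalSet S =
    {g | ∃ a b c : ℝ, g = lieExp (a • X 1) * lieExp (b • X 0) * lieExp (c • X 1)} := by
  rw [h.abnormalSet_eq_image]
  have h1 : ∀ a b c : ℝ, h.isHeisenbergBasis.realization.ofPair (h.isHeisenbergBasis.data.mul
      (h.isHeisenbergBasis.data.mul (a • Pi.single 0 1, 0) (0, b)) (c • Pi.single 0 1, 0)) =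
      lieExp (a • X 1) * lieExp (b • X 0) * lieExp (c • X 1) := fun a b c => by
    rw [HeisenbergData.Realization.ofPair_mul, HeisenbergData.Realization.ofPair_mul,
      IsHeisenbergBasis.ofPair_smul, IsHeisenbergBasis.ofPair_smul,
      IsHeisenbergBasis.ofPair_zero_left]
  ext g
  constructor
  · rintro ⟨_, ⟨a, b, c, rfl⟩, rfl⟩
    exact ⟨a, b, c, h1 a b c⟩
  · rintro ⟨a, b, c, rfl⟩
    exact ⟨_, ⟨a, b, c, rfl⟩, h1 a b c⟩

theorem mem_inExpCoordinates_iff (h : IsTypeII S X) (x : Fin (n + 2) → ℝ) :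
    x ∈ inExpCoordinates X (abnormalSet S) ↔ ∃ y : Fin 3 → ℝ,
      x = Fin.cons (y 1) (h.isHeisenbergBasis.data.abnormalPoint (Pi.single 0 1) n y) := by
  have h5 := h.five_le
  have h1 : lieExp (∑ i, x i • X i) = h.isHeisenbergBasis.realization.ofPair
      (h.isHeisenbergBasis.data.toSecondKind n (x 0) (Fin.tail x), x 0) := by
    rw [← h.isHeisenbergBasis.realization.expMap_lin h.D_pow_eq_zero,
      IsHeisenbergBasis.realization_lin, Fin.sum_univ_succ, add_comm]
    rfl
  rw [inExpCoordinates, mem_ofPred_eq, h1, h.abnormalSet_eq_image,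
    h.isHeisenbergBasis.realization.bijective_ofPair.1.mem_set_image, mem_ofPred_eq,
    HeisenbergData.exists_coords_iff _ _ h.D_pow_eq_zero (by omega)]
  refine exists_congr fun y => ?_
  constructor
  · rintro ⟨hv, ht⟩
    rw [← Fin.cons_self_tail x, hv, ht]
  · rintro rfl
    exact ⟨Fin.tail_cons _ _, Fin.cons_zero _ _⟩

theorem isConstructibleOfDim (h : IsTypeII S X) :
    IsConstructibleOfDim (inExpCoordinates X (abnormalSet S)) 3 := by
  have h5 := h.five_le
  have hN := h.D_pow_eq_zero
  have hpoly : ∀ i : Fin (n + 2), IsPolyFun fun y => (Fin.cons (y 1)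
      (h.isHeisenbergBasis.data.abnormalPoint (Pi.single 0 1) n y) : Fin (n + 2) → ℝ) i := by
    intro i
    refine Fin.cases ?_ (fun j => ?_) i
    · exact IsPolyFun.coord 1
    · exact HeisenbergData.isPolyMap_abnormalPoint _ _ hN (ContinuousLinearMap.proj j)
  choose P hP using hpoly
  have himage : inExpCoordinates X (abnormalSet S) = polyImage P := by
    ext x
    rw [h.mem_inExpCoordinates_iff]
    constructor
    · rintro ⟨y, rfl⟩
      exact ⟨y, funext fun i => (hP i y).symm⟩
    · rintro ⟨y, rfl⟩
      exact ⟨y, funext fun i => (hP i y).symm⟩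
  have hsingle : ∀ {j k : Fin (n + 1)}, j.val ≠ k.val →
      (ContinuousLinearMap.proj j : (Fin (n + 1) → ℝ) →L[ℝ] ℝ) (Pi.single k 1) = 0 := fun hjk => by
    simp [Pi.single_eq_of_ne fun h => hjk (congrArg Fin.val h)]
  have hD₀ := h.clm_comp_D_eq_zero (μ := ContinuousLinearMap.proj (0 : Fin (n + 1)))
    fun k hk _ => hsingle (by simp; omega)
  have hz : ∀ j : Fin (n + 1), j.val ≠ n →
      ContinuousLinearMap.proj (R := ℝ) (φ := fun _ => ℝ) j h.isHeisenbergBasis.data.z = 0 :=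
    fun j hj => hsingle hj
  have h1val : (1 : Fin (n + 1)).val = 1 := by
    rw [Fin.val_one', Nat.mod_eq_of_lt (by omega)]
  have hparam : IsAbnormalParam P 0 1 2 := by
    refine ⟨MvPolynomial.funext fun y => ?_, MvPolynomial.funext fun y => ?_,
      MvPolynomial.funext fun y => ?_, fun i hi y hy => ?_⟩
    · rw [← hP]; simp
    · rw [← hP]
      simpa using HeisenbergData.coord_abnormalPoint (e := Pi.single 0 1) hN (by omega) hD₀
        (hz 0 (by simp; omega)) (by simp) y
    · have h2 : (2 : Fin (n + 2)) = (1 : Fin (n + 1)).succ := by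
        refine Fin.ext ?_
        rw [Fin.val_succ, h1val]
        exact Nat.mod_eq_of_lt (show 2 < n + 2 by omega)
      rw [map_mul, ← hP, h2]
      simpa using HeisenbergData.coord_D_abnormalPoint (e := Pi.single 0 1) hN (by omega) hD₀
        (hz 0 (by simp; omega)) (by simp) (η := ContinuousLinearMap.proj (1 : Fin (n + 1)))
        h.D_apply_one (hz 1 (by omega)) (hsingle (by simp; omega)) y
    · rw [← hP]
      beta_reduce
      rw [HeisenbergData.abnormalPoint_of_eq_zero _ _ hN (by omega) y hy]
      revert hi
      refine Fin.cases (fun _ => hy) (fun j hj => ?_) i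
      have hj' : j ≠ 0 := fun h => hj (by rw [h]; rfl)
      simp [Pi.single_eq_of_ne hj']
  rw [himage]
  exact hparam.isConstructibleOfDim

end IsTypeII

end CarnotGroup

end

theorem theorem1p2
    {E : Type*} [NormedAddCommGroup E] [NormedSpace ℝ E] [FiniteDimensional ℝ E]
    {G : Type*} [TopologicalSpace G] [T2Space G] [ChartedSpace E G] [Group G]
    [LieGroup 𝓘(ℝ, E) ∞ G] [SimplyConnectedSpace G]
    {s : ℕ} (hs : 3 ≤ s) (S : Stratification (GroupLieAlgebra 𝓘(ℝ, E) G) s)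
    (X : Module.Basis (Fin (s + 1)) ℝ (GroupLieAlgebra 𝓘(ℝ, E) G)) :
    (IsTypeI S X → abnormalSet S = {g | ∃ t : ℝ, g = lieExp (t • X 1)}) ∧
    (IsTypeII S X →
      abnormalSet S =
        {g | ∃ a b c : ℝ, g = lieExp (a • X 1) * lieExp (b • X 0) * lieExp (c • X 1)} ∧
      IsConstructibleOfDim (inExpCoordinates X (abnormalSet S)) 3) := by
  obtain ⟨n, rfl⟩ := Nat.exists_eq_add_of_le' (Nat.le_of_succ_le (Nat.le_of_succ_le hs))
  exact ⟨fun h => h.abnormalSet_eq (by omega), fun h => ⟨h.abnormalSet_eq, h.isConstructibleOfDim⟩⟩
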